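/- Let $M$ be a compact (connected, boundaryless, smooth) Riemannian manifold with its Riemannian distance $d$, let $\Psi=\{\Psi_t\}_{t\in\mathbb R}$ be a differentiable flow on $M$ (that is, $(t,x)\mapsto\Psi_t(x)$ is $C^1$), and let $\nu$ be a $\Psi$-invariant Borel probability measure on $M$. For $x\in M$ and $r>0$ let $B(x,r)$ be the open ball, and put $$\eta_r(x)=\inf\{t>0:\Psi_tx\notin B(x,r)\},\qquad \tau_r^\Psi(x)=\inf\{t>\eta_r(x):\Psi_tx\in B(x,r)\},$$ $$\underline R^\Psi(x)=\liminf_{r\to0}\frac{\log\tau_r^\Psi(x)}{-\log r},\qquad \overline R^\Psi(x)=\limsup_{r\to0}\frac{\log\tau_r^\Psi(x)}{-\log r},$$ $$\underline d_\nu(x)=\liminf_{r\to0}\frac{\log\nu(B(x,r))}{\log r},\qquad \overline d_\nu(x)=\limsup_{r\to0}\frac{\log\nu(B(x,r))}{\log r}.$$ Let $X$ be a metric space with a Borel probability measure $\mu$, let $T:X\to X$ be measurable and $\mu$-preserving, and let $\phi:X\to(0,\infty)$ be measurable and $\mu$-integrable. Let $Y=\{(u,s):u\in X,\ 0\le s\le\phi(u)\}$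 with $(u,\phi(u))$ and $(Tu,0)$ identified, let $\Phi_t(u,s)=(u,s+t)$ ($t\ge0$, modulo the identifications) be the suspension flow, and let $\nu_\mu$ be $\mu\otimes\mathrm{Leb}$ on $Y$ normalized to a probability measure. Equip $Y$ with the Bowen--Walters distance: after normalizing heights to $(u,s/\phi(u))$, it is the infimum of the lengths of finite chains of horizontal segments, from $(u,s)$ to $(v,s)$, of length $(1-s)d(u,v)+s\,d(Tu,Tv)$, and vertical segments, from $(u,s)$ to $(u,s')$, of length $|s-s'|$. Suppose that: 1. $T$ has super-polynomial decay of correlations: there is a sequence $(\theta_n)$ with $n^k\theta_n\to0$ for all $k>0$ such that, for all bounded Lipschitz functions $\varphi_1,\varphi_2:X\to\mathbb R$ and all $n\ge1$, $$\left|\int\varphi_1\circ T^n\,\varphi_2\,d\mu-\int\varphi_1\,d\mu\int\varphi_2\,d\mu\right|\le\|\varphi_1\|\,\|\varphi_2\|\,\theta_n,$$ where $\|\varphi\|=\sup|\varphi|+\mathrm{Lip}(\varphi)$; 2. $(M,\Psi,\nu)$ is metrically isomorphic to $(Y,\Phi,\nu_\mu)$ through a map $g:Y\to M$: $g$ is measurable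 with $g_*\nu_\mu=\nu$, and it restricts to a bijection from a set $Y'$ of full $\nu_\mu$-measure, with $\Phi_t(Y')\subset Y'$ for $t\ge0$, onto a set $M'$ of full $\nu$-measure, such that $\Psi_t\circ g=g\circ\Phi_t$ on $Y'$ for all $t\ge0$ and $\nu(g(B))=\nu_\mu(B)$ for every measurable $B\subset Y'$; 3. $g$ is Lipschitz on $Y$ for the Bowen--Walters distance. Then $$\underline R^\Psi(x)=\underline d_\nu(x)-1\qquad\text{and}\qquad\overline R^\Psi(x)=\overline d_\nu(x)-1$$ for $\nu$-almost every $x\in M$ which is not periodic (i.e. $\Psi_tx\ne x$ for all $t>0$) and such that $\underline d_\nu(x)>1$. -/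

import Mathlib

open MeasureTheory Filter Set Bundle
open scoped ENNReal NNReal Topology Manifold ContDiff

noncomputable section

namespace FlowRecurrence

/-! ### Return times, recurrence rates and local dimensions -/

section Recurrence

variable {M : Type*} [MetricSpace M]

/-- First escape time of `x` from the open ball of radius `r` around it,
`inf {t > 0 | Ψ_t x ∉ B(x, r)}`, with `inf ∅ = ∞`. -/
def escapeTime (Ψ : Flow ℝ M) (r : ℝ) (x : M) : ℝ≥0∞ :=
  ⨅ (t : ℝ) (_ : 0 < t) (_ : Ψ t x ∉ Metric.ball x r), ENNReal.ofReal t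

/-- Return time: the infimum of the times `t`, larger than the escape time, such that
`Ψ_t x ∈ B(x, r)`, with `inf ∅ = ∞`. -/
def returnTime (Ψ : Flow ℝ M) (r : ℝ) (x : M) : ℝ≥0∞ :=
  ⨅ (t : ℝ) (_ : escapeTime Ψ r x < ENNReal.ofReal t) (_ : Ψ t x ∈ Metric.ball x r),
    ENNReal.ofReal t

/-- `liminf_{r → 0+} log τ_r(x) / (- log r)`, in the extended reals. -/
def lowerRecurrenceRate (Ψ : Flow ℝ M) (x : M) : EReal :=
  liminf (fun r : ℝ => ENNReal.log (returnTime Ψ r x) / ((-Real.log r : ℝ) : EReal)) (𝓝[>] 0)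

/-- `limsup_{r → 0+} log τ_r(x) / (- log r)`, in the extended reals. -/
def upperRecurrenceRate (Ψ : Flow ℝ M) (x : M) : EReal :=
  limsup (fun r : ℝ => ENNReal.log (returnTime Ψ r x) / ((-Real.log r : ℝ) : EReal)) (𝓝[>] 0)

/-- `liminf_{r → 0+} log ν(B(x, r)) / log r`, in the extended reals. -/
def lowerLocalDim [MeasurableSpace M] (ν : Measure M) (x : M) : EReal :=
  liminf (fun r : ℝ => ENNReal.log (ν (Metric.ball x r)) / ((Real.log r : ℝ) : EReal)) (𝓝[>] 0)

/-- `limsup_{r → 0+} log ν(B(x, r)) / log r`, in the extended reals. -/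
def upperLocalDim [MeasurableSpace M] (ν : Measure M) (x : M) : EReal :=
  limsup (fun r : ℝ => ENNReal.log (ν (Metric.ball x r)) / ((Real.log r : ℝ) : EReal)) (𝓝[>] 0)

end Recurrence

/-! ### Suspension flows -/

section Suspension

variable {X : Type*}

/-- The space under the roof `φ`. The points `(u, φ u)` and `(T u, 0)` are identified in the
suspension space, so that each of its points has exactly one representative `(u, s)` with
`0 ≤ s < φ u`; the suspension space is this set of representatives. -/
def suspensionSpace (φ : X → ℝ) : Set (X × ℝ) :=
  {p | 0 ≤ p.2 ∧ p.2 < φ p.1}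

/-- The number of times the roof is crossed when one climbs to the height `a ≥ 0` above `u`:
the largest `n` with `φ u + φ (T u) + ⋯ + φ (T^(n-1) u) ≤ a`. -/
def lapNumber (T : X → X) (φ : X → ℝ) (u : X) (a : ℝ) : ℕ :=
  sSup {n : ℕ | birkhoffSum T φ n u ≤ a}

/-- The suspension flow at time `t ≥ 0`: `(u, s) ↦ (u, s + t)`, modulo the identifications
`(u, φ u) = (T u, 0)`, that is, brought back to the representative under the roof. -/
def suspensionFlow (T : X → X) (φ : X → ℝ) (t : ℝ) (p : X × ℝ) : X × ℝ :=
  (T^[lapNumber T φ p.1 (p.2 + t)] p.1,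
    p.2 + t - birkhoffSum T φ (lapNumber T φ p.1 (p.2 + t)) p.1)

/-- The measure `μ ⊗ Leb` on the suspension space, normalized to a probability measure. -/
def suspensionMeasure [MeasurableSpace X] (μ : Measure X) (φ : X → ℝ) : Measure (X × ℝ) :=
  ProbabilityTheory.cond (μ.prod volume) (suspensionSpace φ)

/-- `BWChain T p q ℓ`: in the suspension space over `T` with roof `1`, seen as `X × [0, 1]` with
`(u, 1)` and `(T u, 0)` identified, there is a finite chain of horizontal and vertical segments
of total length `ℓ` from `p` to `q`. The horizontal segment between `(u, s)` and `(v, s)` has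
length `(1 - s) d(u, v) + s d(T u, T v)`; the vertical one between `(u, s)` and `(u, s')` has
length `|s - s'|`. -/
inductive BWChain [MetricSpace X] (T : X → X) : X × ℝ → X × ℝ → ℝ → Prop
  | nil (p : X × ℝ) : BWChain T p p 0
  | horizontal {u v : X} {s : ℝ} {q : X × ℝ} {ℓ : ℝ} (hs : 0 ≤ s) (hs' : s ≤ 1)
      (h : BWChain T (v, s) q ℓ) :
      BWChain T (u, s) q ((1 - s) * dist u v + s * dist (T u) (T v) + ℓ)
  | vertical {u : X} {s s' : ℝ} {q : X × ℝ} {ℓ : ℝ} (hs0 : 0 ≤ s) (hs1 : s ≤ 1)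
      (hs0' : 0 ≤ s') (hs1' : s' ≤ 1) (h : BWChain T (u, s') q ℓ) :
      BWChain T (u, s) q (|s - s'| + ℓ)
  | glue_up {u : X} {q : X × ℝ} {ℓ : ℝ} (h : BWChain T (T u, 0) q ℓ) : BWChain T (u, 1) q ℓ
  | glue_down {u : X} {q : X × ℝ} {ℓ : ℝ} (h : BWChain T (u, 1) q ℓ) : BWChain T (T u, 0) q ℓ

/-- The Bowen-Walters distance on the suspension space over `T` with roof `φ`: heights are
normalized by `φ`, and one takes the infimum of the lengths of the chains between the normalized
points. -/
def bwDist [MetricSpace X] (T : X → X) (φ : X → ℝ) (p q : X × ℝ) : ℝ :=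
  sInf {ℓ : ℝ | BWChain T (p.1, p.2 / φ p.1) (q.1, q.2 / φ q.1) ℓ}

/-- Super-polynomial decay of correlations for Lipschitz observables: here `B i + K i`, with `B i`
a bound of `|f i|` and `K i` a Lipschitz constant of `f i`, is any upper bound of the Lipschitz
norm `sup |f i| + Lip (f i)` of this form. -/
def SuperPolynomialDecay [MetricSpace X] [MeasurableSpace X] (T : X → X) (μ : Measure X) : Prop :=
  ∃ θ : ℕ → ℝ, (∀ k : ℕ, Tendsto (fun n : ℕ => (n : ℝ) ^ k * θ n) atTop (𝓝 0)) ∧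
    ∀ (f₁ f₂ : X → ℝ) (B₁ B₂ K₁ K₂ : ℝ≥0),
      LipschitzWith K₁ f₁ → LipschitzWith K₂ f₂ → (∀ u, |f₁ u| ≤ B₁) → (∀ u, |f₂ u| ≤ B₂) →
      ∀ n : ℕ, 1 ≤ n →
        |(∫ u, f₁ (T^[n] u) * f₂ u ∂μ) - (∫ u, f₁ u ∂μ) * (∫ u, f₂ u ∂μ)|
          ≤ (B₁ + K₁) * (B₂ + K₂) * θ n

/-- `g` is a metric isomorphism from the suspension flow over `(X, T, μ)` with roof `φ` to the
flow `(M, Ψ, ν)`: it carries the normalized measure on the suspension space to `ν`, and it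
restricts to a bijection from a set of full measure `Y'`, stable under the suspension flow, to a
set of full measure `M'`, which conjugates the two flows and preserves the measure of sets in both
directions. -/
structure IsSuspensionIsomorphism {M : Type*} [MetricSpace M] [MeasurableSpace M]
    [MeasurableSpace X] (Ψ : Flow ℝ M) (ν : Measure M) (T : X → X) (φ : X → ℝ) (μ : Measure X)
    (g : X × ℝ → M) : Prop where
  aemeasurable : AEMeasurable g (suspensionMeasure μ φ)
  map_eq : (suspensionMeasure μ φ).map g = ν
  exists_conj : ∃ (Y' : Set (X × ℝ)) (M' : Set M),
    Y' ⊆ suspensionSpace φ ∧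
    (∀ᵐ y ∂(suspensionMeasure μ φ), y ∈ Y') ∧
    (∀ᵐ x ∂ν, x ∈ M') ∧
    BijOn g Y' M' ∧
    (∀ t : ℝ, 0 ≤ t → MapsTo (suspensionFlow T φ t) Y' Y') ∧
    (∀ t : ℝ, 0 ≤ t → ∀ y ∈ Y', Ψ t (g y) = g (suspensionFlow T φ t y)) ∧
    (∀ B ⊆ Y', MeasurableSet B → ν (g '' B) = suspensionMeasure μ φ B)

/-- `g` is Lipschitz on the suspension space, for the Bowen-Walters distance. -/
def IsBWLipschitz {M : Type*} [MetricSpace M] [MetricSpace X] (T : X → X) (φ : X → ℝ)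
    (g : X × ℝ → M) : Prop :=
  ∃ L : ℝ≥0, ∀ y ∈ suspensionSpace φ, ∀ y' ∈ suspensionSpace φ,
    dist (g y) (g y') ≤ L * bwDist T φ y y'

end Suspension

end FlowRecurrence

end

/-! Up to factors `r ^ η`, the return time of a typical `x` to `B(x, r)` is `r / ν(B(x, r))`: the
orbit leaves a non-fixed point at positive speed, so a visit to the ball lasts a time of order `r`.
Dividing logarithms by `-log r` gives the local dimension minus one.

The upper bound on the return time uses only the invariance of `ν`. If `D` is the set of points of
an open set `U` that avoid `U` during `(h / 2, t)`, the preimages of `D` at the multiples of `h`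
below `t` are disjoint, whence `ν D ≤ h / t` (`measure_no_return_le`). With `h` of order `r` and `t`
slightly larger than `r / ν(B)`, a covering of bounded multiplicity (`measure_inter_preimage_le`)
and Borel-Cantelli produce the return (`ae_eventually_exists_return`).

The lower bound uses decay of correlations. Reading the base of the suspension in `M` gives a
Lipschitz section `F u = g (u, 0)`. If an orbit starting over `u` near `z` is near `z` again during
lap `n`, then `F u` and `F (T^n u)` both lie in a tube of width of order `r` around a piece of
backward orbit of `z`. This piece has bounded length, because positive speed at `z` and the
Lipschitz bound on fibres bound the roof there. The tube has `μ`-measure at most `ρ(B(z, Λ r)) / r`,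
where `ρ` is the law obtained by flowing the section for a bounded time, so the event has measure at
most a constant times `ρ(B) ^ 2 / r + |θ n| / r` (`measure_lapReturn_inter_ball_le`).

Summing over the laps `n` with `n ρ(B) / r` small and over a cover gives a summable bound as long as
`n` exceeds a small power of `1 / r`, where `θ n` is negligible. For smaller laps, dimension larger
than one makes `ρ(B) / r` a power of `r`, and each dyadic block of laps is tested at a scale
polynomial in the lap. Bounded times are excluded by nonperiodicity. Laps become times because `φ +
⋯ + φ ∘ T^(2^i - 1)` eventually exceeds `β ^ i` for every `β < 2` (`ae_eventually_lt_birkhoffSum`),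
and `ρ` gives way to `ν` at almost every point (`ae_eventually_measure_ball_le`).

It remains to see that no spurious return occurs just after the escape from the ball. This is the
monotonicity in `IsRegularAt`; it follows from the `C¹` dependence of the metric on the point,
through `exists_dist_homothety_le`. -/

noncomputable section

namespace FlowRecurrence

open Manifold

/-! ### The Riemannian distance read in charts. -/

/-- A field of norms whose squares are given by a `C¹` field of bilinear forms, uniformly
nondegenerate near a point, is uniformly equivalent to the ambient norm and Lipschitz, in the
multiplicative sense, near this point. -/
lemma exists_bounds_of_contDiffAt_metric {E : Type*} [NormedAddCommGroup E] [NormedSpace ℝ E]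
    {N : E → E → ℝ} (hN0 : ∀ y v, 0 ≤ N y v) {G : E → E →L[ℝ] E →L[ℝ] ℝ} {a : E}
    (hG : ContDiffAt ℝ 1 G a) (hGN : ∀ᶠ y in 𝓝 a, ∀ v, G y v v = N y v ^ 2)
    {C₂ : ℝ} (hC₂ : 0 < C₂) (hlow : ∀ᶠ y in 𝓝 a, ∀ v, ‖v‖ ≤ C₂ * N y v) :
    ∃ r > 0, ∃ C > 0, ∃ K > 0,
      (∀ y ∈ Metric.ball a r, ∀ v, N y v ≤ C * ‖v‖ ∧ ‖v‖ ≤ C * N y v) ∧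
      (∀ y ∈ Metric.ball a r, ∀ y' ∈ Metric.ball a r, ∀ v,
        N y' v ≤ (1 + K * ‖y' - y‖) * N y v) := by
  let : SeminormedAddCommGroup (E →L[ℝ] E →L[ℝ] ℝ) :=
    ContinuousLinearMap.toSeminormedAddCommGroup
  obtain ⟨K₁, t, ht, hlip⟩ := hG.exists_lipschitzOnWith
  have h3 : ∀ᶠ y in 𝓝 a, ‖G y‖ < ‖G a‖ + 1 :=
    (hG.continuousAt.eventually (Metric.ball_mem_nhds (G a) one_pos)).mono
      fun y hy => norm_lt_of_mem_ball hy
  obtain ⟨r, hr, hball⟩ := Metric.eventually_nhds_iff_ball.1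
    ((hGN.and (hlow.and h3)).and ht)
  have hlow : ∀ y ∈ Metric.ball a r, ∀ v, ‖v‖ ≤ C₂ * N y v := fun y hy => (hball y hy).1.2.1
  have hupp : ∀ y ∈ Metric.ball a r, ∀ v, N y v ≤ (‖G a‖ + 1) * ‖v‖ := by
    intro y hy v
    have e := (hball y hy).1.1 v
    have h6 : G y v v ≤ (‖G a‖ + 1) * ‖v‖ ^ 2 := by
      calc G y v v ≤ ‖G y v v‖ := Real.le_norm_self _
        _ ≤ ‖G y‖ * ‖v‖ * ‖v‖ := ContinuousLinearMap.le_opNorm₂ _ _ _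
        _ ≤ (‖G a‖ + 1) * ‖v‖ * ‖v‖ := by gcongr; exact (hball y hy).1.2.2.le
        _ = _ := by ring
    rw [e] at h6
    -- The factor `‖G a‖ + 1` bounds the square; being at least 1, it is at most its own square, so
    -- it also bounds the norm.
    apply le_of_sq_le_sq _ (by positivity)
    rw [mul_pow]
    refine h6.trans ?_
    gcongr
    nlinarith [norm_nonneg (G a)]
  -- `K₁ * C₂ ^ 2` is the Lipschitz constant of `G` measured with `N y` instead of the ambient norm;
  -- the added 1 makes it positive.
  refine ⟨r, hr, max C₂ (‖G a‖ + 1), lt_max_of_lt_left hC₂, K₁ * C₂ ^ 2 + 1, by positivity,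
    fun y hy v => ⟨?_, ?_⟩, fun y hy y' hy' v => ?_⟩
  · refine (hupp y hy v).trans ?_
    gcongr; exact le_max_right _ _
  · refine (hlow y hy v).trans ?_
    gcongr
    · exact hN0 y v
    · exact le_max_left _ _
  · have hd : ‖G y' - G y‖ ≤ K₁ * ‖y' - y‖ := hlip.norm_sub_le (hball y' hy').2 (hball y hy).2
    have h7 : G y' v v ≤ (1 + (K₁ * C₂ ^ 2 + 1) * ‖y' - y‖) * N y v ^ 2 := by
      have h8 : G y' v v = G y v v + (G y' - G y) v v := by simp
      have h9 : (G y' - G y) v v ≤ (K₁ * ‖y' - y‖) * ‖v‖ * ‖v‖ := by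
        calc (G y' - G y) v v ≤ ‖(G y' - G y) v v‖ := Real.le_norm_self _
          _ ≤ ‖G y' - G y‖ * ‖v‖ * ‖v‖ := ContinuousLinearMap.le_opNorm₂ _ _ _
          _ ≤ _ := by gcongr
      have h10 : (K₁ * ‖y' - y‖) * ‖v‖ * ‖v‖ ≤
          (K₁ * ‖y' - y‖) * (C₂ * N y v) * (C₂ * N y v) := by
        have := hlow y hy v
        have hN := mul_nonneg hC₂.le (hN0 y v)
        gcongr
      rw [h8, (hball y hy).1.1 v]
      have h11 : 0 ≤ ‖y' - y‖ * N y v ^ 2 := by positivity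
      nlinarith
    rw [(hball y' hy').1.1 v] at h7
    have hpos : 0 ≤ (K₁ * C₂ ^ 2 + 1) * ‖y' - y‖ := by positivity
    apply le_of_sq_le_sq _ (mul_nonneg (by linarith) (hN0 y v))
    rw [mul_pow]
    refine h7.trans ?_
    gcongr
    nlinarith

section Geometry

set_option linter.unusedSectionVars false

variable {m : ℕ} {M : Type*} [MetricSpace M]
    [ChartedSpace (EuclideanSpace ℝ (Fin m)) M] [IsManifold (𝓡 m) ∞ M]
    [RiemannianBundle (fun x : M => TangentSpace (𝓡 m) x)]

/-- The norm, in the tangent space of `M`, of the vector with coordinates `v` in the chart at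
`x₀`, at the point with coordinates `y`. -/
def chartNorm (x₀ : M) (y v : EuclideanSpace ℝ (Fin m)) : ℝ :=
  ‖mfderiv 𝓘(ℝ, EuclideanSpace ℝ (Fin m)) (𝓡 m) (extChartAt (𝓡 m) x₀).symm y v‖

lemma chartNorm_smul (x₀ : M) (y v : EuclideanSpace ℝ (Fin m)) (a : ℝ) :
    chartNorm x₀ y (a • v) = |a| * chartNorm x₀ y v := by
  unfold chartNorm
  have := (mfderiv 𝓘(ℝ, EuclideanSpace ℝ (Fin m)) (𝓡 m) (extChartAt (𝓡 m) x₀).symm y).map_smul a v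
  rw [← Real.norm_eq_abs, ← norm_smul]
  congr 1

/-- In the trivialization of the tangent bundle at `x₀` the metric has smooth coordinates, by the
definition of a smooth Riemannian bundle. The inverse of this trivialization is the derivative of
the inverse chart, so the diagonal values are squares of `chartNorm`. -/
lemma exists_contDiffAt_metric
    [IsContMDiffRiemannianBundle (𝓡 m) ∞ (EuclideanSpace ℝ (Fin m))
      (fun x : M => TangentSpace (𝓡 m) x)] (x₀ : M) :
    ∃ G : EuclideanSpace ℝ (Fin m) →
        EuclideanSpace ℝ (Fin m) →L[ℝ] EuclideanSpace ℝ (Fin m) →L[ℝ] ℝ,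
      ContDiffAt ℝ 1 G (extChartAt (𝓡 m) x₀ x₀) ∧
      ∀ᶠ y in 𝓝 (extChartAt (𝓡 m) x₀ x₀), ∀ v, G y v v = chartNorm x₀ y v ^ 2 := by
  obtain ⟨g, hg, hgi⟩ := (inferInstance : IsContMDiffRiemannianBundle (𝓡 m) ∞
    (EuclideanSpace ℝ (Fin m)) (fun x : M => TangentSpace (𝓡 m) x)).exists_contMDiff
  have W := hg x₀
  rw [contMDiffAt_hom_bundle] at W
  have h1 := W.2
  set E := EuclideanSpace ℝ (Fin m)
  set g' : M → E →L[ℝ] E →L[ℝ] ℝ := fun y ↦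
    ContinuousLinearMap.inCoordinates E (fun x : M => TangentSpace (𝓡 m) x) (E →L[ℝ] ℝ)
      (fun x ↦ TangentSpace (𝓡 m) x →L[ℝ] ℝ) x₀ y x₀ y (g y) with hg'
  have h1 : ContMDiffAt (𝓡 m) 𝓘(ℝ, E →L[ℝ] E →L[ℝ] ℝ) 1 g' x₀ := h1.of_le (by norm_num)
  have hsymm : ContMDiffAt 𝓘(ℝ, E) (𝓡 m) 1 (extChartAt (𝓡 m) x₀).symm
      (extChartAt (𝓡 m) x₀ x₀) := by
    have : IsManifold (𝓡 m) 1 M := IsManifold.of_le (n := ∞) (by norm_num)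
    exact (contMDiffOn_extChartAt_symm x₀).contMDiffAt (extChartAt_target_mem_nhds x₀)
  refine ⟨g' ∘ (extChartAt (𝓡 m) x₀).symm, ?_, ?_⟩
  · rw [← contMDiffAt_iff_contDiffAt]
    refine ContMDiffAt.comp _ ?_ hsymm
    simpa using h1
  · filter_upwards [extChartAt_target_mem_nhds (I := 𝓡 m) x₀] with y hy v
    have hs : (extChartAt (𝓡 m) x₀).symm y ∈ (chartAt E x₀).source := by
      simpa using (extChartAt (𝓡 m) x₀).map_target hy
    have : IsManifold (𝓡 m) 1 M := IsManifold.of_le (n := ∞) (by norm_num)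
    have key := TangentBundle.symmL_trivializationAt (I := 𝓡 m) hs
    rw [(extChartAt (𝓡 m) x₀).right_inv hy, ModelWithCorners.range_eq_univ,
      mfderivWithin_univ] at key
    simp only [Function.comp_apply, hg']
    rw [inCoordinates_apply_eq₂ (by simpa using hs) (by simpa using hs)
      (Set.mem_univ _)]
    unfold chartNorm
    rw [← key, ← real_inner_self_eq_norm_sq, hgi]
    have e := Trivialization.symmL_apply (R := ℝ)
      (trivializationAt E (fun x : M => TangentSpace (𝓡 m) x) x₀)
      (show (extChartAt (𝓡 m) x₀).symm y ∈ _ by simpa using hs) v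
    erw [e]
    simp

/-- Nondegeneracy comes from the local bound on the trivializations of a continuous Riemannian
bundle; the other bounds come from the `C¹` regularity of the metric in the chart. -/
lemma exists_chartNorm_bounds
    [IsContMDiffRiemannianBundle (𝓡 m) ∞ (EuclideanSpace ℝ (Fin m))
      (fun x : M => TangentSpace (𝓡 m) x)] (x₀ : M) :
    ∃ r > 0, ∃ C > 0, ∃ K > 0,
      Metric.ball (extChartAt (𝓡 m) x₀ x₀) r ⊆ (extChartAt (𝓡 m) x₀).target ∧
      (∀ y ∈ Metric.ball (extChartAt (𝓡 m) x₀ x₀) r, ∀ v,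
        chartNorm x₀ y v ≤ C * ‖v‖ ∧ ‖v‖ ≤ C * chartNorm x₀ y v) ∧
      (∀ y ∈ Metric.ball (extChartAt (𝓡 m) x₀ x₀) r,
        ∀ y' ∈ Metric.ball (extChartAt (𝓡 m) x₀ x₀) r, ∀ v,
        chartNorm x₀ y' v ≤ (1 + K * ‖y' - y‖) * chartNorm x₀ y v) := by
  have : IsManifold (𝓡 m) 1 M := IsManifold.of_le (n := ∞) (by norm_num)
  obtain ⟨G, hG, hGN⟩ := exists_contDiffAt_metric (m := m) x₀
  have : IsContMDiffRiemannianBundle (𝓡 m) 0 (EuclideanSpace ℝ (Fin m))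
      (fun x : M => TangentSpace (𝓡 m) x) :=
    IsContMDiffRiemannianBundle.of_le (n := ∞) (by norm_num)
  have : IsContinuousRiemannianBundle (EuclideanSpace ℝ (Fin m))
      (fun x : M => TangentSpace (𝓡 m) x) := by
    obtain ⟨g, hg, hgi⟩ := this.exists_contMDiff
    exact ⟨g, hg.continuous, hgi⟩
  obtain ⟨C₂, hC₂, h2⟩ := eventually_norm_trivializationAt_lt (EuclideanSpace ℝ (Fin m))
    (fun x : M => TangentSpace (𝓡 m) x) x₀
  have hcont := (continuousAt_extChartAt_symm (I := 𝓡 m) x₀).tendsto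
  rw [extChartAt_to_inv] at hcont
  have hlow : ∀ᶠ y in 𝓝 (extChartAt (𝓡 m) x₀ x₀), ∀ v, ‖v‖ ≤ C₂ * chartNorm x₀ y v := by
    filter_upwards [hcont.eventually h2, extChartAt_target_mem_nhds (I := 𝓡 m) x₀]
      with y hy hyt v
    have hs : (extChartAt (𝓡 m) x₀).symm y ∈ (chartAt (EuclideanSpace ℝ (Fin m)) x₀).source := by
      simpa using (extChartAt (𝓡 m) x₀).map_target hyt
    have key := TangentBundle.symmL_trivializationAt (I := 𝓡 m) hs
    rw [(extChartAt (𝓡 m) x₀).right_inv hyt, ModelWithCorners.range_eq_univ,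
      mfderivWithin_univ] at key
    unfold chartNorm
    rw [← key]
    have h5 := ContinuousLinearMap.le_of_opNorm_le _ hy.le (Trivialization.symmL ℝ
      (trivializationAt (EuclideanSpace ℝ (Fin m)) (fun x : M => TangentSpace (𝓡 m) x) x₀)
      ((extChartAt (𝓡 m) x₀).symm y) v)
    rwa [Trivialization.continuousLinearMapAt_symmL _ (by simpa using hs)] at h5
  obtain ⟨r, hr, C, hC, K, hK, h⟩ := exists_bounds_of_contDiffAt_metric
    (fun y v => norm_nonneg _) hG hGN hC₂ hlow
  obtain ⟨r', hr', hball⟩ := Metric.mem_nhds_iff.1 (extChartAt_target_mem_nhds (I := 𝓡 m) x₀)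
  have hsub : Metric.ball (extChartAt (𝓡 m) x₀ x₀) (min r r') ⊆
      Metric.ball (extChartAt (𝓡 m) x₀ x₀) r := Metric.ball_subset_ball (min_le_left _ _)
  exact ⟨min r r', lt_min hr hr', C, hC, K, hK,
    (Metric.ball_subset_ball (min_le_right _ _)).trans hball,
    fun y hy => h.1 y (hsub hy), fun y hy y' hy' => h.2 y (hsub hy) y' (hsub hy')⟩

/-- The length of a path contained in a chart domain, computed in the chart. -/
lemma pathELength_extChartAt_symm (x₀ : M) {c : ℝ → EuclideanSpace ℝ (Fin m)}
    (hc : ContDiffOn ℝ 1 c (Icc 0 1))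
    (hct : ∀ t ∈ Icc (0 : ℝ) 1, c t ∈ (extChartAt (𝓡 m) x₀).target) :
    pathELength (𝓡 m) ((extChartAt (𝓡 m) x₀).symm ∘ c) 0 1 =
      ∫⁻ t in Icc (0 : ℝ) 1, ENNReal.ofReal (chartNorm x₀ (c t) (derivWithin c (Icc 0 1) t)) := by
  have : IsManifold (𝓡 m) 1 M := IsManifold.of_le (n := ∞) (by norm_num)
  rw [pathELength_eq_lintegral_mfderivWithin_Icc]
  apply setLIntegral_congr_fun measurableSet_Icc (fun t ht ↦ ?_)
  have hsm : MDifferentiableAt 𝓘(ℝ, EuclideanSpace ℝ (Fin m)) (𝓡 m)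
      (extChartAt (𝓡 m) x₀).symm (c t) := by
    have := mdifferentiableWithinAt_extChartAt_symm (I := 𝓡 m) (hct t ht)
    rwa [ModelWithCorners.range_eq_univ, mdifferentiableWithinAt_univ] at this
  have hcd : DifferentiableWithinAt ℝ c (Icc 0 1) t := hc.differentiableOn one_ne_zero t ht
  have hu : UniqueMDiffWithinAt 𝓘(ℝ) (Icc (0 : ℝ) 1) t := by
    rw [uniqueMDiffWithinAt_iff_uniqueDiffWithinAt]
    exact uniqueDiffOn_Icc zero_lt_one t ht
  have h1 := mfderiv_comp_mfderivWithin t hsm hcd.mdifferentiableWithinAt hu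
  have h2 := congr($h1 1)
  unfold chartNorm
  rw [ofReal_norm]
  congr 1
  rw [h2, ContinuousLinearMap.comp_apply, mfderivWithin_eq_fderivWithin]
  rfl

end Geometry

section ChartGeometry

variable {m : ℕ} {M : Type*} [MetricSpace M]
    [ChartedSpace (EuclideanSpace ℝ (Fin m)) M] [IsManifold (𝓡 m) ∞ M]
    [RiemannianBundle (fun x : M => TangentSpace (𝓡 m) x)]
    [IsRiemannianManifold (𝓡 m) M]

lemma edist_le_of_chart_path (x₀ : M) {c : ℝ → EuclideanSpace ℝ (Fin m)}
    (hc : ContDiffOn ℝ 1 c (Icc 0 1))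
    (hct : ∀ t ∈ Icc (0 : ℝ) 1, c t ∈ (extChartAt (𝓡 m) x₀).target) :
    edist ((extChartAt (𝓡 m) x₀).symm (c 0)) ((extChartAt (𝓡 m) x₀).symm (c 1)) ≤
      ∫⁻ t in Icc (0 : ℝ) 1, ENNReal.ofReal (chartNorm x₀ (c t) (derivWithin c (Icc 0 1) t)) := by
  have : IsManifold (𝓡 m) 1 M := IsManifold.of_le (n := ∞) (by norm_num)
  rw [IsRiemannianManifold.out (I := 𝓡 m), ← pathELength_extChartAt_symm x₀ hc hct]
  apply riemannianEDist_le_pathELength _ rfl rfl zero_le_one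
  exact (contMDiffOn_extChartAt_symm x₀).comp hc.contMDiffOn hct

/-- A path of length less than `ρ / 2` starting within `ρ / 2` of `x₀` never leaves the ball of
radius `ρ`, hence stays in the chart. This makes the intrinsic distance computable in coordinates.
-/
lemma exists_chart_path (x₀ : M) {r : ℝ} (hr : 0 < r) :
    ∃ ρ > 0, ∀ p ∈ Metric.ball x₀ ρ, ∀ q : M, ∀ ℓ ≤ ρ, dist p q < ℓ →
      ∃ c : ℝ → EuclideanSpace ℝ (Fin m), ContDiffOn ℝ 1 c (Icc 0 1) ∧
        (∀ t ∈ Icc (0 : ℝ) 1, c t ∈ Metric.ball (extChartAt (𝓡 m) x₀ x₀) r) ∧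
        c 0 = extChartAt (𝓡 m) x₀ p ∧ c 1 = extChartAt (𝓡 m) x₀ q ∧
        ∫⁻ t in Icc (0 : ℝ) 1,
          ENNReal.ofReal (chartNorm x₀ (c t) (derivWithin c (Icc 0 1) t)) < ENNReal.ofReal ℓ := by
  have : IsManifold (𝓡 m) 1 M := IsManifold.of_le (n := ∞) (by norm_num)
  have hnhds : (extChartAt (𝓡 m) x₀).source ∩
      extChartAt (𝓡 m) x₀ ⁻¹' Metric.ball (extChartAt (𝓡 m) x₀ x₀) r ∈ 𝓝 x₀ :=
    inter_mem (extChartAt_source_mem_nhds x₀)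
      ((continuousAt_extChartAt x₀).preimage_mem_nhds (Metric.ball_mem_nhds _ hr))
  obtain ⟨ρ, hρ, hball⟩ := Metric.mem_nhds_iff.1 hnhds
  refine ⟨ρ / 2, by positivity, fun p hp q ℓ hℓ hpq => ?_⟩
  have hlt : riemannianEDist (𝓡 m) p q < ENNReal.ofReal ℓ := by
    rw [← IsRiemannianManifold.out (I := 𝓡 m), edist_dist]
    exact (ENNReal.ofReal_lt_ofReal_iff_of_nonneg dist_nonneg).2 hpq
  obtain ⟨γ, h0, h1, hγ, hlen⟩ := exists_lt_of_riemannianEDist_lt hlt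
  have hmem : ∀ t ∈ Icc (0 : ℝ) 1, γ t ∈ Metric.ball x₀ ρ := by
    intro t ht
    have h2 : edist p (γ t) < ENNReal.ofReal ℓ := by
      rw [IsRiemannianManifold.out (I := 𝓡 m)]
      refine lt_of_le_of_lt (riemannianEDist_le_pathELength (hγ.mono (Icc_subset_Icc_right ht.2))
        h0 rfl ht.1) (lt_of_le_of_lt (pathELength_mono le_rfl ht.2) hlen)
    rw [edist_dist, ENNReal.ofReal_lt_ofReal_iff_of_nonneg dist_nonneg] at h2
    rw [Metric.mem_ball] at hp ⊢
    calc dist (γ t) x₀ ≤ dist p (γ t) + dist p x₀ := dist_triangle_left _ _ _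
      _ < ρ := by linarith
  have hcsm : ContDiffOn ℝ 1 (extChartAt (𝓡 m) x₀ ∘ γ) (Icc 0 1) := by
    rw [← contMDiffOn_iff_contDiffOn]
    refine (contMDiffOn_extChartAt (n := 1)).comp hγ fun t ht => ?_
    simpa using (hball (hmem t ht)).1
  refine ⟨extChartAt (𝓡 m) x₀ ∘ γ, hcsm, fun t ht => (hball (hmem t ht)).2, by simp [h0],
    by simp [h1], ?_⟩
  rw [← pathELength_extChartAt_symm x₀ hcsm fun t ht =>
    (extChartAt (𝓡 m) x₀).map_source (hball (hmem t ht)).1]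
  refine lt_of_eq_of_lt (pathELength_congr fun t ht => ?_) hlen
  exact (extChartAt (𝓡 m) x₀).left_inv (hball (hmem t ht)).1

variable [IsContMDiffRiemannianBundle (𝓡 m) ∞ (EuclideanSpace ℝ (Fin m))
      (fun x : M => TangentSpace (𝓡 m) x)]

/-- The charts of a Riemannian manifold are locally bi-Lipschitz. -/
lemma exists_extChartAt_biLipschitz (x₀ : M) :
    ∃ U ∈ 𝓝 x₀, ∃ K > 0, U ⊆ (extChartAt (𝓡 m) x₀).source ∧ ∀ p ∈ U, ∀ q ∈ U,
      dist (extChartAt (𝓡 m) x₀ p) (extChartAt (𝓡 m) x₀ q) ≤ K * dist p q ∧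
      dist p q ≤ K * dist (extChartAt (𝓡 m) x₀ p) (extChartAt (𝓡 m) x₀ q) := by
  obtain ⟨r, hr, C, hC, -, -, hsub, hN, -⟩ := exists_chartNorm_bounds (m := m) x₀
  obtain ⟨ρ, hρ, hpath⟩ := exists_chart_path (m := m) x₀ hr
  refine ⟨Metric.ball x₀ (ρ / 2) ∩ ((extChartAt (𝓡 m) x₀).source ∩
      extChartAt (𝓡 m) x₀ ⁻¹' Metric.ball (extChartAt (𝓡 m) x₀ x₀) r),
    inter_mem (Metric.ball_mem_nhds _ (by positivity)) (inter_mem (extChartAt_source_mem_nhds x₀)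
      ((continuousAt_extChartAt x₀).preimage_mem_nhds (Metric.ball_mem_nhds _ hr))),
    C, hC, fun p hp => hp.2.1, fun p hp q hq => ⟨?_, ?_⟩⟩
  -- An almost minimizing path of `M` is read in the chart here; the opposite inequality uses the
  -- straight segment of the chart, which stays in the ball by convexity.
  · have hpq : dist p q < ρ := by
      have h1 := hp.1
      have h2 := hq.1
      rw [Metric.mem_ball] at h1 h2
      linarith [dist_triangle_right p q x₀]
    have key : ∀ ℓ, dist p q < ℓ → ℓ ≤ ρ →
        dist (extChartAt (𝓡 m) x₀ p) (extChartAt (𝓡 m) x₀ q) ≤ C * ℓ := by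
      intro ℓ h1 h2
      obtain ⟨c, hc, hcb, h0, h1', hlen⟩ := hpath p
        (Metric.ball_subset_ball (by linarith) hp.1) q ℓ h2 h1
      have h3 := enorm_sub_le_lintegral_derivWithin_Icc_of_contDiffOn_Icc hc zero_le_one
      have h4 : ∫⁻ t in Icc (0 : ℝ) 1, ‖derivWithin c (Icc 0 1) t‖ₑ ≤
          ENNReal.ofReal C * ENNReal.ofReal ℓ := by
        refine le_trans ?_ (mul_le_mul_right hlen.le _)
        rw [← lintegral_const_mul' _ _ ENNReal.ofReal_ne_top]
        refine setLIntegral_mono' measurableSet_Icc fun t ht => ?_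
        rw [← ofReal_norm, ← ENNReal.ofReal_mul hC.le]
        exact ENNReal.ofReal_le_ofReal (hN _ (hcb t ht) _).2
      have h5 := h3.trans h4
      rw [← ENNReal.ofReal_mul hC.le, h0, h1', ← ofReal_norm, ← dist_eq_norm, dist_comm] at h5
      exact (ENNReal.ofReal_le_ofReal_iff
        (mul_nonneg hC.le (dist_nonneg.trans h1.le))).1 h5
    refine le_of_forall_pos_le_add fun ε hε => ?_
    obtain ⟨ℓ, h1, h2⟩ := exists_between (lt_min hpq
      (show dist p q < dist p q + ε / C by have := div_pos hε hC; linarith))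
    refine (key ℓ h1 (h2.trans_le (min_le_left _ _)).le).trans ?_
    have h3 := (h2.trans_le (min_le_right _ _)).le
    calc C * ℓ ≤ C * (dist p q + ε / C) := by gcongr
      _ = C * dist p q + ε := by field_simp
  · set a := extChartAt (𝓡 m) x₀ p
    set b := extChartAt (𝓡 m) x₀ q
    set c : ℝ → EuclideanSpace ℝ (Fin m) := fun t => a + t • (b - a)
    have hderiv : ∀ t, HasDerivAt c (b - a) t := by
      intro t
      have := ((hasDerivAt_id t).smul_const (b - a)).const_add a
      rwa [one_smul] at this
    have hcb : ∀ t ∈ Icc (0 : ℝ) 1, c t ∈ Metric.ball (extChartAt (𝓡 m) x₀ x₀) r := by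
      intro t ht
      exact (convex_ball _ _).add_smul_sub_mem hp.2.2 hq.2.2 ht
    have hc : ContDiffOn ℝ 1 c (Icc 0 1) := by
      apply ContDiff.contDiffOn
      fun_prop
    have h1 := edist_le_of_chart_path x₀ hc fun t ht => hsub (hcb t ht)
    have h2 : ∫⁻ t in Icc (0 : ℝ) 1,
        ENNReal.ofReal (chartNorm x₀ (c t) (derivWithin c (Icc 0 1) t)) ≤
        ENNReal.ofReal (C * dist a b) := by
      calc _ ≤ ∫⁻ t in Icc (0 : ℝ) 1, ENNReal.ofReal (C * dist a b) := by
            refine setLIntegral_mono' measurableSet_Icc fun t ht => ?_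
            rw [(hderiv t).hasDerivWithinAt.derivWithin (uniqueDiffOn_Icc zero_lt_one t ht),
              dist_comm, dist_eq_norm]
            exact ENNReal.ofReal_le_ofReal (hN _ (hcb t ht) _).1
        _ = _ := by simp
    have h3 := h1.trans h2
    have e0 : (extChartAt (𝓡 m) x₀).symm (c 0) = p := by
      rw [show c 0 = a by simp [c]]
      exact (extChartAt (𝓡 m) x₀).left_inv hp.2.1
    have e1 : (extChartAt (𝓡 m) x₀).symm (c 1) = q := by
      rw [show c 1 = b by simp [c]]
      exact (extChartAt (𝓡 m) x₀).left_inv hq.2.1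
    rw [e0, e1, edist_dist] at h3
    exact (ENNReal.ofReal_le_ofReal_iff (mul_nonneg hC.le dist_nonneg)).1 h3

/-- Homotheties in a chart contract the distance to the centre of the chart. -/
lemma exists_dist_homothety_le (x₀ : M) :
    ∃ ρ > 0, ∀ p ∈ Metric.ball x₀ ρ, ∀ η ∈ Icc (0 : ℝ) 1,
      dist x₀ ((extChartAt (𝓡 m) x₀).symm (extChartAt (𝓡 m) x₀ x₀ +
        (1 - η) • (extChartAt (𝓡 m) x₀ p - extChartAt (𝓡 m) x₀ x₀))) ≤
      (1 - η / 2) * dist x₀ p := by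
  obtain ⟨r, hr, C, hC, K, hK, hsub, hN, hNK⟩ := exists_chartNorm_bounds (m := m) x₀
  set a := extChartAt (𝓡 m) x₀ x₀ with ha
  -- Within radius `1 / (2 * K)` the homothety moves points so little that the norm changes by a
  -- factor at most `1 + η / 2`, and `(1 - η) * (1 + η / 2) ≤ 1 - η / 2`.
  obtain ⟨ρ, hρ, hpath⟩ := exists_chart_path (m := m) x₀ (lt_min hr (show 0 < 1 / (2 * K) by positivity))
  refine ⟨ρ, hρ, fun p hp η hη => ?_⟩
  have hη2 : 0 ≤ 1 - η / 2 := by linarith [hη.2]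
  have key : ∀ ℓ, dist x₀ p < ℓ → ℓ ≤ ρ →
      dist x₀ ((extChartAt (𝓡 m) x₀).symm (a + (1 - η) • (extChartAt (𝓡 m) x₀ p - a))) ≤
        (1 - η / 2) * ℓ := by
    intro ℓ h1 h2
    obtain ⟨c, hc, hcb, h0, h1', hlen⟩ := hpath x₀ (Metric.mem_ball_self hρ) p ℓ h2 h1
    have hcr : ∀ t ∈ Icc (0 : ℝ) 1, c t ∈ Metric.ball a r := fun t ht =>
      Metric.ball_subset_ball (min_le_left _ _) (hcb t ht)
    set d : ℝ → EuclideanSpace ℝ (Fin m) := fun t => a + (1 - η) • (c t - a)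
    have hd : ContDiffOn ℝ 1 d (Icc 0 1) :=
      contDiffOn_const.add ((hc.sub contDiffOn_const).const_smul (1 - η))
    have hdr : ∀ t ∈ Icc (0 : ℝ) 1, d t ∈ Metric.ball a r := fun t ht =>
      (convex_ball _ _).add_smul_sub_mem (Metric.mem_ball_self hr) (hcr t ht)
        ⟨by linarith [hη.2], by linarith [hη.1]⟩
    have h3 := edist_le_of_chart_path x₀ hd fun t ht => hsub (hdr t ht)
    have h4 : ∫⁻ t in Icc (0 : ℝ) 1,
        ENNReal.ofReal (chartNorm x₀ (d t) (derivWithin d (Icc 0 1) t)) ≤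
        ENNReal.ofReal (1 - η / 2) * ENNReal.ofReal ℓ := by
      refine le_trans ?_ (mul_le_mul_right hlen.le _)
      rw [← lintegral_const_mul' _ _ ENNReal.ofReal_ne_top]
      refine setLIntegral_mono' measurableSet_Icc fun t ht => ?_
      have hder : derivWithin d (Icc 0 1) t = (1 - η) • derivWithin c (Icc 0 1) t := by
        have h5 : HasDerivWithinAt c (derivWithin c (Icc 0 1) t) (Icc 0 1) t :=
          (hc.differentiableOn one_ne_zero t ht).hasDerivWithinAt
        have h6 : HasDerivWithinAt d ((1 - η) • derivWithin c (Icc 0 1) t) (Icc 0 1) t :=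
          ((h5.sub_const a).const_smul (1 - η)).const_add a
        exact h6.derivWithin (uniqueDiffOn_Icc zero_lt_one t ht)
      rw [hder, chartNorm_smul, abs_of_nonneg (by linarith [hη.2]), ← ENNReal.ofReal_mul hη2]
      apply ENNReal.ofReal_le_ofReal
      have h7 := hNK (c t) (hcr t ht) (d t) (hdr t ht) (derivWithin c (Icc 0 1) t)
      have h8 : ‖d t - c t‖ = η * ‖c t - a‖ := by
        have : d t - c t = -(η • (c t - a)) := by simp only [d]; module
        rw [this, norm_neg, norm_smul, Real.norm_of_nonneg hη.1]
      have h9 : K * ‖d t - c t‖ ≤ η / 2 := by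
        have h10 : ‖c t - a‖ ≤ 1 / (2 * K) := by
          have := hcb t ht
          rw [Metric.mem_ball, dist_eq_norm] at this
          exact (this.trans_le (min_le_right _ _)).le
        rw [h8]
        calc K * (η * ‖c t - a‖) ≤ K * (η * (1 / (2 * K))) := by
              have := hη.1
              gcongr
          _ = η / 2 := by field_simp
      have hN0 : 0 ≤ chartNorm x₀ (c t) (derivWithin c (Icc 0 1) t) := norm_nonneg _
      calc (1 - η) * chartNorm x₀ (d t) (derivWithin c (Icc 0 1) t)
          ≤ (1 - η) * ((1 + η / 2) * chartNorm x₀ (c t) (derivWithin c (Icc 0 1) t)) := by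
            have := hη.2
            refine mul_le_mul_of_nonneg_left (h7.trans ?_) (by linarith)
            gcongr
        _ ≤ _ := by nlinarith [mul_nonneg (sq_nonneg η) hN0]
    have h5 := h3.trans h4
    have e0 : (extChartAt (𝓡 m) x₀).symm (d 0) = x₀ := by
      simp [d, h0, ha]
    rw [e0, edist_dist, ← ENNReal.ofReal_mul hη2] at h5
    have h6 := (ENNReal.ofReal_le_ofReal_iff
      (mul_nonneg hη2 (dist_nonneg.trans h1.le))).1 h5
    simpa only [d, h1'] using h6
  have hp' : dist x₀ p < ρ := by rwa [Metric.mem_ball'] at hp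
  refine le_of_forall_pos_le_add fun ε hε => ?_
  obtain ⟨ℓ, h1, h2⟩ := exists_between (lt_min hp' (lt_add_of_pos_right (dist x₀ p) hε))
  refine (key ℓ h1 (h2.trans_le (min_le_left _ _)).le).trans ?_
  have h3 := (h2.trans_le (min_le_right _ _)).le
  nlinarith [hη.1]

end ChartGeometry

/-! ### Local behaviour of a `C¹` flow away from its fixed points. -/

/-- The orbit of `x` leaves `x` at a definite speed, uniformly near `x`, and the distance to `x`
increases along a short piece of orbit. -/
def IsRegularAt {M : Type*} [MetricSpace M] (Ψ : Flow ℝ M) (δ : ℝ) (x : M) : Prop :=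
  (∀ y ∈ Metric.ball x δ, ∀ s, |s| ≤ δ → δ * |s| ≤ dist (Ψ s y) y) ∧
    MonotoneOn (fun s => dist x (Ψ s x)) (Icc 0 δ)

lemma IsRegularAt.mono {M : Type*} [MetricSpace M] {Ψ : Flow ℝ M} {δ δ' : ℝ} {x : M}
    (h : IsRegularAt Ψ δ x) (hδ : δ' ≤ δ) : IsRegularAt Ψ δ' x := by
  refine ⟨fun y hy s hs => ?_, h.2.mono (Icc_subset_Icc_right hδ)⟩
  refine le_trans ?_ (h.1 y (Metric.ball_subset_ball hδ hy) s (hs.trans hδ))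
  gcongr

section FlowGeometry

variable {m : ℕ} {M : Type*} [MetricSpace M]
    [ChartedSpace (EuclideanSpace ℝ (Fin m)) M] [IsManifold (𝓡 m) ∞ M]
    [RiemannianBundle (fun x : M => TangentSpace (𝓡 m) x)]
    [IsRiemannianManifold (𝓡 m) M]
    [IsContMDiffRiemannianBundle (𝓡 m) ∞ (EuclideanSpace ℝ (Fin m))
      (fun x : M => TangentSpace (𝓡 m) x)]

omit [RiemannianBundle (fun x : M => TangentSpace (𝓡 m) x)]
    [IsRiemannianManifold (𝓡 m) M]
    [IsContMDiffRiemannianBundle (𝓡 m) ∞ (EuclideanSpace ℝ (Fin m))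
      (fun x : M => TangentSpace (𝓡 m) x)] in
lemma contDiffAt_flow_chart {Ψ : Flow ℝ M}
    (hΨ : ContMDiff (𝓘(ℝ, ℝ).prod (𝓡 m)) (𝓡 m) 1 (fun p : ℝ × M => Ψ p.1 p.2))
    (t₀ : ℝ) (x₀ z₀ : M) (hz : Ψ t₀ x₀ = z₀) :
    ContDiffAt ℝ 1 (fun q : ℝ × EuclideanSpace ℝ (Fin m) =>
      extChartAt (𝓡 m) z₀ (Ψ q.1 ((extChartAt (𝓡 m) x₀).symm q.2)))
      (t₀, extChartAt (𝓡 m) x₀ x₀) := by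
  have : IsManifold (𝓡 m) 1 M := IsManifold.of_le (n := ∞) (by norm_num)
  have h1 : ContMDiffAt 𝓘(ℝ, EuclideanSpace ℝ (Fin m)) (𝓡 m) 1 (extChartAt (𝓡 m) x₀).symm
      (extChartAt (𝓡 m) x₀ x₀) :=
    (contMDiffOn_extChartAt_symm x₀).contMDiffAt (extChartAt_target_mem_nhds x₀)
  have h2 : ContMDiffAt (𝓡 m) 𝓘(ℝ, EuclideanSpace ℝ (Fin m)) 1 (extChartAt (𝓡 m) z₀) z₀ :=
    contMDiffAt_extChartAt
  rw [← contMDiffAt_iff_contDiffAt]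
  have h3 : ContMDiffAt 𝓘(ℝ, ℝ × EuclideanSpace ℝ (Fin m)) (𝓘(ℝ, ℝ).prod (𝓡 m)) 1
      (fun q : ℝ × EuclideanSpace ℝ (Fin m) => (q.1, (extChartAt (𝓡 m) x₀).symm q.2))
      (t₀, extChartAt (𝓡 m) x₀ x₀) := by
    apply ContMDiffAt.prodMk
    · exact contDiffAt_fst.contMDiffAt
    · exact ContMDiffAt.comp (t₀, extChartAt (𝓡 m) x₀ x₀) h1
        (contDiffAt_snd (n := 1) (p := (t₀, extChartAt (𝓡 m) x₀ x₀))).contMDiffAt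
  have h4 := (hΨ (t₀, x₀))
  have h5 : ContMDiffAt 𝓘(ℝ, ℝ × EuclideanSpace ℝ (Fin m)) (𝓡 m) 1
      (fun q : ℝ × EuclideanSpace ℝ (Fin m) => Ψ q.1 ((extChartAt (𝓡 m) x₀).symm q.2))
      (t₀, extChartAt (𝓡 m) x₀ x₀) := by
    refine ContMDiffAt.comp (t₀, extChartAt (𝓡 m) x₀ x₀) (g := fun p : ℝ × M => Ψ p.1 p.2) ?_ h3
    simpa using h4
  refine ContMDiffAt.comp (t₀, extChartAt (𝓡 m) x₀ x₀) ?_ h5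
  simpa [hz] using h2

/-- A `C¹` map is locally Lipschitz in coordinates, and the charts at source and target are locally
bi-Lipschitz. -/
lemma locallyLipschitz_flow {Ψ : Flow ℝ M}
    (hΨ : ContMDiff (𝓘(ℝ, ℝ).prod (𝓡 m)) (𝓡 m) 1 (fun p : ℝ × M => Ψ p.1 p.2)) :
    LocallyLipschitz (fun p : ℝ × M => Ψ p.1 p.2) := by
  rintro ⟨t₀, x₀⟩
  obtain ⟨Kh, V, hV, hlip⟩ := (contDiffAt_flow_chart hΨ t₀ x₀ _ rfl).exists_lipschitzOnWith
  obtain ⟨U, hU, K, hK, hUs, hUK⟩ := exists_extChartAt_biLipschitz (m := m) x₀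
  obtain ⟨U', hU', K', hK', -, hUK'⟩ := exists_extChartAt_biLipschitz (m := m) (Ψ t₀ x₀)
  have hcont : ContinuousAt (fun p : ℝ × M => (p.1, extChartAt (𝓡 m) x₀ p.2)) (t₀, x₀) :=
    continuousAt_fst.prodMk
      ((continuousAt_extChartAt (I := 𝓡 m) x₀).comp (x := (t₀, x₀)) continuousAt_snd)
  have hΨc : ContinuousAt (fun p : ℝ × M => Ψ p.1 p.2) (t₀, x₀) := hΨ.continuous.continuousAt
  refine ⟨(K' * (Kh * max 1 K)).toNNReal, (fun p : ℝ × M => (p.1, extChartAt (𝓡 m) x₀ p.2)) ⁻¹' V ∩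
      ((fun p : ℝ × M => Ψ p.1 p.2) ⁻¹' U' ∩ (Prod.snd ⁻¹' U)),
    inter_mem (hcont.preimage_mem_nhds hV) (inter_mem (hΨc.preimage_mem_nhds hU')
      (continuousAt_snd.preimage_mem_nhds hU)), ?_⟩
  apply LipschitzOnWith.of_dist_le_mul
  rintro ⟨t, x⟩ ⟨h1, h2, h3⟩ ⟨t', x'⟩ ⟨h1', h2', h3'⟩
  simp only [mem_preimage] at h1 h2 h3 h1' h2' h3'
  rw [Real.coe_toNNReal _ (by positivity)]
  have h4 := hlip.dist_le_mul _ h1 _ h1'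
  simp only [(extChartAt (𝓡 m) x₀).left_inv (hUs h3),
    (extChartAt (𝓡 m) x₀).left_inv (hUs h3')] at h4
  have h5 : dist (t, extChartAt (𝓡 m) x₀ x) (t', extChartAt (𝓡 m) x₀ x') ≤
      max 1 K * dist (t, x) (t', x') := by
    rw [Prod.dist_eq, Prod.dist_eq]
    apply max_le
    · calc dist t t' = 1 * dist t t' := (one_mul _).symm
        _ ≤ _ := by gcongr <;> apply le_max_left
    · refine ((hUK x h3 x' h3').1).trans ?_
      gcongr <;> apply le_max_right
  calc dist (Ψ t x) (Ψ t' x') ≤ K' * dist (extChartAt (𝓡 m) (Ψ t₀ x₀) (Ψ t x))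
        (extChartAt (𝓡 m) (Ψ t₀ x₀) (Ψ t' x')) := (hUK' _ h2 _ h2').2
    _ ≤ K' * (Kh * (max 1 K * dist (t, x) (t', x'))) := by gcongr; exact h4.trans (by gcongr)
    _ = _ := by ring

lemma exists_dist_flow_le [CompactSpace M] {Ψ : Flow ℝ M}
    (hΨ : ContMDiff (𝓘(ℝ, ℝ).prod (𝓡 m)) (𝓡 m) 1 (fun p : ℝ × M => Ψ p.1 p.2)) (S : ℝ) :
    ∃ C ≥ 1, ∀ s ∈ Icc (-S) S, ∀ t ∈ Icc (-S) S, ∀ x y,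
      dist (Ψ s x) (Ψ t y) ≤ C * (|s - t| + dist x y) := by
  obtain ⟨K, hK⟩ := ((locallyLipschitz_flow hΨ).locallyLipschitzOn
    (s := Icc (-S) S ×ˢ univ)).exists_lipschitzOnWith_of_compact (isCompact_Icc.prod isCompact_univ)
  refine ⟨max 1 K, le_max_left _ _, fun s hs t ht x y => ?_⟩
  have h1 := hK.dist_le_mul (s, x) ⟨hs, mem_univ _⟩ (t, y) ⟨ht, mem_univ _⟩
  refine h1.trans ?_
  rw [Prod.dist_eq, Real.dist_eq]
  gcongr
  · exact le_max_right _ _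
  · exact max_le (le_add_of_nonneg_right dist_nonneg) (le_add_of_nonneg_left (abs_nonneg _))

/-- A `C¹` flow is regular, in the sense of `IsRegularAt`, at the points which are not fixed. -/
lemma exists_isRegularAt [CompactSpace M] {Ψ : Flow ℝ M}
    (hΨ : ContMDiff (𝓘(ℝ, ℝ).prod (𝓡 m)) (𝓡 m) 1 (fun p : ℝ × M => Ψ p.1 p.2)) {x₀ : M}
    (hx : Ψ 1 x₀ ≠ x₀) : ∃ δ > 0, IsRegularAt Ψ δ x₀ := by
  have hz : Ψ 0 x₀ = x₀ := Ψ.map_zero_apply x₀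
  set χ := extChartAt (𝓡 m) x₀
  set a := χ x₀ with ha
  set h : ℝ × EuclideanSpace ℝ (Fin m) → EuclideanSpace ℝ (Fin m) :=
    fun q => χ (Ψ q.1 (χ.symm q.2)) with hh
  have hcd : ContDiffAt ℝ 1 h (0, a) := contDiffAt_flow_chart hΨ 0 x₀ x₀ hz
  have hstrict := hcd.hasStrictFDerivAt one_ne_zero
  set w := fderiv ℝ h (0, a) (1, 0) with hw
  obtain ⟨U, hU, K₀, hK₀, hUs, hUK₀⟩ := exists_extChartAt_biLipschitz (m := m) x₀
  obtain ⟨K, hK, hUK⟩ : ∃ K ≥ 1, ∀ p ∈ U, ∀ q ∈ U,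
      dist (χ p) (χ q) ≤ K * dist p q ∧ dist p q ≤ K * dist (χ p) (χ q) := by
    refine ⟨max 1 K₀, le_max_left _ _, fun p hp q hq => ⟨(hUK₀ p hp q hq).1.trans ?_,
      (hUK₀ p hp q hq).2.trans ?_⟩⟩ <;> gcongr <;> apply le_max_right
  -- the flow in the chart is close to its linear part
  have hlin : ∀ ε > 0, ∃ δ > 0, ∀ y ∈ Metric.ball x₀ δ, ∀ s s' : ℝ, |s| ≤ δ → |s'| ≤ δ →
      Ψ s y ∈ U ∧ ‖χ (Ψ s y) - χ (Ψ s' y) - (s - s') • w‖ ≤ ε * |s - s'| := by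
    intro ε hε
    have h1 := (hstrict.isLittleO.def hε)
    rw [Metric.eventually_nhds_iff] at h1
    obtain ⟨δ₁, hδ₁, h1⟩ := h1
    have hcχ : ContinuousAt χ x₀ := continuousAt_extChartAt x₀
    have hΨc : ContinuousAt (fun p : ℝ × M => Ψ p.1 p.2) (0, x₀) := hΨ.continuous.continuousAt
    have h2 : ∀ᶠ p in 𝓝 ((0 : ℝ), x₀), Ψ p.1 p.2 ∈ U := by
      apply hΨc.preimage_mem_nhds
      simpa [hz] using hU
    have h3 : ∀ᶠ p in 𝓝 ((0 : ℝ), x₀), p.2 ∈ χ.source ∧ dist (χ p.2) a < δ₁ :=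
      (continuousAt_snd (p := ((0 : ℝ), x₀))).eventually
        (inter_mem (extChartAt_source_mem_nhds (I := 𝓡 m) x₀)
          (hcχ.eventually (Metric.ball_mem_nhds _ hδ₁)))
    obtain ⟨δ₂, hδ₂, h4⟩ := Metric.eventually_nhds_iff.1 (h2.and h3)
    refine ⟨min (δ₁ / 2) (δ₂ / 2), by positivity, fun y hy s s' hs hs' => ?_⟩
    have hy2 : dist y x₀ < δ₂ := lt_of_lt_of_le hy ((min_le_right _ _).trans (by linarith))
    have hs2 : |s| < δ₂ := lt_of_le_of_lt (hs.trans (min_le_right _ _)) (by linarith)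
    have hs1 : |s| < δ₁ := lt_of_le_of_lt (hs.trans (min_le_left _ _)) (by linarith)
    have hs1' : |s'| < δ₁ := lt_of_le_of_lt (hs'.trans (min_le_left _ _)) (by linarith)
    obtain ⟨h5, h6, h7⟩ := h4 (y := (s, y)) (by
      rw [Prod.dist_eq]; exact max_lt (by simpa using hs2) hy2)
    refine ⟨h5, ?_⟩
    have h8 := h1 (y := ((s, χ y), (s', χ y))) (by
      simp only [Prod.dist_eq]
      refine max_lt (max_lt ?_ h7) (max_lt ?_ h7)
      · simpa using hs1
      · simpa using hs1')
    simp only [hh, χ.left_inv h6] at h8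
    have e1 : ((s, χ y) : ℝ × EuclideanSpace ℝ (Fin m)) - (s', χ y) = (s - s') • (1, 0) := by
      ext <;> simp
    rw [e1, map_smul, norm_smul] at h8
    simpa [Prod.norm_def] using h8
  -- If the velocity vanished, `Ψ (1 / n)` would move `x₀` by `o(1 / n)`; transporting this by the
  -- flow, with Lipschitz constant `C`, and adding `n` steps shows that `Ψ 1` fixes `x₀`.
  have hw0 : w ≠ 0 := by
    intro hw0
    apply hx
    obtain ⟨C, hC, hCΨ⟩ := exists_dist_flow_le hΨ 1
    have hsmall : ∀ ε > 0, dist (Ψ 1 x₀) x₀ ≤ 0 + ε := by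
      intro ε hε
      obtain ⟨δ, hδ, hδ'⟩ := hlin (ε / (C * K)) (by positivity)
      obtain ⟨n, hn⟩ := exists_nat_gt (1 / δ)
      have hn0 : (0 : ℝ) < n := lt_trans (by positivity) hn
      have hnδ : 1 / (n : ℝ) ≤ δ := by
        rw [div_le_iff₀ hn0]
        rw [div_lt_iff₀ hδ] at hn
        linarith
      have h1 : dist (Ψ (1 / n) x₀) x₀ ≤ ε / C * (1 / n) := by
        have h2 := hδ' x₀ (Metric.mem_ball_self hδ) (1 / n) 0
          (by rwa [abs_of_nonneg (by positivity)]) (by simpa using hδ.le)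
        have h3 := (hδ' x₀ (Metric.mem_ball_self hδ) 0 0
          (by simpa using hδ.le) (by simpa using hδ.le)).1
        have h4 := (hUK _ h2.1 _ h3).2
        rw [dist_eq_norm (χ _)] at h4
        have h5 := h2.2
        rw [hw0, smul_zero, sub_zero, sub_zero, abs_of_nonneg (by positivity)] at h5
        rw [hz] at h4 h5
        calc _ ≤ K * (ε / (C * K) * (1 / n)) := h4.trans (by gcongr)
          _ = _ := by field_simp
      have hstep : ∀ k : ℕ, k ≤ n → dist (Ψ (k / n) x₀) x₀ ≤ k * (ε * (1 / n)) := by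
        intro k
        induction k with
        | zero => intro _; simp [hz]
        | succ k ih =>
          intro hk
          have h6 := ih (by omega)
          have e : Ψ ((k + 1 : ℕ) / n) x₀ = Ψ (k / n) (Ψ (1 / n) x₀) := by
            rw [← Ψ.map_add]; congr 1; push_cast; ring
          have hkn : (k / n : ℝ) ∈ Icc (-1 : ℝ) 1 := by
            have : (k : ℝ) ≤ n := by exact_mod_cast (by omega : k ≤ n)
            constructor
            · have : (0 : ℝ) ≤ k / n := by positivity
              linarith
            · rwa [div_le_one hn0]
          have h7 := hCΨ _ hkn _ hkn (Ψ (1 / n) x₀) x₀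
          rw [sub_self, abs_zero, zero_add] at h7
          calc dist (Ψ ((k + 1 : ℕ) / n) x₀) x₀
              ≤ dist (Ψ (k / n) (Ψ (1 / n) x₀)) (Ψ (k / n) x₀) + dist (Ψ (k / n) x₀) x₀ := by
                rw [e]; exact dist_triangle _ _ _
            _ ≤ C * (ε / C * (1 / n)) + k * (ε * (1 / n)) :=
                add_le_add (h7.trans (by gcongr)) h6
            _ = _ := by push_cast; field_simp; ring
      have h8 := hstep n le_rfl
      rw [div_self hn0.ne'] at h8
      calc _ ≤ _ := h8
        _ = 0 + ε := by field_simp; ring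
    exact dist_le_zero.1 (le_of_forall_pos_le_add hsmall)
  have hwpos : 0 < ‖w‖ := norm_pos_iff.2 hw0
  -- Chosen so that `K * (2 * ε) = ‖w‖ / (4 * K)`: the linearization error then equals exactly the
  -- lower bound on the gain from the homothety, in the comparison of times `s` and `s'` below.
  set ε := ‖w‖ / (8 * K ^ 2) with hε
  have hεpos : 0 < ε := by positivity
  have hεw : ε ≤ ‖w‖ / 2 := by
    rw [hε]
    gcongr
    nlinarith
  obtain ⟨δ₁, hδ₁, hlin1⟩ := hlin ε hεpos
  have hspeed : ∀ y ∈ Metric.ball x₀ δ₁, ∀ s, |s| ≤ δ₁ → ‖w‖ / (2 * K) * |s| ≤ dist (Ψ s y) y := by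
    intro y hy s hs
    have h1 := hlin1 y hy s 0 hs (by simpa using hδ₁.le)
    have h2 := (hlin1 y hy 0 0 (by simpa using hδ₁.le) (by simpa using hδ₁.le)).1
    have h3 := (hUK _ h1.1 _ h2).1
    have h4 := h1.2
    rw [Ψ.map_zero_apply] at h3 h4
    rw [sub_zero] at h4
    have h5 : ‖w‖ / 2 * |s| ≤ dist (χ (Ψ s y)) (χ y) := by
      rw [dist_eq_norm]
      have h6 : ‖s • w‖ ≤ ‖χ (Ψ s y) - χ y‖ + ‖χ (Ψ s y) - χ y - s • w‖ := by
        have := norm_sub_le (χ (Ψ s y) - χ y) (χ (Ψ s y) - χ y - s • w)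
        simpa using this
      rw [norm_smul, Real.norm_eq_abs] at h6
      nlinarith [abs_nonneg s]
    have h7 := h5.trans h3
    calc ‖w‖ / (2 * K) * |s| = (‖w‖ / 2 * |s|) / K := by field_simp
      _ ≤ dist (Ψ s y) y := by rw [div_le_iff₀ (by linarith)]; linarith
  obtain ⟨ρ, hρ, hhom⟩ := exists_dist_homothety_le (m := m) x₀
  have hsymm : ∀ᶠ y in 𝓝 a, y ∈ χ.target ∧ χ.symm y ∈ U := by
    refine inter_mem (extChartAt_target_mem_nhds (I := 𝓡 m) x₀) ?_
    apply (continuousAt_extChartAt_symm (I := 𝓡 m) x₀).preimage_mem_nhds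
    simpa [χ] using hU
  obtain ⟨r, hr, hrU⟩ := Metric.eventually_nhds_iff_ball.1 hsymm
  have horb : ∀ᶠ s in 𝓝 (0 : ℝ), Ψ s x₀ ∈ Metric.ball x₀ ρ ∧ χ (Ψ s x₀) ∈ Metric.ball a r := by
    have hc : ContinuousAt (fun s => Ψ s x₀) 0 :=
      (hΨ.continuous.comp (continuous_id.prodMk continuous_const)).continuousAt
    have : {z | z ∈ Metric.ball x₀ ρ ∧ χ z ∈ Metric.ball a r} ∈ 𝓝 (Ψ 0 x₀) := by
      rw [hz]
      exact inter_mem (Metric.ball_mem_nhds _ hρ)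
        ((continuousAt_extChartAt x₀).preimage_mem_nhds (Metric.ball_mem_nhds _ hr))
    exact hc.preimage_mem_nhds this
  obtain ⟨δ₂, hδ₂, horb⟩ := Metric.eventually_nhds_iff.1 horb
  -- In `IsRegularAt` the same `δ` serves as radius, as time and as speed, hence the last term.
  set δ := min (min δ₁ (δ₂ / 2)) (‖w‖ / (2 * K)) with hδdef
  have hδ1 : δ ≤ δ₁ := (min_le_left _ _).trans (min_le_left _ _)
  have hδ2 : δ < δ₂ := lt_of_le_of_lt ((min_le_left _ _).trans (min_le_right _ _)) (by linarith)
  refine ⟨δ, by positivity, fun y hy s hs => ?_, fun s hs s' hs' hss => ?_⟩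
  · refine le_trans ?_ (hspeed y (Metric.ball_subset_ball hδ1 hy) s (hs.trans hδ1))
    gcongr
    exact min_le_right _ _
  · rcases hs'.1.eq_or_lt with h0 | h0
    · have : s = s' := le_antisymm hss (by rw [← h0]; exact hs.1)
      rw [this]
    have habs : ∀ u ∈ Icc 0 δ, |u| ≤ δ₁ := fun u hu => by
      rw [abs_of_nonneg hu.1]; exact hu.2.trans hδ1
    have hx₀ : x₀ ∈ Metric.ball x₀ δ₁ := Metric.mem_ball_self hδ₁
    -- The homothety of ratio `1 - η = s / s'` sends the linearized orbit at time `s'` to the one at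
    -- time `s`. The true orbit differs by at most `2 * ε * (s' - s)`, while the distance to `x₀`
    -- drops by a fixed multiple of `s' - s`.
    set η := (s' - s) / s' with hη
    have hη0 : 0 ≤ η := div_nonneg (by linarith) hs'.1
    have hη1 : η ≤ 1 := by rw [hη, div_le_one h0]; linarith [hs.1]
    have hηs : η * s' = s' - s := by rw [hη]; field_simp
    obtain ⟨hb1, hb2⟩ := horb (y := s') (by
      rw [Real.dist_0_eq_abs, abs_of_pos h0]; exact hs'.2.trans_lt hδ2)
    have h1 := hhom _ hb1 η ⟨hη0, hη1⟩
    set b := χ (Ψ s' x₀)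
    have hb : a + (1 - η) • (b - a) ∈ Metric.ball a r :=
      (convex_ball _ _).add_smul_sub_mem (Metric.mem_ball_self hr) hb2
        ⟨by linarith, by linarith⟩
    obtain ⟨h2, h3⟩ := hrU _ hb
    have h4 := (hUK _ h3 _ (hlin1 x₀ hx₀ s s (habs s hs) (habs s hs)).1).2
    rw [χ.right_inv h2] at h4
    have e1 := (hlin1 x₀ hx₀ s' s (habs s' hs') (habs s hs)).2
    have e2 := (hlin1 x₀ hx₀ s' 0 (habs s' hs') (by simpa using hδ₁.le)).2
    rw [hz, sub_zero] at e2
    rw [abs_of_nonneg (by linarith)] at e1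
    rw [abs_of_pos h0] at e2
    have h5 : dist (a + (1 - η) • (b - a)) (χ (Ψ s x₀)) ≤ 2 * ε * (s' - s) := by
      have e3 : a + (1 - η) • (b - a) - χ (Ψ s x₀) =
          (b - χ (Ψ s x₀) - (s' - s) • w) - η • (b - a - s' • w) := by
        have : (s' - s) • w = η • (s' • w) := by rw [smul_smul, hηs]
        rw [this]
        module
      rw [dist_eq_norm, e3]
      refine (norm_sub_le _ _).trans ?_
      rw [norm_smul, Real.norm_of_nonneg hη0]
      have : η * ‖b - a - s' • w‖ ≤ η * (ε * s') := by gcongr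
      have e4 : η * (ε * s') = ε * (s' - s) := by rw [← hηs]; ring
      linarith
    have h6 : ‖w‖ / (2 * K) * s' ≤ dist x₀ (Ψ s' x₀) := by
      have := hspeed x₀ hx₀ s' (habs s' hs')
      rwa [abs_of_pos h0, dist_comm] at this
    have h7 : η / 2 * (‖w‖ / (2 * K) * s') ≤ η / 2 * dist x₀ (Ψ s' x₀) := by gcongr
    have e5 : η / 2 * (‖w‖ / (2 * K) * s') = ‖w‖ / (4 * K) * (s' - s) := by
      rw [← hηs]; ring
    have e6 : K * (2 * ε * (s' - s)) = ‖w‖ / (4 * K) * (s' - s) := by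
      rw [hε]; field_simp; ring
    have h8 : K * dist (a + (1 - η) • (b - a)) (χ (Ψ s x₀)) ≤ K * (2 * ε * (s' - s)) := by gcongr
    calc dist x₀ (Ψ s x₀) ≤ dist x₀ (χ.symm (a + (1 - η) • (b - a))) +
          dist (χ.symm (a + (1 - η) • (b - a))) (Ψ s x₀) := dist_triangle _ _ _
      _ ≤ dist x₀ (Ψ s' x₀) := by linarith

end FlowGeometry

/-! ### Separated sets, the doubling property and covering estimates. -/

section Doubling

/-- The points of `P` are at mutual distance at least `r`. -/
def SeparatedBy {M : Type*} [MetricSpace M] (r : ℝ) (P : Finset M) : Prop :=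
  ∀ p ∈ P, ∀ q ∈ P, p ≠ q → r ≤ dist p q

/-- At every scale `r`, balls of radius `Λ r` contain a bounded number of `r`-separated points. -/
def IsDoublingSpace (M : Type*) [MetricSpace M] : Prop :=
  ∀ Λ : ℝ, ∃ C : ℕ, ∀ r > 0, ∀ P : Finset M, SeparatedBy r P →
    ∀ z, (∀ p ∈ P, dist p z < Λ * r) → P.card ≤ C

lemma SeparatedBy.mono {M : Type*} [MetricSpace M] {r r' : ℝ} {P P' : Finset M}
    (h : SeparatedBy r P) (hr : r' ≤ r) (hP : P' ⊆ P) : SeparatedBy r' P' :=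
  fun p hp q hq hpq => hr.trans (h p (hP hp) q (hP hq) hpq)

lemma exists_card_le_of_totallyBounded {M : Type*} [MetricSpace M] {s : Set M}
    (hs : TotallyBounded s) {r : ℝ} (hr : 0 < r) :
    ∃ N : ℕ, ∀ P : Finset M, (∀ p ∈ P, p ∈ s) → SeparatedBy r P → P.card ≤ N := by
  obtain ⟨t, ht, hst⟩ := Metric.totallyBounded_iff.1 hs (r / 2) (by positivity)
  have h1 : ∀ p : M, ∃ q, p ∈ s → q ∈ t ∧ dist p q < r / 2 := by
    intro p
    by_cases hp : p ∈ s
    · obtain ⟨q, hq, hpq⟩ := mem_iUnion₂.1 (hst hp)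
      exact ⟨q, fun _ => ⟨hq, hpq⟩⟩
    · exact ⟨p, fun h => absurd h hp⟩
  choose f hf using h1
  refine ⟨ht.toFinset.card, fun P hP hsep => ?_⟩
  refine Finset.card_le_card_of_injOn f (fun p hp => ?_) (fun p hp q hq hpq => ?_)
  · simpa using (hf p (hP p hp)).1
  · by_contra hne
    have h1 := (hf p (hP p hp)).2
    have h2 := (hf q (hP q hq)).2
    rw [← hpq] at h2
    linarith [hsep p hp q hq hne, dist_triangle_right p q (f p)]

lemma exists_maximal_separated {M : Type*} [MetricSpace M] [CompactSpace M] (Q : Set M) {r : ℝ}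
    (hr : 0 < r) : ∃ P : Finset M, (∀ p ∈ P, p ∈ Q) ∧ SeparatedBy r P ∧
      ∀ x ∈ Q, ∃ p ∈ P, dist x p < r := by
  classical
  obtain ⟨N, hN⟩ := exists_card_le_of_totallyBounded
    (isCompact_univ (X := M)).totallyBounded hr
  let S : Set ℕ := {n | ∃ P : Finset M, (∀ p ∈ P, p ∈ Q) ∧ SeparatedBy r P ∧ P.card = n}
  have hne : S.Nonempty := ⟨0, ∅, by simp, by simp [SeparatedBy], rfl⟩
  have hbdd : BddAbove S := by
    refine ⟨N, ?_⟩
    rintro n ⟨P, -, hP, rfl⟩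
    exact hN P (fun _ _ => mem_univ _) hP
  obtain ⟨P, hPQ, hP, hcard⟩ := Nat.sSup_mem hne hbdd
  refine ⟨P, hPQ, hP, fun x hx => ?_⟩
  by_contra! hcon
  have hxP : x ∉ P := fun h => by
    have := hcon x h
    rw [dist_self] at this
    linarith
  have hmem : (insert x P).card ∈ S := by
    refine ⟨insert x P, ?_, ?_, rfl⟩
    · intro p hp
      rcases Finset.mem_insert.1 hp with rfl | hp
      · exact hx
      · exact hPQ p hp
    · intro p hp q hq hpq
      rcases Finset.mem_insert.1 hp with rfl | hp' <;> rcases Finset.mem_insert.1 hq with rfl | hq'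
      · exact absurd rfl hpq
      · exact hcon q hq'
      · rw [dist_comm]; exact hcon p hp'
      · exact hP p hp' q hq' hpq
  have := le_csSup hbdd hmem
  rw [Finset.card_insert_of_notMem hxP, ← hcard] at this
  omega

/-- In a compact doubling space, the number of separated points grows at most polynomially. -/
lemma IsDoublingSpace.exists_card_le {M : Type*} [MetricSpace M] [CompactSpace M]
    (h : IsDoublingSpace M) :
    ∃ A B : ℕ, 0 < B ∧ ∀ k : ℕ, ∀ P : Finset M, SeparatedBy ((1 / 2 : ℝ) ^ k) P →
      P.card ≤ A * B ^ k := by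
  classical
  obtain ⟨C, hC⟩ := h 2
  obtain ⟨N, hN⟩ := exists_card_le_of_totallyBounded
    (isCompact_univ (X := M)).totallyBounded one_pos
  refine ⟨N, C + 1, by omega, fun k => ?_⟩
  induction k with
  | zero => intro P hP; simpa using hN P (fun _ _ => mem_univ _) (by simpa using hP)
  | succ k ih =>
    intro P hP
    -- A maximal subset separated at the doubled scale: each of its balls holds at most `C` points
    -- of `P`, by the doubling property with `Λ = 2`.
    obtain ⟨P', hP'P, hP', hcov⟩ := exists_maximal_separated (M := M) (P : Set M)
      (show (0 : ℝ) < (1 / 2) ^ k by positivity)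
    have hsub : P ⊆ P'.biUnion fun q => P.filter fun p => dist p q < (1 / 2 : ℝ) ^ k := by
      intro p hp
      obtain ⟨q, hq, hpq⟩ := hcov p hp
      simp only [Finset.mem_biUnion, Finset.mem_filter]
      exact ⟨q, hq, hp, hpq⟩
    calc P.card ≤ ∑ q ∈ P', (P.filter fun p => dist p q < (1 / 2 : ℝ) ^ k).card :=
          (Finset.card_le_card hsub).trans Finset.card_biUnion_le
      _ ≤ ∑ q ∈ P', C := by
          refine Finset.sum_le_sum fun q _ => ?_
          refine hC ((1 / 2) ^ (k + 1)) (by positivity) _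
            (hP.mono le_rfl (Finset.filter_subset _ _)) q fun p hp => ?_
          have := (Finset.mem_filter.1 hp).2
          rw [pow_succ]
          linarith
      _ = P'.card * C := by simp
      _ ≤ (N * (C + 1) ^ k) * (C + 1) := Nat.mul_le_mul (ih P' hP') (by omega)
      _ = _ := by ring

/-- Estimates on small balls centred in `Q` sum up to an estimate on the preimage of `Q`. -/
lemma measure_inter_preimage_le {M : Type*} [MetricSpace M] [CompactSpace M] [MeasurableSpace M]
    [BorelSpace M] {A B : ℕ} {k : ℕ} {C : ℕ} {Λ : ℝ}
    (hAB : ∀ P : Finset M, SeparatedBy ((1 / 2 : ℝ) ^ k) P → P.card ≤ A * B ^ k)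
    (hC : ∀ r > 0, ∀ P : Finset M, SeparatedBy r P →
      ∀ z, (∀ p ∈ P, dist p z < Λ * r) → P.card ≤ C)
    {Z : Type*} [MeasurableSpace Z] (κ : Measure Z) (ρ : Measure M) (G : Z → M)
    (bad : Set Z) (Q : Set M) (c e : ℝ≥0∞)
    (hloc : ∀ x ∈ Q, κ (bad ∩ G ⁻¹' Metric.ball x ((1 / 2 : ℝ) ^ k)) ≤
      c * ρ (Metric.ball x (Λ * (1 / 2 : ℝ) ^ k)) + e) :
    κ (bad ∩ G ⁻¹' Q) ≤ c * (C * ρ univ) + (A * B ^ k : ℕ) * e := by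
  classical
  obtain ⟨P, hPQ, hP, hcov⟩ := exists_maximal_separated Q
    (show (0 : ℝ) < (1 / 2) ^ k by positivity)
  -- The enlarged balls overlap at most `C` times, since the centres of those containing `z` are
  -- separated points within `Λ * (1 / 2) ^ k` of `z`.
  have hsum : ∑ p ∈ P, ρ (Metric.ball p (Λ * (1 / 2 : ℝ) ^ k)) ≤ C * ρ univ := by
    calc ∑ p ∈ P, ρ (Metric.ball p (Λ * (1 / 2 : ℝ) ^ k))
        = ∑ p ∈ P, ∫⁻ z, (Metric.ball p (Λ * (1 / 2 : ℝ) ^ k)).indicator 1 z ∂ρ := by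
          refine Finset.sum_congr rfl fun p _ => ?_
          rw [lintegral_indicator_one Metric.isOpen_ball.measurableSet]
      _ = ∫⁻ z, ∑ p ∈ P, (Metric.ball p (Λ * (1 / 2 : ℝ) ^ k)).indicator 1 z ∂ρ := by
          rw [lintegral_finsetSum]
          intro p _
          exact measurable_one.indicator Metric.isOpen_ball.measurableSet
      _ ≤ ∫⁻ _, C ∂ρ := by
          refine lintegral_mono fun z => ?_
          have e1 : ∑ p ∈ P, (Metric.ball p (Λ * (1 / 2 : ℝ) ^ k)).indicator (1 : M → ℝ≥0∞) z =
              ((P.filter fun p => dist p z < Λ * (1 / 2 : ℝ) ^ k).card : ℝ≥0∞) := by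
            rw [Finset.card_filter]
            push_cast
            refine Finset.sum_congr rfl fun p _ => ?_
            simp only [indicator_apply, Metric.mem_ball', Pi.one_apply]
          rw [e1]
          exact Nat.cast_le.2 (hC _ (by positivity) _
            (hP.mono le_rfl (Finset.filter_subset _ _)) z fun p hp => (Finset.mem_filter.1 hp).2)
      _ = C * ρ univ := by simp
  have hsub : bad ∩ G ⁻¹' Q ⊆ ⋃ p ∈ P, bad ∩ G ⁻¹' Metric.ball p ((1 / 2 : ℝ) ^ k) := by
    rintro z ⟨hz, hzQ⟩
    obtain ⟨p, hp, hzp⟩ := hcov _ hzQ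
    exact mem_iUnion₂.2 ⟨p, hp, hz, hzp⟩
  calc κ (bad ∩ G ⁻¹' Q) ≤ ∑ p ∈ P, κ (bad ∩ G ⁻¹' Metric.ball p ((1 / 2 : ℝ) ^ k)) :=
        (measure_mono hsub).trans (measure_biUnion_finset_le _ _)
    _ ≤ ∑ p ∈ P, (c * ρ (Metric.ball p (Λ * (1 / 2 : ℝ) ^ k)) + e) :=
        Finset.sum_le_sum fun p hp => hloc p (hPQ p hp)
    _ = c * ∑ p ∈ P, ρ (Metric.ball p (Λ * (1 / 2 : ℝ) ^ k)) + P.card * e := by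
        rw [Finset.sum_add_distrib, Finset.mul_sum]; simp
    _ ≤ _ := by
        gcongr
        exact_mod_cast hAB P hP

/-- By a Lebesgue number, a ball of radius at most `δ` lies in a single bi-Lipschitz chart;
rescaling by `1 / r` puts the points in a fixed compact ball of Euclidean space, with a fixed
separation. Larger balls force `r > δ / Λ`, and total boundedness suffices. -/
lemma isDoublingSpace_of_riemannian {m : ℕ} {M : Type*} [MetricSpace M] [CompactSpace M]
    [ChartedSpace (EuclideanSpace ℝ (Fin m)) M] [IsManifold (𝓡 m) ∞ M]
    [RiemannianBundle (fun x : M => TangentSpace (𝓡 m) x)]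
    [IsRiemannianManifold (𝓡 m) M]
    [IsContMDiffRiemannianBundle (𝓡 m) ∞ (EuclideanSpace ℝ (Fin m))
      (fun x : M => TangentSpace (𝓡 m) x)] : IsDoublingSpace M := by
  classical
  intro Λ
  choose U hU K hK hUs hUK using fun x₀ : M => exists_extChartAt_biLipschitz (m := m) x₀
  have hN : ∀ x₀ : M, ∃ N : ℕ, ∀ P : Finset (EuclideanSpace ℝ (Fin m)),
      (∀ p ∈ P, p ∈ Metric.closedBall (0 : EuclideanSpace ℝ (Fin m)) (K x₀ * Λ)) →
      SeparatedBy (1 / K x₀) P → P.card ≤ N := fun x₀ =>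
    exists_card_le_of_totallyBounded (isCompact_closedBall _ _).totallyBounded
      (one_div_pos.2 (hK x₀))
  choose N hN using hN
  obtain ⟨t, -, ht⟩ := isCompact_univ.elim_nhds_subcover (fun x => interior (U x))
    fun x _ => interior_mem_nhds.2 (hU x)
  obtain ⟨δ, hδ, hleb⟩ := lebesgue_number_lemma_of_metric (isCompact_univ (X := M))
    (c := fun i : t => interior (U i)) (fun i => isOpen_interior) (by
      intro x hx
      obtain ⟨i, hi, hxi⟩ := mem_iUnion₂.1 (ht hx)
      exact mem_iUnion.2 ⟨⟨i, hi⟩, hxi⟩)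
  obtain ⟨N', hN'⟩ : ∃ N' : ℕ, ∀ r > 0, δ < Λ * r →
      ∀ P : Finset M, SeparatedBy r P → P.card ≤ N' := by
    by_cases hΛ : 0 < Λ
    · obtain ⟨N', hN'⟩ := exists_card_le_of_totallyBounded
        (isCompact_univ (X := M)).totallyBounded (div_pos hδ hΛ)
      refine ⟨N', fun r _ hr P hP => hN' P (fun _ _ => mem_univ _) (hP.mono ?_ subset_rfl)⟩
      rw [div_le_iff₀ hΛ]
      linarith
    · exact ⟨0, fun r hr hr' => absurd hr' (by nlinarith)⟩
  refine ⟨max N' (t.sup N), fun r hr P hP z hPz => ?_⟩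
  by_cases hr' : δ < Λ * r
  · exact (hN' r hr hr' P hP).trans (le_max_left _ _)
  · push Not at hr'
    obtain ⟨⟨i, hi⟩, hzi⟩ := hleb z (mem_univ z)
    have hball : ∀ p, dist p z < δ → p ∈ U i := fun p hp => interior_subset (hzi hp)
    have hz : z ∈ U i := hball z (by simpa using hδ)
    have hP' : ∀ p ∈ P, p ∈ U i := fun p hp => hball p ((hPz p hp).trans_le hr')
    set f : M → EuclideanSpace ℝ (Fin m) :=
      fun p => r⁻¹ • (extChartAt (𝓡 m) i p - extChartAt (𝓡 m) i z)
    have hfd : ∀ p q, dist (f p) (f q) =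
        r⁻¹ * dist (extChartAt (𝓡 m) i p) (extChartAt (𝓡 m) i q) := by
      intro p q
      simp only [f]
      rw [dist_smul₀, dist_sub_right, Real.norm_of_nonneg (by positivity)]
    have hsep : ∀ p ∈ P, ∀ q ∈ P, p ≠ q → 1 / K i ≤ dist (f p) (f q) := by
      intro p hp q hq hpq
      have h1 := (hP p hp q hq hpq).trans (hUK i p (hP' p hp) q (hP' q hq)).2
      rw [hfd, div_le_iff₀ (hK i), inv_mul_eq_div, div_mul_eq_mul_div, le_div_iff₀ hr]
      linarith
    have hinj : Set.InjOn f P := by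
      intro p hp q hq hpq
      by_contra hne
      have := hsep p hp q hq hne
      rw [hpq, dist_self] at this
      linarith [one_div_pos.2 (hK i)]
    rw [← Finset.card_image_of_injOn hinj]
    refine (hN i _ ?_ ?_).trans ((Finset.le_sup (f := N) hi).trans (le_max_right _ _))
    · intro y hy
      obtain ⟨p, hp, rfl⟩ := Finset.mem_image.1 hy
      rw [Metric.mem_closedBall, show (0 : EuclideanSpace ℝ (Fin m)) = f z by simp [f], hfd,
        inv_mul_le_iff₀ hr]
      have h1 := (hUK i p (hP' p hp) z hz).1
      have h2 := mul_le_mul_of_nonneg_left (hPz p hp).le (hK i).le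
      linarith
    · intro y hy y' hy' hne
      obtain ⟨p, hp, rfl⟩ := Finset.mem_image.1 hy
      obtain ⟨q, hq, rfl⟩ := Finset.mem_image.1 hy'
      exact hsep p hp q hq fun h => hne (by rw [h])

end Doubling

/-! ### From the isomorphism `g` to a Lipschitz section of the flow. -/

section SuspensionGeometry

variable {X : Type*}

lemma BWChain.length_nonneg [MetricSpace X] {T : X → X} {p q : X × ℝ} {ℓ : ℝ}
    (h : BWChain T p q ℓ) : 0 ≤ ℓ := by
  induction h with
  | nil p => exact le_rfl
  | horizontal hs hs' _ ih =>
    have := mul_nonneg (sub_nonneg.2 hs') (dist_nonneg (x := ‹X›) (y := ‹X›))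
    exact add_nonneg (add_nonneg (mul_nonneg (sub_nonneg.2 hs') dist_nonneg)
      (mul_nonneg hs dist_nonneg)) ih
  | vertical _ _ _ _ _ ih => exact add_nonneg (abs_nonneg _) ih
  | glue_up _ ih => exact ih
  | glue_down _ ih => exact ih

lemma bwDist_le [MetricSpace X] {T : X → X} {φ : X → ℝ} {p q : X × ℝ} {ℓ : ℝ}
    (h : BWChain T (p.1, p.2 / φ p.1) (q.1, q.2 / φ q.1) ℓ) : bwDist T φ p q ≤ ℓ :=
  csInf_le ⟨0, fun _ h => BWChain.length_nonneg h⟩ h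

lemma bwDist_base_le [MetricSpace X] (T : X → X) (φ : X → ℝ) (u v : X) :
    bwDist T φ (u, 0) (v, 0) ≤ dist u v := by
  apply bwDist_le
  have := BWChain.horizontal (T := T) (u := u) (v := v) le_rfl zero_le_one (BWChain.nil (v, (0 : ℝ)))
  simpa using this

lemma bwDist_vertical_le [MetricSpace X] (T : X → X) {φ : X → ℝ} (hφ : ∀ u, 0 < φ u) {u : X}
    {s s' : ℝ} (hs : s ∈ Ico 0 (φ u)) (hs' : s' ∈ Ico 0 (φ u)) :
    bwDist T φ (u, s) (u, s') ≤ |s - s'| / φ u := by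
  apply bwDist_le
  have hdiv : ∀ a ∈ Ico 0 (φ u), 0 ≤ a / φ u ∧ a / φ u ≤ 1 := fun a ha =>
    ⟨div_nonneg ha.1 (hφ u).le, (div_le_one (hφ u)).2 ha.2.le⟩
  have := BWChain.vertical (T := T) (u := u) (hdiv s hs).1 (hdiv s hs).2 (hdiv s' hs').1
    (hdiv s' hs').2 (BWChain.nil (u, s' / φ u))
  rwa [add_zero, ← sub_div, abs_div, abs_of_pos (hφ u)] at this

lemma strictMono_birkhoffSum {T : X → X} {φ : X → ℝ} (hφ : ∀ u, 0 < φ u) (u : X) :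
    StrictMono fun n => birkhoffSum T φ n u := by
  refine strictMono_nat_of_lt_succ fun n => ?_
  simp only [birkhoffSum_succ]
  linarith [hφ (T^[n] u)]

lemma lapNumber_eq {T : X → X} {φ : X → ℝ} (hφ : ∀ u, 0 < φ u) {u : X} {a : ℝ} {n : ℕ}
    (h1 : birkhoffSum T φ n u ≤ a) (h2 : a < birkhoffSum T φ (n + 1) u) :
    lapNumber T φ u a = n := by
  have hle : ∀ k, birkhoffSum T φ k u ≤ a → k ≤ n := fun k hk => by
    by_contra! hlt
    exact absurd (((strictMono_birkhoffSum (T := T) hφ u).monotone hlt).trans hk) (not_le.2 h2)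
  exact le_antisymm (csSup_le ⟨n, h1⟩ hle) (le_csSup ⟨n, hle⟩ h1)

lemma suspensionFlow_of_lt {T : X → X} {φ : X → ℝ} (hφ : ∀ u, 0 < φ u) {u : X} {s t : ℝ}
    (h0 : 0 ≤ s + t) (h : s + t < φ u) : suspensionFlow T φ t (u, s) = (u, s + t) := by
  have : lapNumber T φ u (s + t) = 0 := lapNumber_eq hφ (by simpa using h0) (by simpa using h)
  simp [suspensionFlow, this]

lemma suspensionFlow_of_eq {T : X → X} {φ : X → ℝ} (hφ : ∀ u, 0 < φ u) {u : X} {s t : ℝ}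
    (h : s + t = φ u) : suspensionFlow T φ t (u, s) = (T u, 0) := by
  have : lapNumber T φ u (s + t) = 1 := lapNumber_eq hφ (by simp [h])
    (by simp [h, birkhoffSum_succ, hφ])
  rw [h] at this
  simp [suspensionFlow, this, h]

lemma measurableSet_suspensionSpace [MeasurableSpace X] {φ : X → ℝ} (hφ : Measurable φ) :
    MeasurableSet (suspensionSpace φ) :=
  (measurableSet_le measurable_const measurable_snd).inter
    (measurableSet_lt measurable_snd (hφ.comp measurable_fst))

lemma prod_suspensionSpace [MeasurableSpace X] (μ : Measure X) [SFinite μ] {φ : X → ℝ}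
    (hφ : Measurable φ) :
    μ.prod volume (suspensionSpace φ) = ∫⁻ u, ENNReal.ofReal (φ u) ∂μ := by
  rw [Measure.prod_apply (measurableSet_suspensionSpace hφ)]
  refine lintegral_congr fun u => ?_
  have : Prod.mk u ⁻¹' suspensionSpace φ = Ico 0 (φ u) := by
    ext s; simp [suspensionSpace]
  rw [this, Real.volume_Ico, sub_zero]

/-- Data extracted from a Lipschitz isomorphism between a suspension flow and a flow on `M`:
a section `F` of the flow `Ψ`, through which the suspension flow is read in `M`. -/
structure IsFlowSection {M : Type*} [MetricSpace M] [MeasurableSpace M] [MetricSpace X]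
    [MeasurableSpace X] (Ψ : Flow ℝ M) (ν : Measure M) (T : X → X) (φ : X → ℝ) (μ : Measure X)
    (F : X → M) (L : ℝ≥0) : Prop where
  lipschitz : LipschitzWith L F
  roof : ∀ᵐ u ∂μ, Ψ (φ u) (F u) = F (T u)
  vertical : ∀ᵐ u ∂μ, ∀ s ∈ Ico 0 (φ u), ∀ s' ∈ Ico 0 (φ u),
    dist (Ψ s (F u)) (Ψ s' (F u)) ≤ L * (|s - s'| / φ u)
  null : ∀ E, MeasurableSet E →
    (μ.prod volume).restrict (suspensionSpace φ) ((fun p : X × ℝ => Ψ p.2 (F p.1)) ⁻¹' E) = 0 →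
    ν E = 0

/-- The conjugacy is only known on `Y'`, which may miss the base altogether. By Fubini, almost every
fibre contains heights of `Y'` tending to 0, and the continuity of `g` along fibres and of `Ψ`
extends the conjugacy to the base point and up to the roof. -/
lemma IsSuspensionIsomorphism.exists_isFlowSection {M : Type*} [MetricSpace M] [MeasurableSpace M]
    [MetricSpace X] [MeasurableSpace X] {Ψ : Flow ℝ M} {ν : Measure M} {T : X → X} {φ : X → ℝ}
    {μ : Measure X} [IsProbabilityMeasure μ] (hφ_pos : ∀ u, 0 < φ u) (hφ_meas : Measurable φ)
    (hφ_int : Integrable φ μ) {g : X × ℝ → M}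
    (hg : IsSuspensionIsomorphism Ψ ν T φ μ g) (hg_lip : IsBWLipschitz T φ g) :
    ∃ L : ℝ≥0, IsFlowSection Ψ ν T φ μ (fun u => g (u, 0)) L := by
  obtain ⟨L, hL⟩ := hg_lip
  obtain ⟨Y', M', hY'sub, hY', -, -, hmaps, hconj, -⟩ := hg.exists_conj
  have hbase : ∀ u, (u, (0 : ℝ)) ∈ suspensionSpace φ := fun u => ⟨le_rfl, hφ_pos u⟩
  have hvert : ∀ u, ∀ s ∈ Ico 0 (φ u), ∀ s' ∈ Ico 0 (φ u),
      dist (g (u, s)) (g (u, s')) ≤ L * (|s - s'| / φ u) := fun u s hs s' hs' =>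
    (hL _ hs _ hs').trans (by gcongr; exact bwDist_vertical_le T hφ_pos hs hs')
  have hZtop : μ.prod volume (suspensionSpace φ) ≠ ⊤ := by
    rw [prod_suspensionSpace μ hφ_meas]
    exact hφ_int.lintegral_lt_top.ne
  have hac : (μ.prod volume).restrict (suspensionSpace φ) ≪ suspensionMeasure μ φ := by
    unfold suspensionMeasure
    exact Measure.absolutelyContinuous_smul (ENNReal.inv_ne_zero.2 hZtop)
  have hac' : suspensionMeasure μ φ ≪ (μ.prod volume).restrict (suspensionSpace φ) := by
    unfold suspensionMeasure
    exact Measure.smul_absolutelyContinuous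
  have hY'' : ∀ᵐ u ∂μ, ∀ᵐ s : ℝ, s ∈ Ico 0 (φ u) → (u, s) ∈ Y' := by
    have h1 : ∀ᵐ y ∂(μ.prod volume).restrict (suspensionSpace φ), y ∈ Y' := hac.ae_le hY'
    rw [ae_restrict_iff' (measurableSet_suspensionSpace hφ_meas)] at h1
    exact (Measure.ae_ae_of_ae_prod h1).mono fun u hu => hu.mono fun s hs hsu => hs hsu
  have hflow : ∀ᵐ u ∂μ, (∀ s ∈ Ico 0 (φ u), g (u, s) = Ψ s (g (u, 0))) ∧
      Ψ (φ u) (g (u, 0)) = g (T u, 0) := by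
    filter_upwards [hY''] with u hu
    -- heights in `Y'` accumulate at the base
    have hex : ∀ ε > 0, ∃ s, 0 < s ∧ s < ε ∧ s < φ u ∧ (u, s) ∈ Y' := by
      intro ε hε
      have hpos : 0 < min ε (φ u) := lt_min hε (hφ_pos u)
      have h1 : volume (Ioo 0 (min ε (φ u))) ≠ 0 := by simpa using ⟨hε, hφ_pos u⟩
      have h2 : ∃ᵐ s : ℝ, s ∈ Ioo 0 (min ε (φ u)) := by
        rw [frequently_ae_iff]; exact h1
      obtain ⟨s, hs, hs'⟩ := (h2.and_eventually hu).exists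
      have h3 := hs.2.trans_le (min_le_right _ _)
      exact ⟨s, hs.1, hs.2.trans_le (min_le_left _ _), h3, hs' ⟨hs.1.le, h3⟩⟩
    have hex' : ∀ n : ℕ, ∃ s, 0 < s ∧ s < 1 / ((n : ℝ) + 1) ∧ s < φ u ∧ (u, s) ∈ Y' :=
      fun n => hex _ (by positivity)
    choose σ hσ0 hσn hσφ hσY using hex'
    have hσlim : Tendsto σ atTop (𝓝 0) :=
      squeeze_zero (fun n => (hσ0 n).le) (fun n => (hσn n).le) tendsto_one_div_add_atTop_nhds_zero_nat
    have hglim : Tendsto (fun n => g (u, σ n)) atTop (𝓝 (g (u, 0))) := by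
      rw [tendsto_iff_dist_tendsto_zero]
      have h1 : Tendsto (fun n => (L : ℝ) * (|σ n - 0| / φ u)) atTop (𝓝 0) := by
        have := ((hσlim.sub_const 0).abs.div_const (φ u)).const_mul (L : ℝ)
        simpa using this
      exact squeeze_zero (fun _ => dist_nonneg)
        (fun n => hvert u _ ⟨(hσ0 n).le, hσφ n⟩ _ (hbase u)) h1
    have hlim : ∀ s, Tendsto (fun n => Ψ (s - σ n) (g (u, σ n))) atTop (𝓝 (Ψ s (g (u, 0)))) := by
      intro s
      have h1 : Tendsto (fun n => s - σ n) atTop (𝓝 s) := by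
        simpa using hσlim.const_sub s
      exact (Ψ.cont'.tendsto (s, g (u, 0))).comp (h1.prodMk_nhds hglim)
    refine ⟨fun s hs => ?_, ?_⟩
    · rcases hs.1.eq_or_lt with h0 | h0
      · rw [← h0, Ψ.map_zero_apply]
      · refine tendsto_nhds_unique ?_ (hlim s)
        refine tendsto_const_nhds.congr' ?_
        filter_upwards [hσlim.eventually (gt_mem_nhds h0)] with n hn
        rw [hconj _ (by linarith) _ (hσY n),
          suspensionFlow_of_lt hφ_pos (by linarith) (by linarith [hs.2])]
        congr 2
        ring
    -- From height `σ n`, the time `φ u - σ n` ends exactly on the roof, that is at `(T u, 0)`, so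
    -- the sequence is constant.
    · refine tendsto_nhds_unique (hlim (φ u)) ?_
      refine tendsto_const_nhds.congr fun n => ?_
      rw [hconj _ (by linarith [hσφ n]) _ (hσY n), suspensionFlow_of_eq hφ_pos (by ring)]
  refine ⟨L, ?_, ?_, ?_, ?_⟩
  · refine LipschitzWith.of_dist_le_mul fun u v => (hL _ (hbase u) _ (hbase v)).trans ?_
    gcongr
    exact bwDist_base_le T φ u v
  · exact hflow.mono fun u hu => hu.2
  · filter_upwards [hflow] with u hu s hs s' hs'
    rw [← hu.1 s hs, ← hu.1 s' hs']
    exact hvert u s hs s' hs'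
  · intro E hE h0
    rw [← hg.map_eq, Measure.map_apply_of_aemeasurable hg.aemeasurable hE]
    have h1 : ∀ᵐ p ∂(μ.prod volume).restrict (suspensionSpace φ),
        g p = Ψ p.2 (g (p.1, 0)) := by
      rw [ae_restrict_iff' (measurableSet_suspensionSpace hφ_meas)]
      filter_upwards [Measure.quasiMeasurePreserving_fst.ae hflow] with p hp hpY
      exact hp.1 p.2 hpY
    have h2 := hac' h0
    refine measure_mono_null_ae ?_ h2
    filter_upwards [hac'.ae_le h1] with p hp hpE
    change Ψ p.2 (g (p.1, 0)) ∈ E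
    rwa [← hp]

/-! ### Growth of the Birkhoff sums of the roof. -/

section Birkhoff

variable [MeasurableSpace X] {μ : Measure X} {T : X → X} {φ : X → ℝ}

lemma measurable_birkhoffSum (hT : Measurable T) (hφ : Measurable φ) (n : ℕ) :
    Measurable (birkhoffSum T φ n) := by
  unfold birkhoffSum
  exact Finset.measurable_sum _ fun k _ => hφ.comp (hT.iterate k)

/-- The mean of `φ` on the set of points whose `n`-th Birkhoff sum is at most `t` is at most
`t / n`. -/
lemma setIntegral_birkhoffSum_le [IsProbabilityMeasure μ] (hT : MeasurePreserving T μ μ)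
    (hφ_pos : ∀ u, 0 < φ u) (hφ_meas : Measurable φ) (hφ_int : Integrable φ μ) (n : ℕ) {t : ℝ}
    (ht : 0 ≤ t) : n * ∫ u in {u | birkhoffSum T φ n u ≤ t}, φ u ∂μ ≤ t := by
  have hmeas := fun j => measurable_birkhoffSum (φ := φ) hT.measurable hφ_meas j
  have hnonneg : ∀ j u, 0 ≤ birkhoffSum T φ j u := fun j u =>
    Finset.sum_nonneg fun k _ => (hφ_pos _).le
  -- Truncation makes these sums integrable and bounded. For `j < n`, `f (j + 1) - f j ∘ T` equals
  -- `φ` where the `n`-th sum is at most `t` and is nonnegative elsewhere; by invariance its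
  -- integrals telescope to that of `f n`, at most `t`.
  set f : ℕ → X → ℝ := fun j u => min t (birkhoffSum T φ j u) with hf
  have hfm : ∀ j, Measurable (f j) := fun j => measurable_const.min (hmeas j)
  have hfb : ∀ j u, ‖f j u‖ ≤ t := fun j u => by
    rw [Real.norm_of_nonneg (le_min ht (hnonneg j u))]
    exact min_le_left _ _
  have hfi : ∀ j, Integrable (f j) μ := fun j =>
    (integrable_const t).mono' (hfm j).aestronglyMeasurable (ae_of_all _ (hfb j))
  have hfi' : ∀ j, Integrable (fun u => f j (T u)) μ := fun j =>
    hT.integrable_comp_of_integrable (hfi j)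
  have hA : MeasurableSet {u | birkhoffSum T φ n u ≤ t} :=
    measurableSet_le (hmeas n) measurable_const
  have hstep : ∀ j < n, ∫ u in {u | birkhoffSum T φ n u ≤ t}, φ u ∂μ ≤
      ∫ u, f (j + 1) u ∂μ - ∫ u, f j u ∂μ := by
    intro j hj
    have e1 : ∫ u, f j u ∂μ = ∫ u, f j (T u) ∂μ := by
      have := integral_map (f := f j) hT.measurable.aemeasurable
        (by rw [hT.map_eq]; exact (hfm j).aestronglyMeasurable)
      rwa [hT.map_eq] at this
    rw [e1, ← integral_sub (hfi _) (hfi' _), ← integral_indicator hA]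
    refine integral_mono (hφ_int.indicator hA) ((hfi _).sub (hfi' _)) fun u => ?_
    have hsucc : birkhoffSum T φ (j + 1) u = φ u + birkhoffSum T φ j (T u) :=
      birkhoffSum_succ' T φ j u
    simp only [hf]
    by_cases hu : birkhoffSum T φ n u ≤ t
    · rw [indicator_of_mem (show u ∈ {u | birkhoffSum T φ n u ≤ t} from hu)]
      have h1 : birkhoffSum T φ (j + 1) u ≤ t :=
        ((strictMono_birkhoffSum (T := T) hφ_pos u).monotone (show j + 1 ≤ n from hj)).trans hu
      have h2 : birkhoffSum T φ j (T u) ≤ t := by linarith [hφ_pos u]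
      rw [min_eq_right h1, min_eq_right h2, hsucc]
      linarith
    · rw [indicator_of_notMem (show u ∉ {u | birkhoffSum T φ n u ≤ t} from hu)]
      refine sub_nonneg.2 (min_le_min_left _ ?_)
      rw [hsucc]
      linarith [hφ_pos u]
  have hsum := Finset.sum_le_sum fun j (hj : j ∈ Finset.range n) =>
    hstep j (Finset.mem_range.1 hj)
  rw [Finset.sum_const, Finset.card_range, nsmul_eq_mul,
    Finset.sum_range_sub (fun j => ∫ u, f j u ∂μ)] at hsum
  refine hsum.trans ?_
  have e0 : ∫ u, f 0 u ∂μ = 0 := by simp [hf, ht]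
  rw [e0, sub_zero]
  calc ∫ u, f n u ∂μ ≤ ∫ _, t ∂μ :=
        integral_mono (hfi n) (integrable_const _) fun u => min_le_left _ _
    _ = t := by simp

/-- Borel-Cantelli for the measure of density `φ`, which has the same null sets as `μ` because `φ >
0`: the bad sets have mass at most `(β / 2) ^ i`. Almost linear growth is enough here, so neither
ergodicity nor Birkhoff's theorem is needed. -/
lemma ae_eventually_lt_birkhoffSum [IsProbabilityMeasure μ] (hT : MeasurePreserving T μ μ)
    (hφ_pos : ∀ u, 0 < φ u) (hφ_meas : Measurable φ) (hφ_int : Integrable φ μ) {β : ℝ}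
    (hβ : 1 < β) (hβ2 : β < 2) :
    ∀ᵐ u ∂μ, ∀ᶠ i : ℕ in atTop, β ^ i < birkhoffSum T φ (2 ^ i) u := by
  have hmeas := fun j => measurable_birkhoffSum (φ := φ) hT.measurable hφ_meas j
  set μφ := μ.withDensity fun u => ENNReal.ofReal (φ u)
  have hac : μ ≪ μφ := by
    refine withDensity_absolutelyContinuous' hφ_meas.ennreal_ofReal.aemeasurable ?_
    exact ae_of_all _ fun u => by simpa using hφ_pos u
  refine hac.ae_le ?_
  have hsum : ∑' i : ℕ, μφ {u | birkhoffSum T φ (2 ^ i) u ≤ β ^ i} ≠ ⊤ := by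
    have hle : ∀ i : ℕ, μφ {u | birkhoffSum T φ (2 ^ i) u ≤ β ^ i} ≤
        ENNReal.ofReal ((β / 2) ^ i) := by
      intro i
      have hA : MeasurableSet {u | birkhoffSum T φ (2 ^ i) u ≤ β ^ i} :=
        measurableSet_le (hmeas _) measurable_const
      rw [withDensity_apply _ hA, ← ofReal_integral_eq_lintegral_ofReal hφ_int.integrableOn
        (ae_of_all _ fun u => (hφ_pos u).le)]
      apply ENNReal.ofReal_le_ofReal
      have h1 := setIntegral_birkhoffSum_le hT hφ_pos hφ_meas hφ_int (2 ^ i)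
        (show 0 ≤ β ^ i by positivity)
      push_cast at h1
      rw [div_pow, le_div_iff₀ (by positivity)]
      linarith
    refine ne_top_of_le_ne_top ?_ (ENNReal.tsum_le_tsum hle)
    have hs : Summable fun i : ℕ => (β / 2) ^ i :=
      summable_geometric_of_lt_one (by positivity) (by linarith)
    rw [← ENNReal.ofReal_tsum_of_nonneg (fun i => by positivity) hs]
    exact ENNReal.ofReal_ne_top
  filter_upwards [ae_eventually_notMem hsum] with u hu
  filter_upwards [hu] with i hi
  simpa using hi

end Birkhoff

end SuspensionGeometry

/-! ### Visits near a regular point, tubes around orbits and decay of correlations. -/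

section Core

variable {M : Type*} [MetricSpace M] {X : Type*} [MetricSpace X]

/-- In a time interval of length `δ`, two visits to the ball are less than `2 * r / δ` apart, since
the speed is at least `δ`; about `S / δ` such intervals cover `[0, S]`. -/
lemma IsRegularAt.volume_visits_le {Ψ : Flow ℝ M} {δ : ℝ} {z : M}
    (hz : IsRegularAt Ψ δ z) (hδ : 0 < δ) {S r : ℝ} (hr : r ≤ δ) (w : M) :
    volume (Icc 0 S ∩ {s | Ψ s w ∈ Metric.ball z r}) ≤
      ENNReal.ofReal ((⌊S / δ⌋₊ + 1) * (2 / δ) * r) := by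
  set V := Icc 0 S ∩ {s | Ψ s w ∈ Metric.ball z r}
  have hsub : V ⊆ ⋃ k ∈ Finset.range (⌊S / δ⌋₊ + 1), V ∩ Icc (k * δ) ((k + 1) * δ) := by
    intro s hs
    have hs0 : 0 ≤ s / δ := div_nonneg hs.1.1 hδ.le
    have h1 : ⌊s / δ⌋₊ ≤ ⌊S / δ⌋₊ := Nat.floor_mono (div_le_div_of_nonneg_right hs.1.2 hδ.le)
    refine mem_iUnion₂.2 ⟨⌊s / δ⌋₊, Finset.mem_range.2 (by omega), hs, ?_, ?_⟩
    · have := Nat.floor_le hs0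
      rwa [le_div_iff₀ hδ] at this
    · have := (Nat.lt_floor_add_one (s / δ)).le
      rwa [div_le_iff₀ hδ] at this
  have hpiece : ∀ k : ℕ, volume (V ∩ Icc (k * δ) ((k + 1) * δ)) ≤ ENNReal.ofReal (2 / δ * r) := by
    intro k
    refine (Real.volume_le_diam _).trans (Metric.ediam_le fun s hs s' hs' => ?_)
    have h1 : |s' - s| ≤ δ := by
      rw [abs_le]
      constructor <;> nlinarith [hs.2.1, hs.2.2, hs'.2.1, hs'.2.2]
    have h2 := hz.1 (Ψ s w) (Metric.ball_subset_ball hr hs.1.2) (s' - s) h1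
    rw [← Ψ.map_add, sub_add_cancel] at h2
    have h3 : dist (Ψ s' w) (Ψ s w) < 2 * r := by
      have a1 := Metric.mem_ball.1 hs.1.2
      have a2 := Metric.mem_ball.1 hs'.1.2
      linarith [dist_triangle_right (Ψ s' w) (Ψ s w) z]
    rw [edist_dist, Real.dist_eq, abs_sub_comm]
    apply ENNReal.ofReal_le_ofReal
    rw [div_mul_eq_mul_div, le_div_iff₀ hδ]
    linarith
  calc volume V ≤ ∑ k ∈ Finset.range (⌊S / δ⌋₊ + 1), volume (V ∩ Icc (k * δ) ((k + 1) * δ)) :=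
        (measure_mono hsub).trans (measure_biUnion_finset_le _ _)
    _ ≤ ∑ k ∈ Finset.range (⌊S / δ⌋₊ + 1), ENNReal.ofReal (2 / δ * r) :=
        Finset.sum_le_sum fun k _ => hpiece k
    _ = _ := by
        rw [Finset.sum_const, Finset.card_range, nsmul_eq_mul, mul_assoc,
          ENNReal.ofReal_mul (p := (⌊S / δ⌋₊ + 1 : ℝ)) (by positivity)]
        congr 1
        exact_mod_cast (ENNReal.ofReal_natCast (⌊S / δ⌋₊ + 1)).symm

/-- The roof is bounded above the orbits which visit a neighbourhood of a regular point. -/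
lemma IsRegularAt.roof_le {Ψ : Flow ℝ M} {δ : ℝ} {z : M} (hz : IsRegularAt Ψ δ z) (hδ : 0 < δ)
    {L h s : ℝ} {w : M} (hs : s ∈ Ico 0 h)
    (hvert : ∀ s ∈ Ico 0 h, ∀ s' ∈ Ico 0 h, dist (Ψ s w) (Ψ s' w) ≤ L * (|s - s'| / h))
    (hball : Ψ s w ∈ Metric.ball z δ) : h ≤ L / δ := by
  have hh : 0 < h := hs.1.trans_lt hs.2
  -- A displacement by time `e` stays on the fibre and has length at least `δ * e` and at most `L *
  -- e / h`.
  set e := min δ ((h - s) / 2) with he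
  have he0 : 0 < e := lt_min hδ (by linarith [hs.2])
  have he1 : e ≤ (h - s) / 2 := min_le_right _ _
  have h1 := hz.1 _ hball e (by rw [abs_of_pos he0]; exact min_le_left _ _)
  have h2 := hvert (e + s) ⟨by linarith [hs.1], by linarith [hs.2]⟩ s hs
  rw [Ψ.map_add, add_sub_cancel_right] at h2
  rw [abs_of_pos he0] at h1 h2
  have h3 := h1.trans h2
  rw [← mul_div_assoc, le_div_iff₀ hh] at h3
  rw [le_div_iff₀ hδ]
  nlinarith

variable [MeasurableSpace M] [BorelSpace M] [CompactSpace M] [MeasurableSpace X] [BorelSpace X]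

lemma measurable_flow_section (Ψ : Flow ℝ M) {F : X → M} (hF : Continuous F) :
    Measurable fun p : X × ℝ => Ψ p.2 (F p.1) := by
  have h1 : Measurable (fun q : ℝ × M => Ψ q.1 q.2) := Ψ.cont'.measurable
  exact h1.comp (measurable_snd.prodMk (hF.measurable.comp measurable_fst))

/-- The law of `Ψ_s (F u)` when `(u, s)` is distributed according to `μ ⊗ Leb` on
`X × [0, S]`. -/
def sectionMeasure (Ψ : Flow ℝ M) (μ : Measure X) (F : X → M) (S : ℝ) : Measure M :=
  (μ.prod (volume.restrict (Icc 0 S))).map fun p => Ψ p.2 (F p.1)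

lemma sectionMeasure_univ (Ψ : Flow ℝ M) (μ : Measure X) [IsProbabilityMeasure μ] {F : X → M}
    (hF : Continuous F) (S : ℝ) : sectionMeasure Ψ μ F S univ = ENNReal.ofReal S := by
  unfold sectionMeasure
  rw [Measure.map_apply (measurable_flow_section Ψ hF) MeasurableSet.univ, preimage_univ,
    ← univ_prod_univ, Measure.prod_prod]
  simp

lemma sectionMeasure_apply (Ψ : Flow ℝ M) (μ : Measure X) [SFinite μ] {F : X → M}
    (hF : Continuous F) (S : ℝ) {A : Set M} (hA : MeasurableSet A) :
    sectionMeasure Ψ μ F S A = ∫⁻ u, volume (Icc 0 S ∩ {s | Ψ s (F u) ∈ A}) ∂μ := by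
  unfold sectionMeasure
  rw [Measure.map_apply (measurable_flow_section Ψ hF) hA,
    Measure.prod_apply (measurable_flow_section Ψ hF hA)]
  refine lintegral_congr fun u => ?_
  have hm : MeasurableSet (Prod.mk u ⁻¹' ((fun p : X × ℝ => Ψ p.2 (F p.1)) ⁻¹' A)) :=
    measurable_prodMk_left (measurable_flow_section Ψ hF hA)
  rw [Measure.restrict_apply hm, inter_comm]
  rfl

/-- The trapezoidal bump function of the distance to `γ`. -/
def bump (γ : Set M) (a : ℝ) (x : M) : ℝ := max 0 (min 1 (2 - Metric.infDist x γ / a))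

omit [MeasurableSpace M] [BorelSpace M] [CompactSpace M] in
lemma lipschitzWith_bump (γ : Set M) {a : ℝ≥0} (ha : 0 < a) : LipschitzWith (1 / a) (bump γ a) := by
  have h1 : LipschitzWith (1 / a) fun x => 2 - Metric.infDist x γ / a := by
    refine LipschitzWith.of_dist_le_mul fun x y => ?_
    have := (Metric.lipschitz_infDist_pt γ).dist_le_mul x y
    rw [Real.dist_eq] at this ⊢
    have e : 2 - Metric.infDist x γ / a - (2 - Metric.infDist y γ / a) =
      -((Metric.infDist x γ - Metric.infDist y γ) / a) := by ring
    rw [e, abs_neg, abs_div, NNReal.abs_eq]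
    push_cast
    rw [div_mul_eq_mul_div, one_mul]
    gcongr
    simpa using this
  exact (h1.const_min 1).const_max 0

omit [MeasurableSpace M] [BorelSpace M] [CompactSpace M] in
lemma bump_nonneg (γ : Set M) (a : ℝ) (x : M) : 0 ≤ bump γ a x := le_max_left _ _

omit [MeasurableSpace M] [BorelSpace M] [CompactSpace M] in
lemma bump_le_one (γ : Set M) (a : ℝ) (x : M) : bump γ a x ≤ 1 :=
  max_le zero_le_one (min_le_left _ _)

omit [MeasurableSpace M] [BorelSpace M] [CompactSpace M] in
lemma one_le_bump {γ : Set M} {a : ℝ} (ha : 0 < a) {x : M} (h : Metric.infDist x γ ≤ a) :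
    1 ≤ bump γ a x := by
  refine le_max_of_le_right (le_min le_rfl ?_)
  have := (div_le_one ha).2 h
  linarith

omit [MeasurableSpace M] [BorelSpace M] [CompactSpace M] in
lemma bump_eq_zero {γ : Set M} {a : ℝ} (ha : 0 < a) {x : M} (h : 2 * a ≤ Metric.infDist x γ) :
    bump γ a x = 0 := by
  refine max_eq_left ((min_le_right _ _).trans ?_)
  have := (le_div_iff₀ ha).2 h
  linarith

omit [MeasurableSpace M] [BorelSpace M] [CompactSpace M] in
/-- Decay of correlations bounds the measure of the points which are close to `γ` at the times
`0` and `n`, when the position is observed through a Lipschitz map `F`. -/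
lemma measure_near_inter_near_le {μ : Measure X} [IsProbabilityMeasure μ] {T : X → X}
    (hT : MeasurePreserving T μ μ) {F : X → M} {L : ℝ≥0} (hF : LipschitzWith L F) {θ : ℕ → ℝ}
    (hθ : ∀ (f₁ f₂ : X → ℝ) (B₁ B₂ K₁ K₂ : ℝ≥0),
      LipschitzWith K₁ f₁ → LipschitzWith K₂ f₂ → (∀ u, |f₁ u| ≤ B₁) → (∀ u, |f₂ u| ≤ B₂) →
      ∀ n : ℕ, 1 ≤ n →
        |(∫ u, f₁ (T^[n] u) * f₂ u ∂μ) - (∫ u, f₁ u ∂μ) * (∫ u, f₂ u ∂μ)|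
          ≤ (B₁ + K₁) * (B₂ + K₂) * θ n)
    (γ : Set M) {a : ℝ≥0} (ha : 0 < a) {n : ℕ} (hn : 1 ≤ n) :
    μ {u | Metric.infDist (F u) γ ≤ a ∧ Metric.infDist (F (T^[n] u)) γ ≤ a} ≤
      μ {u | Metric.infDist (F u) γ < 2 * a} ^ 2 + ENNReal.ofReal ((1 + L / a) ^ 2 * θ n) := by
  -- `f` lies between the indicators of the tubes of widths `a` and `2 * a`; its supremum is at most
  -- 1 and its Lipschitz constant at most `L / a`.
  set f : X → ℝ := fun u => bump γ a (F u)
  have hflip : LipschitzWith (1 / a * L) f := (lipschitzWith_bump γ ha).comp hF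
  have hfm : Measurable f := hflip.continuous.measurable
  have hf0 : ∀ u, 0 ≤ f u := fun u => bump_nonneg _ _ _
  have hf1 : ∀ u, f u ≤ 1 := fun u => bump_le_one _ _ _
  have hTn := (hT.iterate n).measurable
  have hcorr := hθ f f 1 1 _ _ hflip hflip
    (fun u => by simpa [abs_of_nonneg (hf0 u)] using hf1 u)
    (fun u => by simpa [abs_of_nonneg (hf0 u)] using hf1 u) n hn
  have hfi : Integrable f μ := (integrable_const (1 : ℝ)).mono' hfm.aestronglyMeasurable
    (ae_of_all _ fun u => by rw [Real.norm_of_nonneg (hf0 u)]; exact hf1 u)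
  have hffm : Measurable fun u => f (T^[n] u) * f u := (hfm.comp hTn).mul hfm
  have hffi : Integrable (fun u => f (T^[n] u) * f u) μ :=
    (integrable_const (1 : ℝ)).mono' hffm.aestronglyMeasurable (ae_of_all _ fun u => by
      rw [Real.norm_of_nonneg (mul_nonneg (hf0 _) (hf0 _))]
      exact mul_le_one₀ (hf1 _) (hf0 _) (hf1 _))
  have hdist : Measurable fun u => Metric.infDist (F u) γ :=
    ((Metric.continuous_infDist_pt γ).comp hF.continuous).measurable
  have hE : MeasurableSet {u | Metric.infDist (F u) γ ≤ a ∧ Metric.infDist (F (T^[n] u)) γ ≤ a} :=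
    (measurableSet_le hdist measurable_const).inter
      (measurableSet_le (hdist.comp hTn) measurable_const)
  have hW : MeasurableSet {u | Metric.infDist (F u) γ < 2 * a} :=
    measurableSet_lt hdist measurable_const
  have h1 : μ.real {u | Metric.infDist (F u) γ ≤ a ∧ Metric.infDist (F (T^[n] u)) γ ≤ a} ≤
      ∫ u, f (T^[n] u) * f u ∂μ := by
    rw [← integral_indicator_one hE]
    refine integral_mono ((integrable_const (1 : ℝ)).indicator hE) hffi fun u => ?_
    by_cases hu : Metric.infDist (F u) γ ≤ a ∧ Metric.infDist (F (T^[n] u)) γ ≤ a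
    · rw [indicator_of_mem (show u ∈ {u | Metric.infDist (F u) γ ≤ a ∧
        Metric.infDist (F (T^[n] u)) γ ≤ a} from hu)]
      exact one_le_mul_of_one_le_of_one_le (one_le_bump ha hu.2) (one_le_bump ha hu.1)
    · rw [indicator_of_notMem (show u ∉ {u | Metric.infDist (F u) γ ≤ a ∧
        Metric.infDist (F (T^[n] u)) γ ≤ a} from hu)]
      exact mul_nonneg (hf0 _) (hf0 _)
  have h2 : ∫ u, f u ∂μ ≤ μ.real {u | Metric.infDist (F u) γ < 2 * a} := by
    rw [← integral_indicator_one hW]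
    refine integral_mono hfi ((integrable_const (1 : ℝ)).indicator hW) fun u => ?_
    by_cases hu : Metric.infDist (F u) γ < 2 * a
    · rw [indicator_of_mem (show u ∈ {u | Metric.infDist (F u) γ < 2 * a} from hu)]
      exact hf1 u
    · rw [indicator_of_notMem (show u ∉ {u | Metric.infDist (F u) γ < 2 * a} from hu)]
      exact (bump_eq_zero ha (not_lt.1 hu)).le
  have h3 : 0 ≤ ∫ u, f u ∂μ := integral_nonneg hf0
  have h4 : μ.real {u | Metric.infDist (F u) γ ≤ a ∧ Metric.infDist (F (T^[n] u)) γ ≤ a} ≤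
      μ.real {u | Metric.infDist (F u) γ < 2 * a} ^ 2 + (1 + L / a) ^ 2 * θ n := by
    have h5 := (abs_le.1 hcorr).2
    have h6 : (∫ u, f u ∂μ) * (∫ u, f u ∂μ) ≤
        μ.real {u | Metric.infDist (F u) γ < 2 * a} ^ 2 := by
      rw [sq]; gcongr
    push_cast at h5
    have e : (1 + 1 / (a : ℝ) * L) * (1 + 1 / (a : ℝ) * L) * θ n = (1 + L / a) ^ 2 * θ n := by ring
    linarith
  calc μ {u | Metric.infDist (F u) γ ≤ a ∧ Metric.infDist (F (T^[n] u)) γ ≤ a}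
      = ENNReal.ofReal (μ.real {u | Metric.infDist (F u) γ ≤ a ∧
          Metric.infDist (F (T^[n] u)) γ ≤ a}) := (ofReal_measureReal (measure_ne_top _ _)).symm
    _ ≤ ENNReal.ofReal (μ.real {u | Metric.infDist (F u) γ < 2 * a} ^ 2) +
          ENNReal.ofReal ((1 + L / a) ^ 2 * θ n) :=
        (ENNReal.ofReal_le_ofReal h4).trans ENNReal.ofReal_add_le
    _ = _ := by
        rw [ENNReal.ofReal_pow measureReal_nonneg, ofReal_measureReal (measure_ne_top _ _)]

end Core

section LapReturn

variable {M : Type*} [MetricSpace M] {X : Type*} [MetricSpace X]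

/-- The points `(u, s)` such that the piece of orbit issued from `T^n u` meets the ball of radius
`r` around the point of `M` represented by `(u, s)`. -/
def lapReturn (Ψ : Flow ℝ M) (T : X → X) (φ : X → ℝ) (F : X → M) (n : ℕ) (r : ℝ) : Set (X × ℝ) :=
  {p | ∃ s' ∈ Ico 0 (φ (T^[n] p.1)), dist (Ψ s' (F (T^[n] p.1))) (Ψ p.2 (F p.1)) < r}

variable [MeasurableSpace M] [BorelSpace M] [CompactSpace M] [MeasurableSpace X] [BorelSpace X]

/-- If `F u` is close to `Ψ (-s) z`, the orbit of `F u` is close to `z` at time `s`, and remains so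
for a duration `r`. Integrating this duration over `u` turns the measure of the tube into that of a
ball, at the price of a factor `1 / r`. -/
lemma measure_near_backward_orbit_le {Ψ : Flow ℝ M} {μ : Measure X} [SFinite μ]
    {F : X → M} (hF : Continuous F) {S C r : ℝ} (hS : 0 ≤ S) (hC1 : 1 ≤ C) (hr : 0 < r) (hr1 : r ≤ 1)
    (hC : ∀ s ∈ Icc (-(S + 1)) (S + 1), ∀ t ∈ Icc (-(S + 1)) (S + 1), ∀ x y,
      dist (Ψ s x) (Ψ t y) ≤ C * (|s - t| + dist x y)) (z : M) :
    ENNReal.ofReal r *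
      μ {u | Metric.infDist (F u) ((fun s => Ψ (-s) z) '' Icc 0 S) < 2 * (2 * C * r)} ≤
      sectionMeasure Ψ μ F (S + 1) (Metric.ball z (5 * C ^ 2 * r)) := by
  set γ := (fun s => Ψ (-s) z) '' Icc 0 S
  have hγ : γ.Nonempty := (nonempty_Icc.2 hS).image _
  have hW : MeasurableSet {u | Metric.infDist (F u) γ < 2 * (2 * C * r)} :=
    measurableSet_lt ((Metric.continuous_infDist_pt γ).comp hF).measurable measurable_const
  rw [sectionMeasure_apply Ψ μ hF _ Metric.isOpen_ball.measurableSet,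
    ← setLIntegral_const, ← lintegral_indicator hW]
  refine lintegral_mono fun u => ?_
  by_cases hu : u ∈ {u | Metric.infDist (F u) γ < 2 * (2 * C * r)}
  · rw [indicator_of_mem hu]
    obtain ⟨-, ⟨s, hs, rfl⟩, hsu⟩ := (Metric.infDist_lt_iff hγ).1 hu
    have hsub : Icc s (s + r) ⊆ Icc 0 (S + 1) ∩ {s | Ψ s (F u) ∈ Metric.ball z (5 * C ^ 2 * r)} := by
      intro t ht
      refine ⟨⟨hs.1.trans ht.1, ht.2.trans (by linarith [hs.2])⟩, ?_⟩
      have ht0 : t ∈ Icc (-(S + 1)) (S + 1) :=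
        ⟨by linarith [hs.1, ht.1], by linarith [hs.2, ht.2]⟩
      have hs0 : s ∈ Icc (-(S + 1)) (S + 1) := ⟨by linarith [hs.1], by linarith [hs.2]⟩
      have h1 := hC t ht0 s hs0 (F u) (F u)
      have h2 := hC s hs0 s hs0 (F u) (Ψ (-s) z)
      rw [← Ψ.map_add, add_neg_cancel, Ψ.map_zero_apply, sub_self, abs_zero, zero_add] at h2
      rw [dist_self, add_zero, abs_of_nonneg (by linarith [ht.1])] at h1
      -- The distance to `z` is less than `4 * C ^ 2 * r` at time `s`, and varies by at most `C * r
      -- ≤ C ^ 2 * r` until time `s + r`.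
      have h3 : C * (t - s) ≤ C * r := by gcongr; linarith [ht.2]
      have h4 : C * dist (F u) (Ψ (-s) z) < C * (2 * (2 * C * r)) := by gcongr
      have h5 : C * r ≤ C ^ 2 * r := by gcongr; nlinarith
      rw [mem_ofPred_eq, Metric.mem_ball]
      have h6 := dist_triangle (Ψ t (F u)) (Ψ s (F u)) z
      nlinarith
    calc ENNReal.ofReal r = volume (Icc s (s + r)) := by simp
      _ ≤ _ := measure_mono hsub
  · rw [indicator_of_notMem hu]
    exact zero_le

/-- Both ends of such a return lie over the tube around the backward orbit of `z`. Decay of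
correlations gives about `(ρ(B) / r) ^ 2` for the pairs of base points, and for each of them the
heights fill a set of measure `O(r)`. -/
lemma measure_lapReturn_inter_ball_le {Ψ : Flow ℝ M} {ν : Measure M} {T : X → X} {φ : X → ℝ}
    {μ : Measure X} [IsProbabilityMeasure μ] {F : X → M} {L : ℝ≥0} (hT : MeasurePreserving T μ μ)
    (hφ_meas : Measurable φ) (hF : IsFlowSection Ψ ν T φ μ F L) {θ : ℕ → ℝ}
    (hθ : ∀ (f₁ f₂ : X → ℝ) (B₁ B₂ K₁ K₂ : ℝ≥0),
      LipschitzWith K₁ f₁ → LipschitzWith K₂ f₂ → (∀ u, |f₁ u| ≤ B₁) → (∀ u, |f₂ u| ≤ B₂) →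
      ∀ n : ℕ, 1 ≤ n →
        |(∫ u, f₁ (T^[n] u) * f₂ u ∂μ) - (∫ u, f₁ u ∂μ) * (∫ u, f₂ u ∂μ)|
          ≤ (B₁ + K₁) * (B₂ + K₂) * θ n)
    (hΨ : ∀ S : ℝ, ∃ C ≥ 1, ∀ s ∈ Icc (-S) S, ∀ t ∈ Icc (-S) S, ∀ x y,
      dist (Ψ s x) (Ψ t y) ≤ C * (|s - t| + dist x y)) {δ : ℝ} (hδ : 0 < δ) :
    ∃ S : ℝ, ∃ D : ℝ, ∃ Λ : ℝ, 0 < D ∧ 1 ≤ Λ ∧ ∀ z r n, IsRegularAt Ψ δ z → 0 < r → r ≤ 1 → 2 * r ≤ δ →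
      1 ≤ n →
      (μ.prod volume).restrict (suspensionSpace φ) (lapReturn Ψ T φ F n r ∩
        (fun p : X × ℝ => Ψ p.2 (F p.1)) ⁻¹' Metric.ball z r) ≤
      ENNReal.ofReal D * (sectionMeasure Ψ μ F S (Metric.ball z (Λ * r)) ^ 2 / ENNReal.ofReal r +
        ENNReal.ofReal (|θ n| / r)) := by
  -- The bound of `IsRegularAt.roof_le` on the roofs over orbits visiting the ball.
  set S : ℝ := L / δ with hSdef
  have hS : 0 ≤ S := by positivity
  obtain ⟨C, hC1, hC⟩ := hΨ (S + 1)
  set D₀ : ℝ := (⌊S / δ⌋₊ + 1) * (2 / δ) with hD₀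
  have hD₀pos : 0 < D₀ := by positivity
  refine ⟨S + 1, D₀ * (1 + L) ^ 2, 5 * C ^ 2, by positivity, by nlinarith,
    fun z r n hz hr hr1 hrδ hn => ?_⟩
  set γ := (fun s => Ψ (-s) z) '' Icc 0 S
  -- The returning point is within `r` of a point itself within `r` of `z`; pulling back to the base
  -- multiplies `2 * r` by at most `C`.
  set a : ℝ≥0 := ⟨2 * C * r, by positivity⟩ with ha
  have ha' : (a : ℝ) = 2 * C * r := rfl
  have ha0 : 0 < a := by
    rw [← NNReal.coe_pos, ha']; positivity
  set E := {u | Metric.infDist (F u) γ ≤ a ∧ Metric.infDist (F (T^[n] u)) γ ≤ a} with hE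
  set V : Set (X × ℝ) := {p | p.1 ∈ E ∧ p.2 ∈ Icc 0 S ∧ Ψ p.2 (F p.1) ∈ Metric.ball z r} with hV
  have hdist : Measurable fun u => Metric.infDist (F u) γ :=
    ((Metric.continuous_infDist_pt γ).comp hF.lipschitz.continuous).measurable
  have hEm : MeasurableSet E :=
    (measurableSet_le hdist measurable_const).inter
      (measurableSet_le (hdist.comp (hT.iterate n).measurable) measurable_const)
  have hVm : MeasurableSet V :=
    (measurable_fst hEm).inter ((measurable_snd measurableSet_Icc).inter
      (measurable_flow_section Ψ hF.lipschitz.continuous Metric.isOpen_ball.measurableSet))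
  have hnear : ∀ w : M, ∀ h : ℝ, (∀ s ∈ Ico 0 h, ∀ s' ∈ Ico 0 h,
      dist (Ψ s w) (Ψ s' w) ≤ L * (|s - s'| / h)) → ∀ s ∈ Ico 0 h, Ψ s w ∈ Metric.ball z (2 * r) →
      s ≤ S ∧ Metric.infDist w γ ≤ a := by
    intro w h hw s hs hsz
    have h1 : h ≤ S := hz.roof_le hδ hs hw (Metric.ball_subset_ball hrδ hsz)
    have hsS : s ≤ S := hs.2.le.trans h1
    refine ⟨hsS, ?_⟩
    have hs0 : -s ∈ Icc (-(S + 1)) (S + 1) := ⟨by linarith, by linarith [hs.1]⟩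
    have h2 := hC (-s) hs0 (-s) hs0 (Ψ s w) z
    rw [← Ψ.map_add, neg_add_cancel, Ψ.map_zero_apply, sub_self, abs_zero, zero_add] at h2
    refine (Metric.infDist_le_dist_of_mem (mem_image_of_mem _ (show s ∈ Icc 0 S from ⟨hs.1, hsS⟩))).trans (h2.trans ?_)
    rw [ha', mul_comm 2 C, mul_assoc]
    gcongr
    exact (Metric.mem_ball.1 hsz).le
  have hsub : ∀ᵐ p ∂(μ.prod volume).restrict (suspensionSpace φ), p ∈ lapReturn Ψ T φ F n r ∩
      (fun p : X × ℝ => Ψ p.2 (F p.1)) ⁻¹' Metric.ball z r → p ∈ V := by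
    rw [ae_restrict_iff' (measurableSet_suspensionSpace hφ_meas)]
    have h1 : ∀ᵐ u ∂μ, _ := hF.vertical.and
      ((hT.iterate n).quasiMeasurePreserving.ae hF.vertical)
    filter_upwards [Measure.quasiMeasurePreserving_fst.ae h1] with p hp hpY hpA
    obtain ⟨⟨s', hs', hd⟩, hpz⟩ := hpA
    have h2 : Ψ p.2 (F p.1) ∈ Metric.ball z r := hpz
    obtain ⟨h3, h4⟩ := hnear _ _ hp.1 p.2 hpY (Metric.ball_subset_ball (by linarith) h2)
    have h5 : Ψ s' (F (T^[n] p.1)) ∈ Metric.ball z (2 * r) := by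
      rw [Metric.mem_ball] at h2 ⊢
      linarith [dist_triangle (Ψ s' (F (T^[n] p.1))) (Ψ p.2 (F p.1)) z]
    exact ⟨⟨h4, (hnear _ _ hp.2 s' hs' h5).2⟩, ⟨hpY.1, h3⟩, h2⟩
  set R := ENNReal.ofReal r
  have hR0 : R ≠ 0 := by simpa [R] using hr
  have hRtop : R ≠ ⊤ := ENNReal.ofReal_ne_top
  set W := {u | Metric.infDist (F u) γ < 2 * a}
  set m := sectionMeasure Ψ μ F (S + 1) (Metric.ball z (5 * C ^ 2 * r))
  have hW : μ W ≤ m / R := by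
    rw [ENNReal.le_div_iff_mul_le (Or.inl hR0) (Or.inl hRtop), mul_comm]
    exact measure_near_backward_orbit_le hF.lipschitz.continuous hS hC1 hr hr1 hC z
  calc (μ.prod volume).restrict (suspensionSpace φ) (lapReturn Ψ T φ F n r ∩
        (fun p : X × ℝ => Ψ p.2 (F p.1)) ⁻¹' Metric.ball z r)
      ≤ (μ.prod volume) V := (measure_mono_ae hsub).trans (Measure.restrict_le_self _)
    _ = ∫⁻ u, volume (Prod.mk u ⁻¹' V) ∂μ := Measure.prod_apply hVm
    _ ≤ ∫⁻ u, E.indicator (fun _ => ENNReal.ofReal (D₀ * r)) u ∂μ := by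
        refine lintegral_mono fun u => ?_
        by_cases hu : u ∈ E
        · rw [indicator_of_mem hu]
          refine (measure_mono fun s hs => ?_).trans
            (hz.volume_visits_le (S := S) hδ (by linarith) (F u))
          exact hs.2
        · rw [indicator_of_notMem hu]
          have : Prod.mk u ⁻¹' V = ∅ := by
            ext s; simp [hV, hu]
          simp [this]
    _ = ENNReal.ofReal (D₀ * r) * μ E := by rw [lintegral_indicator hEm, setLIntegral_const]
    _ ≤ ENNReal.ofReal (D₀ * r) * ((m / R) ^ 2 + ENNReal.ofReal ((1 + L / a) ^ 2 * |θ n|)) := by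
        gcongr
        refine (measure_near_inter_near_le hT hF.lipschitz hθ γ ha0 hn).trans ?_
        gcongr
        exact le_abs_self _
    -- Powers of `r`: `r * (m / r) ^ 2 = m ^ 2 / r`, and `r * ((1 + L) / r) ^ 2 = (1 + L) ^ 2 / r`.
    _ ≤ ENNReal.ofReal (D₀ * (1 + L) ^ 2) * (m ^ 2 / R + ENNReal.ofReal (|θ n| / r)) := by
        rw [mul_add, mul_add]
        gcongr ?_ + ?_
        · have e : ENNReal.ofReal (D₀ * r) * (m / R) ^ 2 = ENNReal.ofReal D₀ * (m ^ 2 / R) := by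
            rw [ENNReal.ofReal_mul hD₀pos.le, div_eq_mul_inv, div_eq_mul_inv, mul_pow]
            calc _ = ENNReal.ofReal D₀ * (m ^ 2 * R⁻¹) * (R * R⁻¹) := by ring
              _ = _ := by rw [ENNReal.mul_inv_cancel hR0 hRtop, mul_one]
          rw [e]
          gcongr
          have : 1 ≤ (1 + (L : ℝ)) ^ 2 := by nlinarith [L.2]
          nlinarith
        · rw [← ENNReal.ofReal_mul (by positivity), ← ENNReal.ofReal_mul (by positivity)]
          apply ENNReal.ofReal_le_ofReal
          have h1 : 1 + L / (a : ℝ) ≤ (1 + L) / r := by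
            rw [add_div]
            have h2 : r ≤ a := by rw [ha']; nlinarith
            gcongr
            rw [le_div_iff₀ hr]; linarith
          calc D₀ * r * ((1 + L / a) ^ 2 * |θ n|)
              ≤ D₀ * r * (((1 + L) / r) ^ 2 * |θ n|) := by gcongr
            _ = _ := by field_simp

end LapReturn

/-! ### Mass of balls at typical points, and the existence of returns. -/

section LocalMeasure

variable {M : Type*} [MetricSpace M] [CompactSpace M] [MeasurableSpace M] [BorelSpace M]

lemma tsum_mul_inv_pow_ne_top {c q : ℝ≥0∞} (hc : c ≠ ⊤) (hq : 1 < q) :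
    ∑' k : ℕ, c * q⁻¹ ^ k ≠ ⊤ := by
  rw [ENNReal.tsum_mul_left, ENNReal.tsum_geometric]
  refine ENNReal.mul_ne_top hc (ENNReal.inv_ne_top.2 ?_)
  exact (tsub_pos_of_lt (ENNReal.inv_lt_one.2 hq)).ne'

/-- Almost every point has, up to a subexponential factor, no more mass for `ρ` than for `ν` in its
small balls. -/
lemma ae_eventually_measure_ball_le (hM : IsDoublingSpace M) (ν ρ : Measure M) [IsFiniteMeasure ρ]
    (Λ : ℝ) {q : ℝ≥0∞} (hq : 1 < q) (hq' : q ≠ ⊤) :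
    ∀ᵐ x ∂ν, ∀ᶠ k : ℕ in atTop,
      ρ (Metric.ball x (Λ * (1 / 2) ^ k)) ≤ q ^ k * ν (Metric.ball x ((1 / 2) ^ k)) := by
  obtain ⟨A, B, -, hAB⟩ := hM.exists_card_le
  obtain ⟨C, hC⟩ := hM Λ
  have hq0 : q ≠ 0 := (zero_lt_one.trans hq).ne'
  set bad : ℕ → Set M := fun k =>
    {x | q ^ k * ν (Metric.ball x ((1 / 2) ^ k)) < ρ (Metric.ball x (Λ * (1 / 2) ^ k))}
  have hbad : ∀ k, ν (bad k) ≤ (C * ρ univ) * q⁻¹ ^ k := by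
    intro k
    have h := measure_inter_preimage_le (hAB k) hC ν ρ id (bad k) (bad k) (q⁻¹ ^ k) 0
      (fun x hx => ?_)
    · simpa [mul_comm] using h
    · rw [add_zero]
      calc ν (bad k ∩ id ⁻¹' Metric.ball x ((1 / 2) ^ k)) ≤ ν (Metric.ball x ((1 / 2) ^ k)) :=
            measure_mono inter_subset_right
        _ = q⁻¹ ^ k * (q ^ k * ν (Metric.ball x ((1 / 2) ^ k))) := by
            rw [← mul_assoc, ← mul_pow, ENNReal.inv_mul_cancel hq0 hq', one_pow, one_mul]
        _ ≤ _ := by gcongr; exact le_of_lt hx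
  have hsum : ∑' k, ν (bad k) ≠ ⊤ :=
    ne_top_of_le_ne_top (tsum_mul_inv_pow_ne_top
      (ENNReal.mul_ne_top (by simp) (measure_ne_top _ _)) hq) (ENNReal.tsum_le_tsum hbad)
  filter_upwards [ae_eventually_notMem hsum] with x hx
  filter_upwards [hx] with k hk
  exact not_lt.1 hk

/-- The mass of the small balls around almost every point decays at most polynomially. -/
lemma ae_eventually_le_measure_ball (hM : IsDoublingSpace M) (ν : Measure M) :
    ∃ B : ℕ, 0 < B ∧ ∀ᵐ x ∂ν, ∀ᶠ k : ℕ in atTop,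
      (B : ℝ≥0∞)⁻¹ ^ k ≤ ν (Metric.ball x ((1 / 2) ^ k)) := by
  obtain ⟨A, B, hB, hAB⟩ := hM.exists_card_le
  obtain ⟨C, hC⟩ := hM 1
  -- At most `A * B ^ k` balls, each of mass below `(2 * B)⁻¹ ^ k`, leave a summable `A * 2⁻¹ ^ k`.
  refine ⟨2 * B, by positivity, ?_⟩
  have hB0 : (B : ℝ≥0∞) ≠ 0 := by exact_mod_cast hB.ne'
  set bad : ℕ → Set M := fun k =>
    {x | ν (Metric.ball x ((1 / 2) ^ k)) < ((2 * B : ℕ) : ℝ≥0∞)⁻¹ ^ k}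
  have hbad : ∀ k, ν (bad k) ≤ A * (2 : ℝ≥0∞)⁻¹ ^ k := by
    intro k
    have h := measure_inter_preimage_le (hAB k) hC ν 0 id (bad k) (bad k) 0
      (((2 * B : ℕ) : ℝ≥0∞)⁻¹ ^ k) (fun x hx => ?_)
    · rw [preimage_id, inter_self, zero_mul, zero_add] at h
      refine h.trans ?_
      push_cast
      rw [ENNReal.mul_inv (by simp) (by simp), mul_pow, mul_assoc, mul_left_comm ((B : ℝ≥0∞) ^ k),
        ← mul_pow (B : ℝ≥0∞), ENNReal.mul_inv_cancel hB0 (by simp), one_pow, mul_one]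
    · rw [zero_mul, zero_add]
      exact (measure_mono inter_subset_right).trans (le_of_lt hx)
  have hsum : ∑' k, ν (bad k) ≠ ⊤ :=
    ne_top_of_le_ne_top (tsum_mul_inv_pow_ne_top (by simp) (by norm_num))
      (ENNReal.tsum_le_tsum hbad)
  filter_upwards [ae_eventually_notMem hsum] with x hx
  filter_upwards [hx] with k hk
  exact not_lt.1 hk

omit [CompactSpace M] in
/-- Points of an open set which do not come back to it between the times `h / 2` and `t` are rare. -/
lemma measure_no_return_le {Ψ : Flow ℝ M} {ν : Measure M} [IsProbabilityMeasure ν]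
    (hν : ∀ t, MeasurePreserving (Ψ t) ν ν) {U : Set M} (hU : IsOpen U) {h t : ℝ} (hh : 0 < h)
    (ht : 0 < t) :
    ν {x ∈ U | ∀ s ∈ Ioo (h / 2) t, Ψ s x ∉ U} ≤ ENNReal.ofReal (h / t) := by
  set D := {x ∈ U | ∀ s ∈ Ioo (h / 2) t, Ψ s x ∉ U} with hD
  have hDm : MeasurableSet D := by
    have e : D = U \ ⋃ s ∈ Ioo (h / 2) t, Ψ s ⁻¹' U := by
      ext x; simp [hD]
    rw [e]
    exact hU.measurableSet.diff (isOpen_biUnion fun s _ =>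
      hU.preimage (Ψ.continuous_toFun s)).measurableSet
  set n := ⌈t / h⌉₊ with hn
  have hn0 : 0 < n := Nat.ceil_pos.2 (by positivity)
  -- A common point would return to `U` after the time `(j - i) * h`, which is at least `h > h / 2`
  -- and less than `t`.
  have hdisj : ∀ i j : ℕ, i < j → j < n →
      Disjoint (Ψ (i * h) ⁻¹' D) (Ψ (j * h) ⁻¹' D) := by
    intro i j hij hj
    rw [Set.disjoint_left]
    intro x hxi hxj
    have h1 : (1 : ℝ) ≤ j - i := by
      have : (i : ℝ) + 1 ≤ j := by exact_mod_cast hij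
      linarith
    have h2 : (j : ℝ) < t / h := Nat.lt_ceil.1 hj
    rw [lt_div_iff₀ hh] at h2
    have h3 : (0 : ℝ) ≤ i * h := by positivity
    refine hxi.2 ((j - i) * h) ⟨by nlinarith, by nlinarith⟩ ?_
    rw [← Ψ.map_add, ← add_mul, sub_add_cancel]
    exact hxj.1
  have hsum : ∑ i ∈ Finset.range n, ν (Ψ (i * h) ⁻¹' D) ≤ ν univ := by
    refine sum_measure_le_measure_univ (fun i _ => ((hν _).measurable hDm).nullMeasurableSet) ?_
    intro i hi j hj hij
    refine Disjoint.aedisjoint ?_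
    rcases lt_or_gt_of_ne hij with h | h
    · exact hdisj i j h (Finset.mem_range.1 hj)
    · exact (hdisj j i h (Finset.mem_range.1 hi)).symm
  simp only [fun s => (hν s).measure_preimage hDm.nullMeasurableSet, Finset.sum_const,
    Finset.card_range, nsmul_eq_mul, measure_univ] at hsum
  calc ν D = ENNReal.ofReal (h / t) * (ENNReal.ofReal (t / h) * ν D) := by
        rw [← mul_assoc, ← ENNReal.ofReal_mul (by positivity)]
        field_simp
        simp
    _ ≤ ENNReal.ofReal (h / t) * (n * ν D) := by
        gcongr
        rw [← ENNReal.ofReal_natCast]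
        exact ENNReal.ofReal_le_ofReal (Nat.le_ceil _)
    _ ≤ ENNReal.ofReal (h / t) := by
        simpa using mul_le_mul_right hsum (ENNReal.ofReal (h / t))

/-- Almost every regular point comes back to its balls before the time predicted by their mass. -/
lemma ae_eventually_exists_return {Ψ : Flow ℝ M} {ν : Measure M} [IsProbabilityMeasure ν]
    (hM : IsDoublingSpace M) (hν : ∀ t, MeasurePreserving (Ψ t) ν ν) {a q : ℝ} (ha : 0 < a)
    (hq : 1 < q) :
    ∀ᵐ x ∂ν, ∀ᶠ k : ℕ in atTop, ∃ s, a * (1 / 2) ^ k < s ∧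
      s * ν.real (Metric.ball x ((1 / 2) ^ (k + 1))) < q ^ k * (1 / 2) ^ k ∧
      dist (Ψ s x) x < (1 / 2) ^ k := by
  obtain ⟨A, B, -, hAB⟩ := hM.exists_card_le
  obtain ⟨C, hC⟩ := hM 2
  set bad : ℕ → Set M := fun k => {x | ∀ s, a * (1 / 2) ^ k < s →
    s * ν.real (Metric.ball x ((1 / 2) ^ (k + 1))) < q ^ k * (1 / 2) ^ k →
      (1 / 2) ^ k ≤ dist (Ψ s x) x}
  have hq0 : 0 < q := by linarith
  have hbad : ∀ k, ν (bad k) ≤ (ENNReal.ofReal (2 * a) * C) * (ENNReal.ofReal q)⁻¹ ^ k := by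
    intro k
    set r : ℝ := (1 / 2) ^ k with hr
    have hr0 : 0 < r := by positivity
    have hr1 : (1 / 2 : ℝ) ^ (k + 1) = r / 2 := by rw [pow_succ, hr]; ring
    have h := measure_inter_preimage_le (hAB (k + 1)) hC ν ν id (bad k) (bad k)
      (ENNReal.ofReal (2 * a) * (ENNReal.ofReal q)⁻¹ ^ k) 0 (fun x hx => ?_)
    · simpa [mul_comm, mul_left_comm, mul_assoc] using h
    rw [add_zero, hr1]
    set m := ν.real (Metric.ball x (2 * (r / 2)))
    have hm : ν (Metric.ball x (2 * (r / 2))) = ENNReal.ofReal m :=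
      (ofReal_measureReal (measure_ne_top _ _)).symm
    rcases eq_or_lt_of_le (show 0 ≤ m from measureReal_nonneg) with hm0 | hm0
    · rw [hm, ← hm0, ENNReal.ofReal_zero, mul_zero, le_zero_iff]
      refine measure_mono_null inter_subset_right (measure_mono_null
        (Metric.ball_subset_ball (show r / 2 ≤ 2 * (r / 2) by linarith)) ?_)
      rw [hm, ← hm0, ENNReal.ofReal_zero]
    -- With time step `2 * a * r` and this horizon, the factor `r` cancels and the bad part has mass
    -- at most `2 * a * q⁻¹ ^ k * m`, where `m` is the mass of the ball of radius `r`, which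
    -- contains the half-radius balls around its bad points.
    have ht : 0 < q ^ k * r / m := by positivity
    have hsub : bad k ∩ id ⁻¹' Metric.ball x (r / 2) ⊆ {y ∈ Metric.ball x (r / 2) |
        ∀ s ∈ Ioo (2 * a * r / 2) (q ^ k * r / m), Ψ s y ∉ Metric.ball x (r / 2)} := by
      rintro y ⟨hy, hyx⟩
      refine ⟨hyx, fun s hs hsx => ?_⟩
      have hyx' : dist y x < r / 2 := hyx
      have hs0 : 0 < s := lt_trans (by positivity) hs.1
      have h1 : ν.real (Metric.ball y (r / 2)) ≤ m :=
        measureReal_mono (Metric.ball_subset_ball' (by linarith))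
      have h2 := hy s (by linarith [hs.1]) (by
        rw [hr1]
        calc s * ν.real (Metric.ball y (r / 2)) ≤ s * m := by gcongr
          _ < _ := (lt_div_iff₀ hm0).1 hs.2)
      have h3 := dist_triangle_right (Ψ s y) y x
      rw [Metric.mem_ball] at hsx
      linarith
    refine (measure_mono hsub).trans ((measure_no_return_le hν Metric.isOpen_ball
      (show 0 < 2 * a * r by positivity) ht).trans ?_)
    rw [hm, ← ENNReal.ofReal_inv_of_pos hq0, ← ENNReal.ofReal_pow (by positivity),
      ← ENNReal.ofReal_mul (by positivity), ← ENNReal.ofReal_mul (by positivity)]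
    apply ENNReal.ofReal_le_ofReal
    rw [inv_pow]
    field_simp
    rfl
  have hsum : ∑' k, ν (bad k) ≠ ⊤ :=
    ne_top_of_le_ne_top (tsum_mul_inv_pow_ne_top
      (ENNReal.mul_ne_top ENNReal.ofReal_ne_top (by simp)) (by simpa using hq))
      (ENNReal.tsum_le_tsum hbad)
  filter_upwards [ae_eventually_notMem hsum] with x hx
  filter_upwards [hx] with k hk
  simpa [bad] using hk

end LocalMeasure

/-! ### Borel-Cantelli over laps and scales. -/

section Laps

variable {M : Type*} [MetricSpace M] [CompactSpace M] [MeasurableSpace M] [BorelSpace M]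
  {Z : Type*} [MeasurableSpace Z]

lemma eventually_enorm_mul_pow_le_one {θ : ℕ → ℝ}
    (hθ : ∀ k : ℕ, Tendsto (fun n : ℕ => (n : ℝ) ^ k * θ n) atTop (𝓝 0)) (p : ℕ) :
    ∀ᶠ n : ℕ in atTop, ‖θ n‖ₑ * (n : ℝ≥0∞) ^ p ≤ 1 := by
  have h := (hθ p).enorm
  rw [enorm_zero] at h
  filter_upwards [h.eventually_lt_const zero_lt_one] with n hn
  rw [enorm_mul, enorm_pow, Real.enorm_natCast, mul_comm] at hn
  exact hn.le

/-- If the `n`-th lap comes back to the balls of radius `r` with small probability, and if the balls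
centred in `Q` have small mass, then almost no point over `Q` comes back, at the laps between
`2 ^ i` and `2 ^ (i + 1)`, closer than `2 ^ (- q i)`. -/
lemma exists_ae_eventually_notMem_dyadic (hM : IsDoublingSpace M) (κ : Measure Z) (ρ : Measure M)
    [IsFiniteMeasure ρ] (G : Z → M) (V : ℕ → ℕ → Set Z) {θ : ℕ → ℝ}
    (hθ : ∀ k : ℕ, Tendsto (fun n : ℕ => (n : ℝ) ^ k * θ n) atTop (𝓝 0)) {D c : ℝ≥0∞} (hD : D ≠ ⊤)
    (hc : c < 1) (Λ : ℝ) (l : ℕ) (Q : Set M)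
    (hV : ∀ z ∈ Q, ∀ k ≥ l, ∀ n ≥ 1, κ (V n k ∩ G ⁻¹' Metric.ball z ((1 / 2) ^ k)) ≤
      D * (ρ (Metric.ball z (Λ * (1 / 2) ^ k)) ^ 2 * 2 ^ k + ‖θ n‖ₑ * 2 ^ k))
    (hQ : ∀ z ∈ Q, ∀ k ≥ l, ρ (Metric.ball z (Λ * (1 / 2) ^ k)) * 2 ^ k ≤ c ^ k) :
    ∃ q : ℕ, 1 ≤ q ∧ ∀ᵐ p ∂κ, G p ∈ Q →
      ∀ᶠ i : ℕ in atTop, ∀ n ∈ Ico (2 ^ i) (2 ^ (i + 1)), p ∉ V n (q * i) := by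
  obtain ⟨A, B, -, hAB⟩ := hM.exists_card_le
  obtain ⟨C, hC⟩ := hM Λ
  -- At scale `q * i` one lap costs `4⁻¹ ^ i`, so the `2 ^ i` laps of a block cost `2⁻¹ ^ i`.
  obtain ⟨q, hcq, hq1⟩ : ∃ q : ℕ, c ^ q ≤ 4⁻¹ ∧ 1 ≤ q :=
    (((ENNReal.tendsto_pow_atTop_nhds_zero_of_lt_one hc).eventually_le_const
      (show (0 : ℝ≥0∞) < 4⁻¹ by simp)).and (eventually_ge_atTop 1)).exists
  refine ⟨q, hq1, ?_⟩
  -- Since `n ≥ 2 ^ i`, the power `n ^ p` dominates the number of balls, the factor `2 ^ (q * i)`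
  -- and a further `4 ^ i`.
  set p := 4 * (2 * B) ^ q
  have hp : 4 * (2 * B) ^ q ≤ 2 ^ p := Nat.lt_two_pow_self.le
  obtain ⟨N, hN⟩ := eventually_atTop.1 (eventually_enorm_mul_pow_le_one hθ p)
  set bad : ℕ → Set Z := fun i => ⋃ n ∈ Finset.Ico (2 ^ i) (2 ^ (i + 1)), V n (q * i) ∩ G ⁻¹' Q
  set K : ℝ≥0∞ := D * (C * ρ univ) + A * D
  have hK : K ≠ ⊤ := by
    refine ENNReal.add_ne_top.2 ⟨?_, ?_⟩ <;> finiteness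
  have hlap : ∀ i, max N l ≤ i → ∀ n ∈ Finset.Ico (2 ^ i) (2 ^ (i + 1)),
      κ (V n (q * i) ∩ G ⁻¹' Q) ≤ K * 4⁻¹ ^ i := by
    intro i hi n hn
    rw [Finset.mem_Ico] at hn
    have hik : l ≤ q * i := (le_of_max_le_right hi).trans (Nat.le_mul_of_pos_left _ hq1)
    have hn1 : 1 ≤ n := Nat.one_le_two_pow.trans hn.1
    have hnN : N ≤ n := ((le_of_max_le_left hi).trans Nat.lt_two_pow_self.le).trans hn.1
    have hθn : ‖θ n‖ₑ * (2 * B) ^ (q * i) ≤ 4⁻¹ ^ i := by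
      rw [← ENNReal.inv_pow, ENNReal.le_inv_iff_mul_le, mul_assoc]
      refine le_trans ?_ (hN n hnN)
      gcongr
      have h1 : (2 * B) ^ (q * i) * 4 ^ i ≤ n ^ p := by
        calc (2 * B) ^ (q * i) * 4 ^ i = (4 * (2 * B) ^ q) ^ i := by
              rw [mul_pow 4, ← pow_mul, mul_comm]
          _ ≤ (2 ^ p) ^ i := Nat.pow_le_pow_left hp i
          _ = (2 ^ i) ^ p := by rw [← pow_mul, ← pow_mul, mul_comm]
          _ ≤ n ^ p := Nat.pow_le_pow_left hn.1 p
      exact_mod_cast h1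
    have hck : c ^ (q * i) ≤ 4⁻¹ ^ i := by
      rw [pow_mul]; gcongr
    refine (measure_inter_preimage_le (hAB (q * i)) hC κ ρ G (V n (q * i)) Q (D * c ^ (q * i))
      (D * (‖θ n‖ₑ * 2 ^ (q * i))) fun z hz => ?_).trans ?_
    · refine (hV z hz _ hik n hn1).trans ?_
      rw [mul_add, mul_assoc]
      refine add_le_add (mul_le_mul' le_rfl ?_) le_rfl
      rw [sq, mul_right_comm]
      exact mul_le_mul' (hQ z hz _ hik) le_rfl
    · rw [add_mul]
      push_cast
      calc D * c ^ (q * i) * (C * ρ univ) + A * (B : ℝ≥0∞) ^ (q * i) * (D * (‖θ n‖ₑ * 2 ^ (q * i)))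
          = D * (C * ρ univ) * c ^ (q * i) + A * D * (‖θ n‖ₑ * (2 * B) ^ (q * i)) := by
            rw [mul_pow]; ring
        _ ≤ _ := by gcongr
  have hbad : ∀ i, max N l ≤ i → κ (bad i) ≤ K * 2⁻¹ ^ i := by
    intro i hi
    calc κ (bad i) ≤ ∑ n ∈ Finset.Ico (2 ^ i) (2 ^ (i + 1)), κ (V n (q * i) ∩ G ⁻¹' Q) :=
          measure_biUnion_finset_le _ _
      _ ≤ ∑ n ∈ Finset.Ico (2 ^ i) (2 ^ (i + 1)), K * 4⁻¹ ^ i := Finset.sum_le_sum (hlap i hi)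
      _ = K * (2 ^ i * 4⁻¹ ^ i) := by
          rw [Finset.sum_const, Nat.card_Ico, nsmul_eq_mul,
            show 2 ^ (i + 1) - 2 ^ i = 2 ^ i by rw [pow_succ]; omega]
          push_cast
          ring
      _ = K * 2⁻¹ ^ i := by
          rw [← mul_pow, show (4 : ℝ≥0∞) = 2 * 2 by norm_num, ENNReal.mul_inv (by simp) (by simp),
            ← mul_assoc, ENNReal.mul_inv_cancel (by simp) (by simp), one_mul]
  have hsum : ∑' i, κ (bad (i + max N l)) ≠ ⊤ := by
    refine ne_top_of_le_ne_top (tsum_mul_inv_pow_ne_top hK (show (1 : ℝ≥0∞) < 2 by norm_num))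
      (ENNReal.tsum_le_tsum fun i => (hbad _ (Nat.le_add_left _ _)).trans ?_)
    exact mul_le_mul' le_rfl (pow_le_pow_of_le_one zero_le (by simp) (Nat.le_add_right _ _))
  filter_upwards [ae_eventually_notMem hsum] with x hx hxQ
  rw [eventually_atTop] at hx ⊢
  obtain ⟨i₀, hi₀⟩ := hx
  refine ⟨i₀ + max N l, fun i hi n hn hxV => hi₀ (i - max N l) (by omega) ?_⟩
  rw [Nat.sub_add_cancel (by omega)]
  exact mem_iUnion₂.2 ⟨n, Finset.mem_Ico.2 hn, hxV, hxQ⟩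

lemma tsum_ofReal_one_div_sq_ne_top : ∑' n : ℕ, ENNReal.ofReal (1 / (n : ℝ) ^ 2) ≠ ⊤ := by
  have h := Real.summable_one_div_nat_pow.2 (show 1 < 2 by norm_num)
  exact h.tsum_ofReal_ne_top

/-- If the `n`-th lap comes back to the balls of radius `r` with small probability, then almost no
point comes back to its ball of radius `r` at a lap smaller than the one predicted by the mass of
this ball, unless the lap is smaller than a small power of `1 / r`. -/
lemma ae_eventually_notMem_of_lap_mul_le (hM : IsDoublingSpace M) (κ : Measure Z) (ρ : Measure M)
    [IsFiniteMeasure ρ] (G : Z → M) (V : ℕ → ℕ → Set Z) {θ : ℕ → ℝ}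
    (hθ : ∀ k : ℕ, Tendsto (fun n : ℕ => (n : ℝ) ^ k * θ n) atTop (𝓝 0)) {D b : ℝ≥0∞} (hD : D ≠ ⊤)
    (hb : b < 1) (Λ : ℝ) (l : ℕ) (Q : Set M)
    (hV : ∀ z ∈ Q, ∀ k ≥ l, ∀ n ≥ 1, κ (V n k ∩ G ⁻¹' Metric.ball z ((1 / 2) ^ k)) ≤
      D * (ρ (Metric.ball z (Λ * (1 / 2) ^ k)) ^ 2 * 2 ^ k + ‖θ n‖ₑ * 2 ^ k))
    {q : ℕ} (hq : 1 ≤ q) :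
    ∀ᵐ p ∂κ, G p ∈ Q → ∀ᶠ k : ℕ in atTop, ∀ n : ℕ, 2 ^ k ≤ n ^ q →
      n * ρ (Metric.ball (G p) ((Λ + 1) * (1 / 2) ^ k)) * 2 ^ k ≤ b ^ k → p ∉ V n k := by
  obtain ⟨A, B, -, hAB⟩ := hM.exists_card_le
  obtain ⟨C, hC⟩ := hM Λ
  -- From `2 ^ k ≤ n ^ q`, the power `n ^ (q * s)` dominates `(4 * B) ^ k`; the two extra powers of
  -- `n` make the sum over laps converge.
  set s := 4 * B
  have hs : 4 * B ≤ 2 ^ s := Nat.lt_two_pow_self.le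
  obtain ⟨N, hN⟩ := eventually_atTop.1 (eventually_enorm_mul_pow_le_one hθ (q * s + 2))
  set bad : ℕ → Set Z := fun k => {p | G p ∈ Q ∧ ∃ n : ℕ, 2 ^ k ≤ n ^ q ∧
    n * ρ (Metric.ball (G p) ((Λ + 1) * (1 / 2) ^ k)) * 2 ^ k ≤ b ^ k ∧ p ∈ V n k}
  set W := ∑' n : ℕ, ENNReal.ofReal (1 / (n : ℝ) ^ 2)
  have hW : W ≠ ⊤ := tsum_ofReal_one_div_sq_ne_top
  have hn0 : ∀ {k n : ℕ}, 2 ^ k ≤ n ^ q → 1 ≤ n := fun {k n} h => by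
    rcases Nat.eq_zero_or_pos n with rfl | h'
    · rw [zero_pow (by omega)] at h
      exact absurd h (by simp)
    · exact h'
  set e : ℕ → ℝ≥0∞ := fun k => ∑' n : ℕ, {n : ℕ | 2 ^ k ≤ n ^ q}.indicator (fun n => ‖θ n‖ₑ) n
  have he : ∀ k, N ^ q ≤ k → (2 * B : ℝ≥0∞) ^ k * e k ≤ W * 2⁻¹ ^ k := by
    intro k hk
    rw [← ENNReal.tsum_mul_left, ← ENNReal.tsum_mul_right]
    refine ENNReal.tsum_le_tsum fun n => ?_
    by_cases hn : n ∈ {n : ℕ | 2 ^ k ≤ n ^ q}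
    · rw [indicator_of_mem hn]
      have hn' : 2 ^ k ≤ n ^ q := hn
      have hn1 : 1 ≤ n := hn0 hn'
      have hnN : N ≤ n := by
        by_contra! h
        have h1 : n ^ q ≤ N ^ q := Nat.pow_le_pow_left h.le q
        have h2 : k < 2 ^ k := Nat.lt_two_pow_self
        omega
      have hn2 : ENNReal.ofReal (1 / (n : ℝ) ^ 2) = ((n : ℝ≥0∞) ^ 2)⁻¹ := by
        rw [one_div, ENNReal.ofReal_inv_of_pos (by positivity), ENNReal.ofReal_pow (by positivity),
          ENNReal.ofReal_natCast]
      rw [hn2, ← ENNReal.inv_pow, ← ENNReal.mul_inv (by simp) (by simp), ENNReal.le_inv_iff_mul_le]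
      refine le_trans ?_ (hN n hnN)
      rw [mul_comm _ ‖θ n‖ₑ, mul_assoc]
      gcongr
      have h1 : (2 * B) ^ k * (n ^ 2 * 2 ^ k) ≤ n ^ (q * s + 2) := by
        calc (2 * B) ^ k * (n ^ 2 * 2 ^ k) = (4 * B) ^ k * n ^ 2 := by
              rw [show 4 * B = 2 * B * 2 by ring, mul_pow (2 * B)]; ring
          _ ≤ (2 ^ s) ^ k * n ^ 2 := by gcongr
          _ = (2 ^ k) ^ s * n ^ 2 := by rw [← pow_mul, ← pow_mul, mul_comm s k]
          _ ≤ (n ^ q) ^ s * n ^ 2 := by gcongr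
          _ = _ := by rw [← pow_mul, ← pow_add]
      exact_mod_cast h1
    · rw [indicator_of_notMem hn, mul_zero]
      exact zero_le
  have hbad : ∀ k, max (N ^ q) l ≤ k → κ (bad k) ≤
      D * (C * ρ univ) * b⁻¹⁻¹ ^ k + (A * D * W) * 2⁻¹ ^ k := by
    intro k hk
    have h := measure_inter_preimage_le (hAB k) hC κ ρ G (bad k) Q (D * b ^ k)
      (D * (2 ^ k * e k)) fun z hz => ?_
    · rw [inter_eq_left.2 (show bad k ⊆ G ⁻¹' Q from fun p hp => hp.1)] at h
      refine h.trans ?_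
      rw [inv_inv]
      push_cast
      calc D * b ^ k * (C * ρ univ) + A * (B : ℝ≥0∞) ^ k * (D * (2 ^ k * e k))
          = D * (C * ρ univ) * b ^ k + A * D * ((2 * B) ^ k * e k) := by rw [mul_pow]; ring
        _ ≤ D * (C * ρ univ) * b ^ k + A * D * (W * 2⁻¹ ^ k) := by
          exact add_le_add le_rfl (mul_le_mul' le_rfl (he k (le_of_max_le_left hk)))
        _ = _ := by ring
    set m := ρ (Metric.ball z (Λ * (1 / 2) ^ k)) with hm
    set J := {n : ℕ | 2 ^ k ≤ n ^ q ∧ n * m * 2 ^ k ≤ b ^ k}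
    have hsub : bad k ∩ G ⁻¹' Metric.ball z ((1 / 2) ^ k) ⊆
        ⋃ n, {p | n ∈ J ∧ p ∈ V n k ∩ G ⁻¹' Metric.ball z ((1 / 2) ^ k)} := by
      rintro p ⟨⟨-, n, hn, hnm, hpV⟩, hpz⟩
      refine mem_iUnion.2 ⟨n, ⟨hn, le_trans ?_ hnm⟩, hpV, hpz⟩
      gcongr
      refine measure_mono (Metric.ball_subset_ball' ?_)
      have : dist (G p) z < (1 / 2) ^ k := hpz
      rw [dist_comm]
      linarith
    -- The number of admissible laps is at most the largest one, and that one satisfies `n * m * 2 ^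
    -- k ≤ b ^ k`; one factor `m` is left over, to be summed over the cover.
    have hJ : ∑' n : ℕ, J.indicator (fun _ => m ^ 2 * 2 ^ k) n ≤ b ^ k * m := by
      rcases eq_or_ne m 0 with hm0 | hm0
      · simp [hm0]
      · have hfin : J.Finite := by
          have hbm : b ^ k / (m * 2 ^ k) ≠ ⊤ :=
            ENNReal.div_ne_top (ENNReal.pow_ne_top (hb.trans ENNReal.one_lt_top).ne) (by positivity)
          obtain ⟨n₀, hn₀⟩ := ENNReal.exists_nat_gt hbm
          refine (finite_lt_nat n₀).subset fun n hn => ?_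
          have h1 : (n : ℝ≥0∞) ≤ b ^ k / (m * 2 ^ k) := by
            rw [ENNReal.le_div_iff_mul_le (Or.inl (by positivity)) (Or.inl (by finiteness)),
              ← mul_assoc]
            exact hn.2
          exact_mod_cast h1.trans_lt hn₀
        rw [tsum_eq_sum (s := hfin.toFinset) fun n hn => indicator_of_notMem (by simpa using hn) _]
        rcases hfin.toFinset.eq_empty_or_nonempty with he | hne
        · simp [he]
        · set n₁ := hfin.toFinset.max' hne
          have hn₁ : n₁ ∈ J := by simpa using hfin.toFinset.max'_mem hne
          have hcard : hfin.toFinset.card ≤ n₁ := by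
            have : hfin.toFinset ⊆ Finset.Icc 1 n₁ := fun n hn =>
              Finset.mem_Icc.2 ⟨hn0 ((hfin.mem_toFinset.1 hn).1), Finset.le_max' _ _ hn⟩
            simpa using Finset.card_le_card this
          calc ∑ n ∈ hfin.toFinset, J.indicator (fun _ => m ^ 2 * 2 ^ k) n
              ≤ ∑ n ∈ hfin.toFinset, m ^ 2 * 2 ^ k :=
                Finset.sum_le_sum fun n _ => indicator_le_self _ _ _
            _ = hfin.toFinset.card * (m ^ 2 * 2 ^ k) := by rw [Finset.sum_const, nsmul_eq_mul]
            _ ≤ n₁ * (m ^ 2 * 2 ^ k) := by gcongr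
            _ = (n₁ * m * 2 ^ k) * m := by ring
            _ ≤ b ^ k * m := by gcongr; exact hn₁.2
    calc κ (bad k ∩ G ⁻¹' Metric.ball z ((1 / 2) ^ k))
        ≤ ∑' n, κ {p | n ∈ J ∧ p ∈ V n k ∩ G ⁻¹' Metric.ball z ((1 / 2) ^ k)} :=
          (measure_mono hsub).trans (measure_iUnion_le _)
      _ ≤ ∑' n, (D * J.indicator (fun _ => m ^ 2 * 2 ^ k) n +
            D * (2 ^ k * {n : ℕ | 2 ^ k ≤ n ^ q}.indicator (fun n => ‖θ n‖ₑ) n)) := by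
          refine ENNReal.tsum_le_tsum fun n => ?_
          by_cases hn : n ∈ J
          · rw [indicator_of_mem hn, indicator_of_mem (show n ∈ {n : ℕ | 2 ^ k ≤ n ^ q} from hn.1)]
            refine (measure_mono fun p hp => hp.2).trans
              ((hV z hz k (le_of_max_le_right hk) n (hn0 hn.1)).trans_eq ?_)
            ring
          · simp [hn]
      _ ≤ D * b ^ k * m + D * (2 ^ k * e k) := by
          rw [ENNReal.tsum_add, ENNReal.tsum_mul_left, ENNReal.tsum_mul_left,
            ENNReal.tsum_mul_left, mul_assoc]
          gcongr
  have hsum : ∑' k, κ (bad (k + max (N ^ q) l)) ≠ ⊤ := by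
    have h1 := tsum_mul_inv_pow_ne_top (show D * (C * ρ univ) ≠ ⊤ by finiteness)
      (ENNReal.one_lt_inv.2 hb)
    have h2 := tsum_mul_inv_pow_ne_top (show A * D * W ≠ ⊤ by finiteness)
      (show (1 : ℝ≥0∞) < 2 by norm_num)
    refine ne_top_of_le_ne_top (ENNReal.add_ne_top.2 ⟨h1, h2⟩) ?_
    rw [← ENNReal.tsum_add]
    refine ENNReal.tsum_le_tsum fun i => (hbad _ (Nat.le_add_left _ _)).trans ?_
    refine add_le_add (mul_le_mul' le_rfl ?_) (mul_le_mul' le_rfl ?_)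
    · exact pow_le_pow_of_le_one zero_le (by rw [inv_inv]; exact hb.le) (Nat.le_add_right _ _)
    · exact pow_le_pow_of_le_one zero_le (by simp) (Nat.le_add_right _ _)
  filter_upwards [ae_eventually_notMem hsum] with x hx hxQ
  rw [eventually_atTop] at hx ⊢
  obtain ⟨i₀, hi₀⟩ := hx
  refine ⟨i₀ + max (N ^ q) l, fun k hk n hn hnm hxV => hi₀ (k - max (N ^ q) l) (by omega) ?_⟩
  rw [Nat.sub_add_cancel (by omega)]
  exact ⟨hxQ, n, hn, hnm, hxV⟩

/-- Large laps come back close to the starting point only when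
the mass of the balls allows it. -/
lemma ae_eventually_notMem_of_large_lap (hM : IsDoublingSpace M) (κ : Measure Z) (ρ : Measure M)
    [IsFiniteMeasure ρ] (G : Z → M) (V : ℕ → ℕ → Set Z) (hVanti : ∀ n, Antitone (V n)) {θ : ℕ → ℝ}
    (hθ : ∀ k : ℕ, Tendsto (fun n : ℕ => (n : ℝ) ^ k * θ n) atTop (𝓝 0)) {D b c : ℝ≥0∞}
    (hD : D ≠ ⊤) (hb : b < 1) (hc : c < 1) (Λ : ℝ) (l : ℕ) (Q : Set M)
    (hV : ∀ z ∈ Q, ∀ k ≥ l, ∀ n ≥ 1, κ (V n k ∩ G ⁻¹' Metric.ball z ((1 / 2) ^ k)) ≤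
      D * (ρ (Metric.ball z (Λ * (1 / 2) ^ k)) ^ 2 * 2 ^ k + ‖θ n‖ₑ * 2 ^ k))
    (hQ : ∀ z ∈ Q, ∀ k ≥ l, ρ (Metric.ball z (Λ * (1 / 2) ^ k)) * 2 ^ k ≤ c ^ k) :
    ∀ᵐ p ∂κ, G p ∈ Q → ∃ N : ℕ, ∀ k ≥ N, ∀ n ≥ N,
      n * ρ (Metric.ball (G p) ((Λ + 1) * (1 / 2) ^ k)) * 2 ^ k ≤ b ^ k → p ∉ V n k := by
  obtain ⟨q, hq, h1⟩ := exists_ae_eventually_notMem_dyadic hM κ ρ G V hθ hD hc Λ l Q hV hQ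
  filter_upwards [h1, ae_eventually_notMem_of_lap_mul_le hM κ ρ G V hθ hD hb Λ l Q hV hq]
    with p hp1 hp2 hpQ
  obtain ⟨i₀, hi₀⟩ := eventually_atTop.1 (hp1 hpQ)
  obtain ⟨k₀, hk₀⟩ := eventually_atTop.1 (hp2 hpQ)
  refine ⟨max (2 ^ i₀) k₀, fun k hk n hn hnm hpV => ?_⟩
  have hn0 : n ≠ 0 := by
    have := (Nat.one_le_two_pow.trans (le_max_left _ _)).trans hn
    omega
  have hi : i₀ ≤ Nat.log 2 n := Nat.le_log_of_pow_le (by norm_num) (le_of_max_le_left hn)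
  -- A small lap at scale `k` is also a return at the coarser scale `q * Nat.log 2 n`, excluded by
  -- the dyadic estimate; otherwise `2 ^ k ≤ n ^ q`, as the other estimate requires.
  rcases le_or_gt (q * Nat.log 2 n) k with h | h
  · exact hi₀ _ hi n ⟨Nat.pow_log_le_self 2 hn0, Nat.lt_pow_succ_log_self (by norm_num) n⟩
      (hVanti n h hpV)
  · refine hk₀ k (le_of_max_le_right hk) n ?_ hnm hpV
    calc 2 ^ k ≤ 2 ^ (q * Nat.log 2 n) := Nat.pow_le_pow_right (by norm_num) h.le
      _ = (2 ^ Nat.log 2 n) ^ q := by rw [← pow_mul, mul_comm]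
      _ ≤ n ^ q := Nat.pow_le_pow_left (Nat.pow_log_le_self 2 hn0) q

end Laps

/-! ### From laps to times. -/

section EarlyReturns

variable {M : Type*} [MetricSpace M] [CompactSpace M] [MeasurableSpace M] [BorelSpace M]
  {X : Type*} [MetricSpace X] [MeasurableSpace X] [BorelSpace X]

omit [CompactSpace M] [BorelSpace M] [BorelSpace X] in
lemma IsFlowSection.ae_flow_birkhoffSum {Ψ : Flow ℝ M} {ν : Measure M} {T : X → X} {φ : X → ℝ}
    {μ : Measure X} {F : X → M} {L : ℝ≥0} (hF : IsFlowSection Ψ ν T φ μ F L)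
    (hT : MeasurePreserving T μ μ) :
    ∀ᵐ u ∂μ, ∀ n, Ψ (birkhoffSum T φ n u) (F u) = F (T^[n] u) := by
  have h : ∀ᵐ u ∂μ, ∀ n : ℕ, Ψ (φ (T^[n] u)) (F (T^[n] u)) = F (T (T^[n] u)) :=
    ae_all_iff.2 fun n => (hT.iterate n).quasiMeasurePreserving.ae hF.roof
  filter_upwards [h] with u hu n
  induction n with
  | zero => simp [Ψ.map_zero_apply]
  | succ n ih =>
    rw [birkhoffSum_succ, add_comm, Ψ.map_add, ih, hu n, Function.iterate_succ_apply']

omit [CompactSpace M] [MeasurableSpace M] [BorelSpace M] in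
lemma exists_pos_le_dist_of_forall_ne {Ψ : Flow ℝ M} {x : M} (hx : ∀ t : ℝ, 0 < t → Ψ t x ≠ x)
    {a : ℝ} (ha : 0 < a) (b : ℝ) : ∃ e > 0, ∀ t ∈ Icc a b, e ≤ dist (Ψ t x) x := by
  rcases (Icc a b).eq_empty_or_nonempty with h | h
  · exact ⟨1, one_pos, by simp [h]⟩
  have hc : Continuous fun t => dist (Ψ t x) x := by
    have : Continuous fun t => Ψ t x := Ψ.continuous continuous_id continuous_const
    fun_prop
  obtain ⟨t, ht, hmin⟩ := isCompact_Icc.exists_isMinOn h hc.continuousOn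
  exact ⟨dist (Ψ t x) x, dist_pos.2 (hx t (ha.trans_le ht.1)), fun s hs => hmin hs⟩

/-- Control of the early returns, for almost every point of the suspension space. -/
lemma exists_ae_suspension_no_early_return {Ψ : Flow ℝ M} {ν : Measure M} {T : X → X} {φ : X → ℝ}
    {μ : Measure X} [IsProbabilityMeasure μ] {F : X → M} {L : ℝ≥0} (hM : IsDoublingSpace M)
    (hT : MeasurePreserving T μ μ) (hφ_pos : ∀ u, 0 < φ u) (hφ_meas : Measurable φ)
    (hφ_int : Integrable φ μ) (hdecay : SuperPolynomialDecay T μ) (hF : IsFlowSection Ψ ν T φ μ F L)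
    (hΨ : ∀ S : ℝ, ∃ C ≥ 1, ∀ s ∈ Icc (-S) S, ∀ t ∈ Icc (-S) S, ∀ x y,
      dist (Ψ s x) (Ψ t y) ≤ C * (|s - t| + dist x y)) {δ : ℝ} (hδ : 0 < δ) :
    ∃ ρ : Measure M, IsFiniteMeasure ρ ∧ ∃ Λ : ℝ, ∀ (b c : ℝ≥0∞) (β : ℝ) (l : ℕ), b < 1 → c < 1 →
      1 ≤ β → β < 2 →
      ∀ᵐ p ∂(μ.prod volume).restrict (suspensionSpace φ), ∀ x, x = Ψ p.2 (F p.1) →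
        IsRegularAt Ψ δ x → (∀ t : ℝ, 0 < t → Ψ t x ≠ x) →
        (∀ k ≥ l, ρ (Metric.ball x (Λ * (1 / 2) ^ k)) * 2 ^ k ≤ c ^ k) →
        ∀ᶠ k : ℕ in atTop, ∀ i : ℕ,
          2 ^ i * ρ (Metric.ball x ((Λ + 1) * (1 / 2) ^ k)) * 2 ^ k ≤ b ^ k →
          ∀ t ∈ Ioo δ (β ^ i), (1 / 2) ^ k ≤ dist (Ψ t x) x := by
  obtain ⟨θ, hθ0, hθ⟩ := hdecay
  obtain ⟨S, D, Λ, hD, -, hlap⟩ := measure_lapReturn_inter_ball_le hT hφ_meas hF hθ hΨ hδ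
  set ρ := sectionMeasure Ψ μ F S
  have hρ : IsFiniteMeasure ρ := ⟨by
    rw [sectionMeasure_univ Ψ μ hF.lipschitz.continuous]; exact ENNReal.ofReal_lt_top⟩
  refine ⟨ρ, hρ, Λ, fun b c β l hb hc hβ1 hβ2 => ?_⟩
  -- The margin between `β` and `β'` absorbs the initial height `p.2`.
  obtain ⟨β', hβ', hβ'2⟩ := exists_between hβ2
  obtain ⟨l₀, hl₀⟩ := exists_pow_lt_of_lt_one (half_pos hδ) (show (1 / 2 : ℝ) < 1 by norm_num)
  set Q : Set M := {x | IsRegularAt Ψ δ x ∧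
    ∀ k ≥ l, ρ (Metric.ball x (Λ * (1 / 2) ^ k)) * 2 ^ k ≤ c ^ k} with hQ
  set V : ℕ → ℕ → Set (X × ℝ) := fun n k => lapReturn Ψ T φ F n ((1 / 2) ^ k)
  have hVanti : ∀ n, Antitone (V n) := by
    rintro n k k' hk p ⟨s', hs', hd⟩
    exact ⟨s', hs', hd.trans_le (pow_le_pow_of_le_one (by norm_num) (by norm_num) hk)⟩
  have hV : ∀ z ∈ Q, ∀ k ≥ max l l₀, ∀ n ≥ 1, (μ.prod volume).restrict (suspensionSpace φ)
      (V n k ∩ (fun p : X × ℝ => Ψ p.2 (F p.1)) ⁻¹' Metric.ball z ((1 / 2) ^ k)) ≤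
      ENNReal.ofReal D * (ρ (Metric.ball z (Λ * (1 / 2) ^ k)) ^ 2 * 2 ^ k + ‖θ n‖ₑ * 2 ^ k) := by
    intro z hz k hk n hn
    have hk0 : (1 / 2 : ℝ) ^ k ≤ (1 / 2) ^ l₀ :=
      pow_le_pow_of_le_one (by norm_num) (by norm_num) (le_of_max_le_right hk)
    refine (hlap z ((1 / 2) ^ k) n hz.1 (by positivity) (pow_le_one₀ (by norm_num) (by norm_num))
      (by linarith) hn).trans_eq ?_
    have e1 : ENNReal.ofReal ((1 / 2) ^ k) = ((2 : ℝ≥0∞) ^ k)⁻¹ := by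
      rw [one_div, ENNReal.ofReal_pow (by norm_num), ENNReal.ofReal_inv_of_pos (by norm_num),
        ENNReal.ofReal_ofNat, ENNReal.inv_pow]
    rw [ENNReal.ofReal_div_of_pos (by positivity), e1,
      div_eq_mul_inv _ ((2 : ℝ≥0∞) ^ k)⁻¹, div_eq_mul_inv _ ((2 : ℝ≥0∞) ^ k)⁻¹, inv_inv,
      ← Real.enorm_eq_ofReal_abs]
  have hmain := ae_eventually_notMem_of_large_lap hM _ ρ (fun p : X × ℝ => Ψ p.2 (F p.1)) V hVanti
    hθ0 ENNReal.ofReal_ne_top hb hc Λ (max l l₀) Q hV fun z hz k hk => hz.2 k (le_of_max_le_left hk)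
  have hbase : ∀ᵐ u ∂μ, (∀ n, Ψ (birkhoffSum T φ n u) (F u) = F (T^[n] u)) ∧
      ∀ᶠ i : ℕ in atTop, β' ^ i < birkhoffSum T φ (2 ^ i) u :=
    (hF.ae_flow_birkhoffSum hT).and
      (ae_eventually_lt_birkhoffSum hT hφ_pos hφ_meas hφ_int (by linarith) hβ'2)
  filter_upwards [hmain, ae_restrict_of_ae (Measure.quasiMeasurePreserving_fst.ae hbase),
    ae_restrict_mem (measurableSet_suspensionSpace hφ_meas)] with p hp hpb hpY x hpx hxreg hper hxQ
  obtain ⟨N, hN⟩ := hp (show Ψ p.2 (F p.1) ∈ Q by rw [← hpx]; exact ⟨hxreg, hxQ⟩)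
  obtain ⟨hflow, hgrow⟩ := hpb
  have hs0 : 0 ≤ p.2 := hpY.1
  have hratio : ∀ᶠ i : ℕ in atTop, 1 + p.2 ≤ (β' / β) ^ i :=
    (tendsto_pow_atTop_atTop_of_one_lt ((one_lt_div (by linarith)).2 hβ')).eventually_ge_atTop _
  obtain ⟨i₀, hi₀⟩ := eventually_atTop.1 (hgrow.and hratio)
  -- Times in `[δ, τ]` form a compact set, on which nonperiodicity keeps the orbit away from `x`;
  -- later times belong to laps from `N` on.
  set τ := birkhoffSum T φ N p.1 + β ^ i₀
  obtain ⟨e, he, hedist⟩ := exists_pos_le_dist_of_forall_ne hper hδ τ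
  obtain ⟨k₀, hk₀⟩ := exists_pow_lt_of_lt_one he (show (1 / 2 : ℝ) < 1 by norm_num)
  filter_upwards [eventually_ge_atTop k₀, eventually_ge_atTop N] with k hk hkN i hi t ht
  rcases le_or_gt t τ with htτ | htτ
  · exact ((pow_le_pow_of_le_one (by norm_num) (by norm_num) hk).trans hk₀.le).trans
      (hedist t ⟨ht.1.le, htτ⟩)
  have hSN : 0 ≤ birkhoffSum T φ N p.1 := Finset.sum_nonneg fun j _ => (hφ_pos _).le
  have hi₀i : i₀ ≤ i := by
    by_contra! h
    have : β ^ i ≤ β ^ i₀ := pow_le_pow_right₀ hβ1 h.le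
    linarith [ht.2]
  have hβpow : 1 ≤ β ^ i := one_le_pow₀ hβ1
  have hi2 : t + p.2 < birkhoffSum T φ (2 ^ i) p.1 := by
    obtain ⟨h1, h2⟩ := hi₀ i hi₀i
    rw [div_pow, le_div_iff₀ (by positivity)] at h2
    nlinarith [ht.2]
  have hex : ∃ n, t + p.2 < birkhoffSum T φ n p.1 := ⟨2 ^ i, hi2⟩
  have hmono := (strictMono_birkhoffSum (T := T) hφ_pos p.1).monotone
  have hNlt : N < Nat.find hex := by
    by_contra! h
    have h1 := Nat.find_spec hex
    have h2 := hmono h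
    have : 0 < β ^ i₀ := by positivity
    linarith
  -- `n` is the lap in progress at time `t`; it is at most `2 ^ i`, so the mass condition for `2 ^
  -- i` passes to `n`.
  obtain ⟨n, hn⟩ : ∃ n, Nat.find hex = n + 1 := ⟨Nat.find hex - 1, by omega⟩
  have hn1 : birkhoffSum T φ n p.1 ≤ t + p.2 := not_lt.1 (Nat.find_min hex (by omega))
  have hn2 : t + p.2 < birkhoffSum T φ n p.1 + φ (T^[n] p.1) := by
    rw [← birkhoffSum_succ, ← hn]; exact Nat.find_spec hex
  have hn3 : n ≤ 2 ^ i := by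
    have := Nat.find_min' hex hi2
    omega
  have hnot := hN k hkN n (by omega) (le_trans (by
    rw [← hpx]
    gcongr
    exact_mod_cast hn3) hi)
  by_contra! hlt
  refine hnot ⟨t + p.2 - birkhoffSum T φ n p.1, ⟨by linarith, by linarith⟩, ?_⟩
  rw [← hflow n, ← Ψ.map_add, sub_add_cancel, Ψ.map_add, ← hpx]
  exact hlt

end EarlyReturns

/-! ### Transfer from the suspension space to `M`. -/

section Transfer

variable {M : Type*} [MetricSpace M]

/-- `IsFlowSection.null` transfers null sets only when they are measurable, so every condition
entering the exceptional set must be. -/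
lemma isClosed_isRegularAt (Ψ : Flow ℝ M) (δ : ℝ) : IsClosed {x | IsRegularAt Ψ δ x} := by
  have h1 : IsClosed {x | ∀ y ∈ Metric.ball x δ, ∀ s, |s| ≤ δ → δ * |s| ≤ dist (Ψ s y) y} := by
    rw [← isOpen_compl_iff]
    have e : {x | ∀ y ∈ Metric.ball x δ, ∀ s, |s| ≤ δ → δ * |s| ≤ dist (Ψ s y) y}ᶜ =
        ⋃ y ∈ {y | ¬ ∀ s, |s| ≤ δ → δ * |s| ≤ dist (Ψ s y) y}, Metric.ball y δ := by
      ext x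
      simp only [mem_compl_iff, mem_ofPred_eq, not_forall, mem_iUnion, Metric.mem_ball,
        dist_comm x, exists_prop]
      exact exists_congr fun y => and_comm
    rw [e]
    exact isOpen_biUnion fun y _ => Metric.isOpen_ball
  have h2 : IsClosed {x | MonotoneOn (fun s => dist x (Ψ s x)) (Icc 0 δ)} := by
    simp only [MonotoneOn, ofPred_forall]
    refine isClosed_iInter fun s => isClosed_iInter fun _ => isClosed_iInter fun t =>
      isClosed_iInter fun _ => isClosed_iInter fun _ => isClosed_le ?_ ?_
    · exact continuous_id.dist (Ψ.continuous_toFun s)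
    · exact continuous_id.dist (Ψ.continuous_toFun t)
  exact h1.inter h2

variable [CompactSpace M] [MeasurableSpace M] [BorelSpace M]

/-- The points with a period in `[1 / (n + 1), n]` form a closed set, as the projection of a compact
set; the nonperiodic points avoid all of these. -/
lemma measurableSet_nonperiodic (Ψ : Flow ℝ M) :
    MeasurableSet {x | ∀ t : ℝ, 0 < t → Ψ t x ≠ x} := by
  have hK : ∀ n : ℕ, IsClosed {x | ∃ t ∈ Icc (1 / ((n : ℝ) + 1)) n, Ψ t x = x} := by
    intro n
    have hc : IsCompact ((Icc (1 / ((n : ℝ) + 1)) n ×ˢ (univ : Set M)) ∩ {p | Ψ p.1 p.2 = p.2}) :=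
      (isCompact_Icc.prod isCompact_univ).inter_right
        (isClosed_eq Ψ.cont' continuous_snd)
    convert (hc.image continuous_snd).isClosed using 1
    ext x
    constructor
    · rintro ⟨t, ht, htx⟩
      exact ⟨(t, x), ⟨⟨ht, mem_univ _⟩, htx⟩, rfl⟩
    · rintro ⟨⟨t, y⟩, ⟨⟨ht, -⟩, hty⟩, rfl⟩
      exact ⟨t, ht, hty⟩
  have e : {x | ∀ t : ℝ, 0 < t → Ψ t x ≠ x} =
      ⋂ n : ℕ, {x | ∃ t ∈ Icc (1 / ((n : ℝ) + 1)) n, Ψ t x = x}ᶜ := by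
    ext x
    simp only [mem_iInter, mem_compl_iff, mem_ofPred_eq, not_exists, not_and]
    refine ⟨fun h n t ht => h t (lt_of_lt_of_le (by positivity) ht.1), fun h t ht => ?_⟩
    obtain ⟨n₁, hn₁⟩ := exists_nat_one_div_lt ht
    obtain ⟨n₂, hn₂⟩ := exists_nat_ge t
    refine h (max n₁ n₂) t ⟨le_trans ?_ hn₁.le, hn₂.trans ?_⟩
    · apply one_div_le_one_div_of_le (by positivity)
      have : (n₁ : ℝ) ≤ (max n₁ n₂ : ℕ) := by exact_mod_cast le_max_left _ _
      linarith
    · exact_mod_cast le_max_right _ _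
  rw [e]
  exact MeasurableSet.iInter fun n => (hK n).measurableSet.compl

lemma measurable_measure_ball (ρ : Measure M) [SFinite ρ] (R : ℝ) :
    Measurable fun x => ρ (Metric.ball x R) := by
  have h : MeasurableSet {p : M × M | dist p.2 p.1 < R} :=
    (isOpen_lt (continuous_snd.dist continuous_fst) continuous_const).measurableSet
  exact measurable_measure_prodMk_left h

variable {X : Type*} [MetricSpace X] [MeasurableSpace X] [BorelSpace X]

/-- Almost every nonperiodic regular point whose balls have small mass does not come back to its
small balls before the time predicted by their mass. -/
lemma exists_ae_no_early_return {Ψ : Flow ℝ M} {ν : Measure M} {T : X → X} {φ : X → ℝ}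
    {μ : Measure X} [IsProbabilityMeasure μ] {F : X → M} {L : ℝ≥0} (hM : IsDoublingSpace M)
    (hT : MeasurePreserving T μ μ) (hφ_pos : ∀ u, 0 < φ u) (hφ_meas : Measurable φ)
    (hφ_int : Integrable φ μ) (hdecay : SuperPolynomialDecay T μ) (hF : IsFlowSection Ψ ν T φ μ F L)
    (hΨ : ∀ S : ℝ, ∃ C ≥ 1, ∀ s ∈ Icc (-S) S, ∀ t ∈ Icc (-S) S, ∀ x y,
      dist (Ψ s x) (Ψ t y) ≤ C * (|s - t| + dist x y)) {δ : ℝ} (hδ : 0 < δ) :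
    ∃ ρ : Measure M, IsFiniteMeasure ρ ∧ ∃ Λ : ℝ, ∀ (b c : ℝ≥0∞) (β : ℝ) (l : ℕ), b < 1 → c < 1 →
      1 ≤ β → β < 2 →
      ∀ᵐ x ∂ν, IsRegularAt Ψ δ x → (∀ t : ℝ, 0 < t → Ψ t x ≠ x) →
        (∀ k ≥ l, ρ (Metric.ball x (Λ * (1 / 2) ^ k)) * 2 ^ k ≤ c ^ k) →
        ∀ᶠ k : ℕ in atTop, ∀ i : ℕ,
          2 ^ i * ρ (Metric.ball x ((Λ + 1) * (1 / 2) ^ k)) * 2 ^ k ≤ b ^ k →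
          ∀ t ∈ Ioo δ (β ^ i), (1 / 2) ^ k ≤ dist (Ψ t x) x := by
  obtain ⟨ρ, hρ, Λ, h⟩ := exists_ae_suspension_no_early_return hM hT hφ_pos hφ_meas hφ_int hdecay
    hF hΨ hδ
  refine ⟨ρ, hρ, Λ, fun b c β l hb hc hβ1 hβ2 => ?_⟩
  set P : Set M := {x | ∀ᶠ k : ℕ in atTop, ∀ i : ℕ,
          2 ^ i * ρ (Metric.ball x ((Λ + 1) * (1 / 2) ^ k)) * 2 ^ k ≤ b ^ k →
          ∀ t ∈ Ioo δ (β ^ i), (1 / 2) ^ k ≤ dist (Ψ t x) x} with hP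
  set Q : Set M := {x | ∀ k ≥ l, ρ (Metric.ball x (Λ * (1 / 2) ^ k)) * 2 ^ k ≤ c ^ k} with hQ
  have hPm : MeasurableSet P := by
    have e : P = ⋃ N : ℕ, ⋂ k ∈ {k : ℕ | N ≤ k}, ⋂ i : ℕ,
        ({x | 2 ^ i * ρ (Metric.ball x ((Λ + 1) * (1 / 2) ^ k)) * 2 ^ k ≤ b ^ k}ᶜ ∪
          ⋂ t ∈ Ioo δ (β ^ i), {x | (1 / 2) ^ k ≤ dist (Ψ t x) x}) := by
      ext x
      simp only [hP, eventually_atTop, mem_ofPred_eq, mem_iUnion, mem_iInter, mem_union,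
        mem_compl_iff, imp_iff_not_or]
    rw [e]
    refine MeasurableSet.iUnion fun N => MeasurableSet.biInter (to_countable _) fun k _ =>
      MeasurableSet.iInter fun i => MeasurableSet.union (MeasurableSet.compl ?_) ?_
    · exact measurableSet_le (((measurable_measure_ball ρ _).const_mul _).mul_const _)
        measurable_const
    · exact (isClosed_biInter fun t _ =>
        isClosed_le continuous_const ((Ψ.continuous_toFun t).dist continuous_id)).measurableSet
  have hQm : MeasurableSet Q := by
    have e : Q = ⋂ k ∈ {k : ℕ | l ≤ k}, {x | ρ (Metric.ball x (Λ * (1 / 2) ^ k)) * 2 ^ k ≤ c ^ k} := by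
      ext x; simp [hQ]
    rw [e]
    exact MeasurableSet.biInter (to_countable _) fun k _ =>
      measurableSet_le ((measurable_measure_ball ρ _).mul_const _) measurable_const
  have hnull := hF.null
    (({x | IsRegularAt Ψ δ x} ∩ {x | ∀ t : ℝ, 0 < t → Ψ t x ≠ x} ∩ Q) \ P)
    ((((isClosed_isRegularAt Ψ δ).measurableSet.inter (measurableSet_nonperiodic Ψ)).inter hQm).diff
      hPm) (by
      refine measure_mono_null ?_ (h b c β l hb hc hβ1 hβ2)
      rintro p ⟨⟨⟨h1, h2⟩, h3⟩, h4⟩ hcon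
      exact h4 (hcon _ rfl h1 h2 h3))
  filter_upwards [compl_mem_ae_iff.2 hnull] with x hx h1 h2 h3
  by_contra h4
  exact hx ⟨⟨⟨h1, h2⟩, h3⟩, h4⟩

end Transfer

/-! ### Bounds on the return time of a regular point. -/

section ReturnTime

variable {M : Type*} [MetricSpace M] {Ψ : Flow ℝ M} {x : M} {δ r : ℝ}

lemma IsRegularAt.escapeTime_le (hx : IsRegularAt Ψ δ x) (hδ : 0 < δ) (hr : 0 < r)
    (hrδ : r ≤ δ ^ 2) : escapeTime Ψ r x ≤ ENNReal.ofReal (r / δ) := by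
  have h0 : 0 < r / δ := by positivity
  have h1 := hx.1 x (Metric.mem_ball_self hδ) (r / δ) (by
    rw [abs_of_pos h0, div_le_iff₀ hδ, ← sq]; exact hrδ)
  rw [abs_of_pos h0, mul_div_cancel₀ _ hδ.ne'] at h1
  exact iInf_le_of_le (r / δ) (iInf₂_le h0 (by rw [Metric.mem_ball, not_lt]; exact h1))

lemma returnTime_le {s : ℝ} (hs : escapeTime Ψ r x < ENNReal.ofReal s)
    (hsx : dist (Ψ s x) x < r) : returnTime Ψ r x ≤ ENNReal.ofReal s :=
  iInf_le_of_le s (iInf₂_le hs hsx)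

/-- Up to time `δ` the distance to `x` is monotone, so an orbit which has escaped cannot be back
before `δ`; only the times after `δ` have to be excluded. -/
lemma IsRegularAt.le_returnTime (hx : IsRegularAt Ψ δ x) {T : ℝ}
    (hT : ∀ t ∈ Ioo δ T, r ≤ dist (Ψ t x) x) : ENNReal.ofReal T ≤ returnTime Ψ r x := by
  refine le_iInf fun t => le_iInf₂ fun ht htx => ENNReal.ofReal_le_ofReal ?_
  by_contra! htT
  rw [Metric.mem_ball] at htx
  rcases lt_or_ge δ t with h | h
  · exact absurd (hT t ⟨h, htT⟩) (not_le.2 htx)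
  · simp only [escapeTime, iInf_lt_iff] at ht
    obtain ⟨t', ht'0, ht'x, ht't⟩ := ht
    have ht't' : t' < t := (ENNReal.ofReal_lt_ofReal_iff_of_nonneg ht'0.le).1 ht't
    have hmono := hx.2 ⟨ht'0.le, ht't'.le.trans h⟩ ⟨ht'0.le.trans ht't'.le, h⟩ ht't'.le
    rw [Metric.mem_ball, not_lt] at ht'x
    rw [dist_comm] at ht'x htx
    exact absurd (ht'x.trans hmono) (not_le.2 htx)

lemma eventually_exists_dyadic (K : ℕ) :
    ∀ᶠ r : ℝ in 𝓝[>] 0, ∃ k ≥ K, (1 / 2 : ℝ) ^ (k + 1) < r ∧ r ≤ (1 / 2) ^ k := by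
  have h : ∀ᶠ r : ℝ in 𝓝[>] 0, r ∈ Ioo (0 : ℝ) ((1 / 2) ^ K) := Ioo_mem_nhdsGT (by positivity)
  filter_upwards [h] with r hr
  obtain ⟨k, hk1, hk2⟩ := exists_nat_pow_near_of_lt_one hr.1
    (hr.2.le.trans (pow_le_one₀ (by norm_num) (by norm_num))) (show (0 : ℝ) < 1 / 2 by norm_num)
    (by norm_num)
  refine ⟨k, ?_, hk1, hk2⟩
  by_contra! hkK
  have : (1 / 2 : ℝ) ^ K ≤ (1 / 2) ^ (k + 1) :=
    pow_le_pow_of_le_one (by norm_num) (by norm_num) hkK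
  linarith [hr.2]

lemma exists_one_lt_log_le {e : ℝ} (he : 0 < e) : ∃ q : ℝ, 1 < q ∧ Real.log q ≤ e :=
  ⟨Real.exp e, by simpa using he, by simp⟩

lemma nat_mul_log_two_le_neg_log {k : ℕ} (hr0 : 0 < r) (hr : r ≤ (1 / 2) ^ k) :
    k * Real.log 2 ≤ -Real.log r := by
  have h := Real.log_le_log hr0 hr
  rw [Real.log_pow, one_div, Real.log_inv] at h
  linarith

/-- Returns before the time predicted by the mass give an upper bound of the return time. -/
lemma IsRegularAt.eventually_log_returnTime_le (hx : IsRegularAt Ψ δ x) (hδ : 0 < δ) {m : ℝ → ℝ}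
    (hm : Monotone m) (hm0 : ∀ r > 0, 0 < m r)
    (hdouble : ∀ q > 1, ∀ᶠ k : ℕ in atTop, m (4 * (1 / 2) ^ k) ≤ q ^ k * m ((1 / 2) ^ k))
    (hret : ∀ q > 1, ∀ᶠ k : ℕ in atTop, ∃ s, 2 / δ * (1 / 2) ^ k < s ∧
      s * m ((1 / 2) ^ (k + 1)) < q ^ k * (1 / 2) ^ k ∧ dist (Ψ s x) x < (1 / 2) ^ k)
    {η : ℝ} (hη : 0 < η) :
    ∀ᶠ r in 𝓝[>] 0, ∃ s, 0 < s ∧ returnTime Ψ r x ≤ ENNReal.ofReal s ∧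
      Real.log s ≤ Real.log r - Real.log (m r) + η * (-Real.log r) := by
  have hlog2 : 0 < Real.log 2 := Real.log_pos (by norm_num)
  -- The factors `q` accumulate to `q ^ (2 * k + 3)`, and `2 * k + 3 ≤ 5 * k`.
  obtain ⟨q, hq1, hq⟩ := exists_one_lt_log_le (show 0 < η * Real.log 2 / 5 by positivity)
  obtain ⟨K₁, hK₁⟩ := eventually_atTop.1 (hdouble q hq1)
  obtain ⟨K₂, hK₂⟩ := eventually_atTop.1 (hret q hq1)
  have hsmall : ∀ᶠ r : ℝ in 𝓝[>] 0, r ∈ Ioo (0 : ℝ) (δ ^ 2) := Ioo_mem_nhdsGT (by positivity)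
  filter_upwards [eventually_exists_dyadic (max (max K₁ K₂) 1), hsmall] with r hr hrδ
  obtain ⟨k, hk, hkr, hrk⟩ := hr
  have hr0 := hrδ.1
  -- At scale `k + 1` the return falls inside radius `r`, and it comes after `(1 / 2) ^ k / δ ≥ r /
  -- δ`, hence after the escape.
  obtain ⟨s, hs1, hs2, hs3⟩ := hK₂ (k + 1) (by omega)
  have hd := hK₁ (k + 2) (by omega)
  have hs0 : 0 < s := lt_trans (by positivity) hs1
  refine ⟨s, hs0, returnTime_le ((hx.escapeTime_le hδ hr0 hrδ.2.le).trans_lt ?_) (hs3.trans hkr), ?_⟩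
  · refine (ENNReal.ofReal_lt_ofReal_iff hs0).2 (lt_of_le_of_lt ?_ hs1)
    rw [pow_succ]
    calc r / δ ≤ (1 / 2) ^ k / δ := by gcongr
      _ = _ := by ring
  have e4 : (4 : ℝ) * (1 / 2) ^ (k + 2) = (1 / 2) ^ k := by rw [pow_add]; ring
  rw [e4] at hd
  have hmain : s * m r ≤ q ^ (2 * k + 3) * r := by
    calc s * m r ≤ s * m ((1 / 2) ^ k) := by gcongr; exact hm hrk
      _ ≤ s * (q ^ (k + 2) * m ((1 / 2) ^ (k + 2))) := by gcongr
      _ = q ^ (k + 2) * (s * m ((1 / 2) ^ (k + 1 + 1))) := by ring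
      _ ≤ q ^ (k + 2) * (q ^ (k + 1) * (1 / 2) ^ (k + 1)) := by gcongr
      _ = q ^ (2 * k + 3) * (1 / 2) ^ (k + 1) := by ring
      _ ≤ q ^ (2 * k + 3) * r := by gcongr
  have h1 := Real.log_le_log (mul_pos hs0 (hm0 r hr0)) hmain
  rw [Real.log_mul hs0.ne' (hm0 r hr0).ne', Real.log_mul (by positivity) hr0.ne', Real.log_pow] at h1
  push_cast at h1
  have h2 := nat_mul_log_two_le_neg_log hr0 hrk
  have hk1 : (1 : ℝ) ≤ k := by exact_mod_cast (by omega : 1 ≤ k)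
  have h3 : (2 * k + 3) * Real.log q ≤ 5 * k * (η * Real.log 2 / 5) := by
    have := Real.log_pos hq1
    gcongr
    linarith
  nlinarith

/-- The absence of returns before the time predicted by the mass gives a lower bound of the return
time. -/
lemma IsRegularAt.eventually_le_log_returnTime (hx : IsRegularAt Ψ δ x) {m : ℝ → ℝ}
    (hm : Monotone m) (hm0 : ∀ r > 0, 0 < m r)
    (hdouble : ∀ q > 1, ∀ᶠ k : ℕ in atTop, m (4 * (1 / 2) ^ k) ≤ q ^ k * m ((1 / 2) ^ k))
    {B : ℝ} (hB : 1 ≤ B) (hmB : ∀ᶠ k : ℕ in atTop, B⁻¹ ^ k ≤ m ((1 / 2) ^ k))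
    {c : ℝ} (hc : 0 ≤ c) (hc1 : c < 1) (hmc : ∀ᶠ k : ℕ in atTop, m ((1 / 2) ^ k) * 2 ^ k ≤ c ^ k)
    (hret : ∀ b β : ℝ, 0 < b → b < 1 → 1 ≤ β → β < 2 → ∀ᶠ k : ℕ in atTop, ∀ i : ℕ,
      2 ^ i * m ((1 / 2) ^ k) * 2 ^ k ≤ b ^ k →
        ∀ t ∈ Ioo δ (β ^ i), (1 / 2) ^ k ≤ dist (Ψ t x) x)
    {η : ℝ} (hη : 0 < η) :
    ∀ᶠ r in 𝓝[>] 0, ∃ s, 0 < s ∧ ENNReal.ofReal s ≤ returnTime Ψ r x ∧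
      Real.log r - Real.log (m r) - η * (-Real.log r) ≤ Real.log s := by
  have hlog2 : 0 < Real.log 2 := Real.log_pos (by norm_num)
  have hlogB : 0 ≤ Real.log B := Real.log_nonneg hB
  set e := η * Real.log 2 / 8 with he
  have he0 : 0 < e := by positivity
  obtain ⟨q, hq1, hq⟩ := exists_one_lt_log_le he0
  -- `b ≥ c` makes `b ^ k / (2 ^ k * m ((1 / 2) ^ k))` at least 1, so that it lies between
  -- consecutive powers of 2; `b ≥ exp (-e)` limits the loss.
  set b := max c (Real.exp (-e)) with hb
  have hb0 : 0 < b := lt_max_of_lt_right (Real.exp_pos _)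
  have hb1 : b < 1 := max_lt hc1 (by simpa using he0)
  have hlogb : -e ≤ Real.log b := by
    rw [Real.le_log_iff_exp_le hb0]; exact le_max_right _ _
  -- `β = 2 ^ (1 - ε)` costs `ε * (-log (m r))`, which the polynomial lower bound on the mass keeps
  -- below `2 * k * e`. All losses together stay below `8 * k * e ≤ η * (-log r)`.
  set ε := min 1 (e / (Real.log B + 1)) with hε
  have hε0 : 0 < ε := lt_min one_pos (by positivity)
  have hε1 : ε ≤ 1 := min_le_left _ _
  have hεB : ε * Real.log B ≤ e := by
    have : ε ≤ e / (Real.log B + 1) := min_le_right _ _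
    rw [le_div_iff₀ (by positivity)] at this
    nlinarith
  set β := Real.exp ((1 - ε) * Real.log 2) with hβ
  have hβ1 : 1 ≤ β := Real.one_le_exp (mul_nonneg (by linarith) hlog2.le)
  have hβ2 : β < 2 := by
    rw [← Real.lt_log_iff_exp_lt (by norm_num)]; nlinarith
  obtain ⟨K₁, hK₁⟩ := eventually_atTop.1 (hdouble q hq1)
  obtain ⟨K₂, hK₂⟩ := eventually_atTop.1 (hret b β hb0 hb1 hβ1 hβ2)
  obtain ⟨K₃, hK₃⟩ := eventually_atTop.1 (hmB.and hmc)
  obtain ⟨K₄, hK₄⟩ := exists_nat_ge (8 / η)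
  filter_upwards [eventually_exists_dyadic (max (max K₁ K₂) (max K₃ (max K₄ 1))),
    self_mem_nhdsWithin] with r hr hr0
  rw [mem_Ioi] at hr0
  obtain ⟨k, hk, hkr, hrk⟩ := hr
  have hmk := hm0 ((1 / 2) ^ k) (by positivity)
  obtain ⟨i, hi1, hi2⟩ := exists_nat_pow_near (x := b ^ k / (2 ^ k * m ((1 / 2) ^ k))) (by
    rw [one_le_div (by positivity), mul_comm]
    refine ((hK₃ k (by omega)).2).trans ?_
    gcongr
    exact le_max_left _ _) (show (1 : ℝ) < 2 by norm_num)
  have hnot := hK₂ k (by omega) i (by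
    rw [le_div_iff₀ (by positivity)] at hi1
    linarith)
  refine ⟨β ^ i, by positivity, hx.le_returnTime fun t ht => hrk.trans (hnot t ht), ?_⟩
  have e4 : (4 : ℝ) * (1 / 2) ^ (k + 1) = 2 * (1 / 2) ^ k := by rw [pow_succ]; ring
  have hmr := hm0 r hr0
  have hd : m ((1 / 2) ^ k) ≤ q ^ (k + 1) * m r := by
    calc m ((1 / 2) ^ k) ≤ m (4 * (1 / 2) ^ (k + 1)) := hm (by
          rw [e4]; linarith [show (0 : ℝ) < (1 / 2) ^ k by positivity])
      _ ≤ q ^ (k + 1) * m ((1 / 2) ^ (k + 1)) := hK₁ (k + 1) (by omega)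
      _ ≤ _ := by gcongr; exact hm hkr.le
  have h1 := Real.log_le_log hmk hd
  rw [Real.log_mul (by positivity) hmr.ne', Real.log_pow] at h1
  have h2 := (Real.log_lt_log (by positivity) hi2).le
  rw [Real.log_div (by positivity) (by positivity), Real.log_mul (by positivity) hmk.ne',
    Real.log_pow, Real.log_pow, Real.log_pow] at h2
  have h3 : -Real.log (m r) ≤ (k + 1) * Real.log B := by
    have := Real.log_le_log (by positivity) (((hK₃ (k + 1) (by omega)).1).trans (hm hkr.le))
    rw [Real.log_pow, Real.log_inv] at this
    push_cast at this
    linarith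
  have h4 := nat_mul_log_two_le_neg_log hr0 hrk
  push_cast at h1 h2
  rw [Real.log_pow, hβ, Real.log_exp]
  have hk1 : (1 : ℝ) ≤ k := by exact_mod_cast (by omega : 1 ≤ k)
  have hk8 : 8 / η ≤ k := hK₄.trans (by exact_mod_cast (by omega : K₄ ≤ k))
  rw [div_le_iff₀ hη] at hk8
  have hke : 0 ≤ k * e := by positivity
  have h5 : Real.log 2 ≤ k * e := by
    calc Real.log 2 = 8 * (Real.log 2 / 8) := by ring
      _ ≤ k * η * (Real.log 2 / 8) := by gcongr
      _ = k * e := by rw [he]; ring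
  have h6 : (k + 1) * Real.log q ≤ 2 * k * e := by
    have := Real.log_pos hq1
    gcongr; linarith
  have h7 : k * -e ≤ k * Real.log b := mul_le_mul_of_nonneg_left hlogb (by positivity)
  have h9 : ε * (-Real.log (m r)) ≤ 2 * k * e := by
    calc ε * (-Real.log (m r)) ≤ ε * ((k + 1) * Real.log B) := by gcongr
      _ = (k + 1) * (ε * Real.log B) := by ring
      _ ≤ 2 * k * e := by gcongr; linarith
  have h10 : 8 * (k * e) ≤ η * (-Real.log r) := by
    calc 8 * (k * e) = η * (k * Real.log 2) := by rw [he]; ring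
      _ ≤ _ := by gcongr
  have hlr : 0 ≤ -Real.log r := le_trans (by positivity) h4
  have h11 : -Real.log (m r) + Real.log r - 4 * (k * e) ≤ (i : ℝ) * Real.log 2 := by linarith
  have h12 : (1 - ε) * (-Real.log (m r) + Real.log r - 4 * (k * e)) ≤
      (1 - ε) * (i * Real.log 2) := mul_le_mul_of_nonneg_left h11 (by linarith)
  have h13 : 0 ≤ ε * (-Real.log r) := by positivity
  have h14 : 0 ≤ ε * (4 * (k * e)) := by positivity
  linarith

end ReturnTime

/-! ### Replacing `ρ` by `ν`, for all parameters at once. -/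

section NoReturn

variable {M : Type*} [MetricSpace M] [CompactSpace M] [MeasurableSpace M] [BorelSpace M]
variable {X : Type*} [MetricSpace X] [MeasurableSpace X] [BorelSpace X]

omit [CompactSpace M] [BorelSpace M] in
lemma ofReal_mul_measure_ball_mul_le (ν : Measure M) [IsFiniteMeasure ν] (x : M) (r : ℝ) {a b d : ℝ}
    (ha : 0 ≤ a) (h : a * ν.real (Metric.ball x r) * b ≤ d) :
    ENNReal.ofReal a * ν (Metric.ball x r) * ENNReal.ofReal b ≤ ENNReal.ofReal d := by
  rw [← ofReal_measureReal (μ := ν) (measure_ne_top _ _), ← ENNReal.ofReal_mul ha,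
    ← ENNReal.ofReal_mul (by positivity)]
  exact ENNReal.ofReal_le_ofReal h

/-- Almost every nonperiodic regular point, whose balls have a mass of order smaller than their
radius, does not come back to its small balls before the time predicted by their mass. -/
lemma ae_eventually_no_return {Ψ : Flow ℝ M} {ν : Measure M} [IsFiniteMeasure ν] {T : X → X}
    {φ : X → ℝ} {μ : Measure X} [IsProbabilityMeasure μ] {F : X → M} {L : ℝ≥0}
    (hM : IsDoublingSpace M)
    (hT : MeasurePreserving T μ μ) (hφ_pos : ∀ u, 0 < φ u) (hφ_meas : Measurable φ)
    (hφ_int : Integrable φ μ) (hdecay : SuperPolynomialDecay T μ) (hF : IsFlowSection Ψ ν T φ μ F L)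
    (hΨ : ∀ S : ℝ, ∃ C ≥ 1, ∀ s ∈ Icc (-S) S, ∀ t ∈ Icc (-S) S, ∀ x y,
      dist (Ψ s x) (Ψ t y) ≤ C * (|s - t| + dist x y)) {δ : ℝ} (hδ : 0 < δ) :
    ∀ᵐ x ∂ν, IsRegularAt Ψ δ x → (∀ t : ℝ, 0 < t → Ψ t x ≠ x) →
      ∀ c : ℝ, 0 ≤ c → c < 1 →
      (∀ᶠ k : ℕ in atTop, ν.real (Metric.ball x ((1 / 2) ^ k)) * 2 ^ k ≤ c ^ k) →
      ∀ b β : ℝ, 0 < b → b < 1 → 1 ≤ β → β < 2 → ∀ᶠ k : ℕ in atTop, ∀ i : ℕ,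
        2 ^ i * ν.real (Metric.ball x ((1 / 2) ^ k)) * 2 ^ k ≤ b ^ k →
        ∀ t ∈ Ioo δ (β ^ i), (1 / 2) ^ k ≤ dist (Ψ t x) x := by
  obtain ⟨ρ, hρ, Λ, h⟩ := exists_ae_no_early_return hM hT hφ_pos hφ_meas hφ_int hdecay hF hΨ hδ
  -- The almost sure statements are available for countably many parameters only; these sequences
  -- approximate arbitrary `b`, `c` and `β`.
  obtain ⟨u, -, hu1, hu⟩ := exists_seq_strictMono_tendsto' (show (0 : ℝ≥0∞) < 1 by simp)
  obtain ⟨q, -, hq1, hq⟩ := exists_seq_strictAnti_tendsto' (show (1 : ℝ≥0∞) < 2 by norm_num)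
  obtain ⟨v, -, hv1, hv⟩ := exists_seq_strictMono_tendsto' (show (1 : ℝ) < 2 by norm_num)
  -- The subexponential factor in the comparison of `ρ` with `ν` is absorbed by a slightly larger
  -- rate, still below 1.
  have hkey : ∀ e : ℝ≥0∞, e < 1 → ∃ n m, e * q n ≤ u m := by
    intro e he
    have h1 : Tendsto (fun n => e * q n) atTop (𝓝 (e * 1)) :=
      ENNReal.Tendsto.const_mul hq (Or.inl one_ne_zero)
    rw [mul_one] at h1
    obtain ⟨n, hn⟩ := (h1.eventually_lt_const he).exists
    obtain ⟨m, hm⟩ := (hu.eventually_const_lt hn).exists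
    exact ⟨n, m, hm.le⟩
  have hall := ae_all_iff.2 fun n₁ : ℕ => ae_all_iff.2 fun n₂ : ℕ => ae_all_iff.2 fun n₃ : ℕ =>
    ae_all_iff.2 fun l : ℕ => h (u n₁) (u n₂) (v n₃) l (hu1 _).2 (hu1 _).2 (hv1 _).1.le (hv1 _).2
  have hcomp := ae_all_iff.2 fun n : ℕ => ae_eventually_measure_ball_le hM ν ρ (Λ + 1) (hq1 n).1
    ((hq1 n).2.trans_le (by norm_num : (2 : ℝ≥0∞) ≤ 2)).ne_top
  filter_upwards [hall, hcomp] with x hx hxρ hreg hper c hc0 hc hmc b β hb0 hb hβ1 hβ2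
  have hpow : ∀ (w : ℝ) (k n m : ℕ) (y : ℝ≥0∞), 0 ≤ w → ENNReal.ofReal w * q n ≤ u m →
      y ≤ ENNReal.ofReal (w ^ k) → q n ^ k * y ≤ u m ^ k := by
    intro w k n m y hw h1 h2
    rw [ENNReal.ofReal_pow hw] at h2
    calc q n ^ k * y ≤ q n ^ k * ENNReal.ofReal w ^ k := by gcongr
      _ = (ENNReal.ofReal w * q n) ^ k := by rw [mul_pow, mul_comm]
      _ ≤ _ := by gcongr
  obtain ⟨n₁, m₁, hb'⟩ := hkey (ENNReal.ofReal b) (by simpa using hb)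
  obtain ⟨n₂, m₂, hc'⟩ := hkey (ENNReal.ofReal c) (by simpa using hc)
  obtain ⟨n₃, hβ'⟩ := (hv.eventually_const_lt hβ2).exists
  have htwo : ∀ k : ℕ, ENNReal.ofReal (2 ^ k) = 2 ^ k := fun k => by
    rw [ENNReal.ofReal_pow (by norm_num), ENNReal.ofReal_ofNat]
  obtain ⟨l, hl⟩ := eventually_atTop.1 (hmc.and (hxρ n₂))
  have hQ : ∀ k ≥ l, ρ (Metric.ball x (Λ * (1 / 2) ^ k)) * 2 ^ k ≤ u m₂ ^ k := by
    intro k hk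
    obtain ⟨h1, h2⟩ := hl k hk
    have h3 := ofReal_mul_measure_ball_mul_le (d := c ^ k) ν x _ zero_le_one (by rwa [one_mul])
    rw [ENNReal.ofReal_one, one_mul, htwo] at h3
    calc ρ (Metric.ball x (Λ * (1 / 2) ^ k)) * 2 ^ k
        ≤ ρ (Metric.ball x ((Λ + 1) * (1 / 2) ^ k)) * 2 ^ k := by
          gcongr; linarith
      _ ≤ q n₂ ^ k * ν (Metric.ball x ((1 / 2) ^ k)) * 2 ^ k := by gcongr
      _ = q n₂ ^ k * (ν (Metric.ball x ((1 / 2) ^ k)) * 2 ^ k) := by rw [mul_assoc]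
      _ ≤ _ := hpow c k n₂ m₂ _ hc0 hc' h3
  filter_upwards [hx m₁ m₂ n₃ l hreg hper hQ, hxρ n₁] with k hk1 hk2 i hi t ht
  refine hk1 i ?_ t ⟨ht.1, ht.2.trans_le (by gcongr)⟩
  have h3 := ofReal_mul_measure_ball_mul_le ν x _ (by positivity) hi
  rw [htwo, htwo] at h3
  calc 2 ^ i * ρ (Metric.ball x ((Λ + 1) * (1 / 2) ^ k)) * 2 ^ k
      ≤ 2 ^ i * (q n₁ ^ k * ν (Metric.ball x ((1 / 2) ^ k))) * 2 ^ k := by gcongr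
    _ = q n₁ ^ k * (2 ^ i * ν (Metric.ball x ((1 / 2) ^ k)) * 2 ^ k) := by ring
    _ ≤ _ := hpow b k n₁ m₁ _ hb0.le hb' h3

end NoReturn

/-! ### From bounds on logarithms to equality of the rates. -/

section Rates

lemma liminf_le_liminf_of_forall_le_add {α : Type*} {l : Filter α} {u v : α → EReal}
    (h : ∀ η : ℝ, 0 < η → ∀ᶠ r in l, u r ≤ v r + η) : liminf u l ≤ liminf v l := by
  refine le_of_forall_lt fun a ha => ?_
  obtain ⟨a₁, ha₁, ha₁'⟩ := EReal.lt_iff_exists_real_btwn.1 ha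
  obtain ⟨a₂, ha₂, ha₂'⟩ := EReal.lt_iff_exists_real_btwn.1 ha₁
  refine ha₂.trans_le (le_liminf_of_le (by isBoundedDefault) ?_)
  have hη : 0 < a₁ - a₂ := sub_pos.2 (EReal.coe_lt_coe_iff.1 ha₂')
  filter_upwards [h _ hη, eventually_lt_of_lt_liminf ha₁'] with r h1 h2
  by_contra! h3
  have h4 := h2.trans_le h1
  have h5 : v r + ((a₁ - a₂ : ℝ) : EReal) ≤ a₂ + ((a₁ - a₂ : ℝ) : EReal) := by gcongr
  rw [← EReal.coe_add, add_sub_cancel] at h5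
  exact absurd h4 (not_lt.2 h5)

lemma limsup_le_limsup_of_forall_le_add {α : Type*} {l : Filter α} {u v : α → EReal}
    (h : ∀ η : ℝ, 0 < η → ∀ᶠ r in l, u r ≤ v r + η) : limsup u l ≤ limsup v l := by
  refine le_of_forall_gt fun a ha => ?_
  obtain ⟨a₁, ha₁, ha₁'⟩ := EReal.lt_iff_exists_real_btwn.1 ha
  obtain ⟨a₂, ha₂, ha₂'⟩ := EReal.lt_iff_exists_real_btwn.1 ha₁'
  refine lt_of_le_of_lt (limsup_le_of_le (by isBoundedDefault) ?_) ha₂'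
  have hη : 0 < a₂ - a₁ := sub_pos.2 (EReal.coe_lt_coe_iff.1 ha₂)
  filter_upwards [h _ hη, eventually_lt_of_limsup_lt ha₁] with r h1 h2
  refine h1.trans ?_
  have h5 : v r + ((a₂ - a₁ : ℝ) : EReal) ≤ a₁ + ((a₂ - a₁ : ℝ) : EReal) := by gcongr
  rwa [← EReal.coe_add, add_sub_cancel] at h5

lemma continuous_sub_one : Continuous fun y : EReal => y - 1 := by
  refine continuous_iff_continuousAt.2 fun y => ?_
  exact (EReal.continuousAt_add (p := (y, -1)) (Or.inr (EReal.coe_ne_bot (-1)))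
    (Or.inr (EReal.coe_ne_top (-1)))).comp (f := fun y : EReal => (y, (-1 : EReal))) (by fun_prop)

lemma liminf_sub_one {α : Type*} {l : Filter α} [l.NeBot] (v : α → EReal) :
    liminf (fun r => v r - 1) l = liminf v l - 1 := by
  have hmono : Monotone fun y : EReal => y - 1 := fun a b hab => EReal.sub_le_sub hab le_rfl
  exact (hmono.map_liminf_of_continuousAt v continuous_sub_one.continuousAt).symm

lemma limsup_sub_one {α : Type*} {l : Filter α} [l.NeBot] (v : α → EReal) :
    limsup (fun r => v r - 1) l = limsup v l - 1 := by
  have hmono : Monotone fun y : EReal => y - 1 := fun a b hab => EReal.sub_le_sub hab le_rfl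
  exact (hmono.map_limsup_of_continuousAt v continuous_sub_one.continuousAt).symm

variable {M : Type*} [MetricSpace M] [MeasurableSpace M] {ν : Measure M} [IsFiniteMeasure ν] {x : M}

lemma log_measure_ball_div {r : ℝ} (h : 0 < ν.real (Metric.ball x r)) :
    ENNReal.log (ν (Metric.ball x r)) / ((Real.log r : ℝ) : EReal) =
      ((Real.log (ν.real (Metric.ball x r)) / Real.log r : ℝ) : EReal) := by
  rw [← ofReal_measureReal (μ := ν) (measure_ne_top _ _), ENNReal.log_ofReal_of_pos h,
    EReal.coe_div]

lemma recurrenceRate_eq_localDim_sub_one {Ψ : Flow ℝ M}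
    (hm0 : ∀ r > 0, 0 < ν.real (Metric.ball x r))
    (hup : ∀ η : ℝ, 0 < η → ∀ᶠ r in 𝓝[>] 0, ∃ s, 0 < s ∧ returnTime Ψ r x ≤ ENNReal.ofReal s ∧
      Real.log s ≤ Real.log r - Real.log (ν.real (Metric.ball x r)) + η * (-Real.log r))
    (hlow : ∀ η : ℝ, 0 < η → ∀ᶠ r in 𝓝[>] 0, ∃ s, 0 < s ∧ ENNReal.ofReal s ≤ returnTime Ψ r x ∧
      Real.log r - Real.log (ν.real (Metric.ball x r)) - η * (-Real.log r) ≤ Real.log s) :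
    lowerRecurrenceRate Ψ x = lowerLocalDim ν x - 1 ∧
      upperRecurrenceRate Ψ x = upperLocalDim ν x - 1 := by
  set u : ℝ → EReal := fun r => ENNReal.log (returnTime Ψ r x) / ((-Real.log r : ℝ) : EReal)
  set v : ℝ → EReal := fun r => ENNReal.log (ν (Metric.ball x r)) / ((Real.log r : ℝ) : EReal)
  have hsmall : ∀ᶠ r : ℝ in 𝓝[>] 0, r ∈ Ioo (0 : ℝ) 1 := Ioo_mem_nhdsGT one_pos
  have hv : ∀ r ∈ Ioo (0 : ℝ) 1, v r - 1 =
      ((Real.log (ν.real (Metric.ball x r)) / Real.log r - 1 : ℝ) : EReal) := fun r hr => by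
    simp only [v]
    rw [log_measure_ball_div (hm0 r hr.1)]
    simp
  have h1 : ∀ η : ℝ, 0 < η → ∀ᶠ r in 𝓝[>] 0, u r ≤ (v r - 1) + η := by
    intro η hη
    filter_upwards [hup η hη, hsmall] with r ⟨s, hs, hτ, hlog⟩ hr
    have hlr : 0 < -Real.log r := by
      have := Real.log_neg hr.1 hr.2
      linarith
    calc u r ≤ ENNReal.log (ENNReal.ofReal s) / ((-Real.log r : ℝ) : EReal) :=
          EReal.div_le_div_right_of_nonneg (EReal.coe_nonneg.2 hlr.le) (ENNReal.log_monotone hτ)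
      _ = ((Real.log s / -Real.log r : ℝ) : EReal) := by
          rw [ENNReal.log_ofReal_of_pos hs, EReal.coe_div]
      _ ≤ _ := by
          rw [hv r hr, ← EReal.coe_add, EReal.coe_le_coe_iff, div_le_iff₀ hlr]
          have : Real.log r ≠ 0 := by linarith
          refine hlog.trans_eq ?_
          field_simp
          ring
  have h2 : ∀ η : ℝ, 0 < η → ∀ᶠ r in 𝓝[>] 0, (v r - 1) ≤ u r + η := by
    intro η hη
    filter_upwards [hlow η hη, hsmall] with r ⟨s, hs, hτ, hlog⟩ hr
    have hlr : 0 < -Real.log r := by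
      have := Real.log_neg hr.1 hr.2
      linarith
    have h3 : ((Real.log s / -Real.log r : ℝ) : EReal) ≤ u r := by
      rw [EReal.coe_div, ← ENNReal.log_ofReal_of_pos hs]
      exact EReal.div_le_div_right_of_nonneg (EReal.coe_nonneg.2 hlr.le) (ENNReal.log_monotone hτ)
    refine le_trans ?_ (add_le_add h3 le_rfl)
    rw [hv r hr, ← EReal.coe_add, EReal.coe_le_coe_iff, ← sub_le_iff_le_add, le_div_iff₀ hlr]
    have : Real.log r ≠ 0 := by linarith
    refine le_of_eq_of_le ?_ hlog
    field_simp
    ring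
  exact ⟨((liminf_le_liminf_of_forall_le_add h1).antisymm
      (liminf_le_liminf_of_forall_le_add h2)).trans (liminf_sub_one v),
    ((limsup_le_limsup_of_forall_le_add h1).antisymm
      (limsup_le_limsup_of_forall_le_add h2)).trans (limsup_sub_one v)⟩

lemma exists_eventually_measure_ball_mul_le (hm0 : ∀ r > 0, 0 < ν.real (Metric.ball x r))
    (h : 1 < lowerLocalDim ν x) :
    ∃ c : ℝ, 0 ≤ c ∧ c < 1 ∧
      ∀ᶠ k : ℕ in atTop, ν.real (Metric.ball x ((1 / 2) ^ k)) * 2 ^ k ≤ c ^ k := by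
  obtain ⟨a, ha1, ha⟩ := EReal.lt_iff_exists_real_btwn.1 h
  have ha1' : 1 < a := by exact_mod_cast ha1
  have hlog2 : 0 < Real.log 2 := Real.log_pos (by norm_num)
  -- This is `2 ^ (1 - a)`: for `a` below the lower dimension, the mass is eventually at most `2 ^
  -- (-a * k)`.
  refine ⟨Real.exp ((1 - a) * Real.log 2), (Real.exp_pos _).le,
    by simpa using mul_neg_of_neg_of_pos (show 1 - a < 0 by linarith) hlog2, ?_⟩
  have hev := eventually_lt_of_lt_liminf ha
  have htend : Tendsto (fun k : ℕ => (1 / 2 : ℝ) ^ k) atTop (𝓝[>] 0) :=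
    tendsto_nhdsWithin_iff.2 ⟨tendsto_pow_atTop_nhds_zero_of_lt_one (by norm_num) (by norm_num),
      Eventually.of_forall fun k => by simp⟩
  filter_upwards [htend.eventually hev, eventually_ge_atTop 1] with k hk hk1
  have hmk := hm0 ((1 / 2) ^ k) (by positivity)
  rw [log_measure_ball_div hmk, EReal.coe_lt_coe_iff, Real.log_pow, one_div, Real.log_inv] at hk
  have hk1' : (0 : ℝ) < k := by exact_mod_cast hk1
  rw [lt_div_iff_of_neg (by nlinarith)] at hk
  rw [← Real.exp_nat_mul, ← Real.log_le_iff_le_exp (by positivity), Real.log_mul (by positivity)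
    (by positivity), Real.log_pow, one_div]
  linarith

end Rates

/-! ### Masses of balls at almost every point, and the conclusion. -/

section Main

variable {M : Type*} [MetricSpace M] [CompactSpace M] [MeasurableSpace M] [BorelSpace M]

/-- Polynomial lower bounds and the doubling property of a measure, at almost every point. -/
lemma ae_measureReal_ball_bounds (hM : IsDoublingSpace M) (ν : Measure M) [IsFiniteMeasure ν] :
    ∃ B : ℝ, 1 ≤ B ∧ ∀ᵐ x ∂ν, (∀ r > 0, 0 < ν.real (Metric.ball x r)) ∧
      (∀ᶠ k : ℕ in atTop, B⁻¹ ^ k ≤ ν.real (Metric.ball x ((1 / 2) ^ k))) ∧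
      ∀ q > 1, ∀ᶠ k : ℕ in atTop,
        ν.real (Metric.ball x (4 * (1 / 2) ^ k)) ≤ q ^ k * ν.real (Metric.ball x ((1 / 2) ^ k)) := by
  obtain ⟨B, hB, hνB⟩ := ae_eventually_le_measure_ball hM ν
  have hB0 : (0 : ℝ) < B := by exact_mod_cast hB
  obtain ⟨q, -, hq1, hq⟩ := exists_seq_strictAnti_tendsto' (show (1 : ℝ) < 2 by norm_num)
  have hcomp := ae_all_iff.2 fun n : ℕ => ae_eventually_measure_ball_le hM ν ν 4
    (q := ENNReal.ofReal (q n)) (by simpa using (hq1 n).1) ENNReal.ofReal_ne_top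
  refine ⟨B, by exact_mod_cast hB, ?_⟩
  filter_upwards [hνB, hcomp] with x h1 h2
  have hlow : ∀ᶠ k : ℕ in atTop, (B : ℝ)⁻¹ ^ k ≤ ν.real (Metric.ball x ((1 / 2) ^ k)) := by
    filter_upwards [h1] with k hk
    have := ENNReal.toReal_mono (measure_ne_top _ _) hk
    simpa [Measure.real] using this
  refine ⟨fun r hr => ?_, hlow, fun s hs => ?_⟩
  · have hsmall : ∀ᶠ k : ℕ in atTop, (1 / 2 : ℝ) ^ k < r :=
      (tendsto_pow_atTop_nhds_zero_of_lt_one (by norm_num) (by norm_num)).eventually_lt_const hr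
    obtain ⟨k, hk1, hk2⟩ := (hlow.and hsmall).exists
    exact (show (0 : ℝ) < (B : ℝ)⁻¹ ^ k by positivity).trans_le
      (hk1.trans (measureReal_mono (Metric.ball_subset_ball hk2.le)))
  · obtain ⟨n, hn⟩ := (hq.eventually_lt_const hs).exists
    filter_upwards [h2 n] with k hk
    have hq0 : 0 ≤ q n := by linarith [(hq1 n).1]
    have := ENNReal.toReal_mono (by finiteness) hk
    rw [ENNReal.toReal_mul, ENNReal.toReal_pow, ENNReal.toReal_ofReal hq0] at this
    refine this.trans ?_
    change q n ^ k * ν.real _ ≤ _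
    gcongr

end Main

end FlowRecurrence

end

theorem corollary3p6
    {m : ℕ} {M : Type*} [MetricSpace M] [CompactSpace M]
    [ChartedSpace (EuclideanSpace ℝ (Fin m)) M] [IsManifold (𝓡 m) ∞ M]
    [RiemannianBundle (fun x : M => TangentSpace (𝓡 m) x)]
    [IsContMDiffRiemannianBundle (𝓡 m) ∞ (EuclideanSpace ℝ (Fin m))
      (fun x : M => TangentSpace (𝓡 m) x)]
    [IsRiemannianManifold (𝓡 m) M]
    [MeasurableSpace M] [BorelSpace M]
    (Ψ : Flow ℝ M)
    (hΨ : ContMDiff (𝓘(ℝ, ℝ).prod (𝓡 m)) (𝓡 m) 1 (fun p : ℝ × M => Ψ p.1 p.2))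
    (ν : Measure M) [IsProbabilityMeasure ν]
    (hν : ∀ t : ℝ, MeasurePreserving (Ψ t) ν ν)
    {X : Type*} [MetricSpace X] [MeasurableSpace X] [BorelSpace X]
    (μ : Measure X) [IsProbabilityMeasure μ]
    (T : X → X) (hT : MeasurePreserving T μ μ)
    (φ : X → ℝ) (hφ_pos : ∀ u, 0 < φ u) (hφ_meas : Measurable φ) (hφ_int : Integrable φ μ)
    (hdecay : FlowRecurrence.SuperPolynomialDecay T μ)
    (g : X × ℝ → M)
    (hg : FlowRecurrence.IsSuspensionIsomorphism Ψ ν T φ μ g)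
    (hg_lip : FlowRecurrence.IsBWLipschitz T φ g) :
    ∀ᵐ x ∂ν, (∀ t : ℝ, 0 < t → Ψ t x ≠ x) → 1 < FlowRecurrence.lowerLocalDim ν x →
      FlowRecurrence.lowerRecurrenceRate Ψ x = FlowRecurrence.lowerLocalDim ν x - 1 ∧
      FlowRecurrence.upperRecurrenceRate Ψ x = FlowRecurrence.upperLocalDim ν x - 1 := by

  have hM : FlowRecurrence.IsDoublingSpace M := FlowRecurrence.isDoublingSpace_of_riemannian (m := m)
  have hlip := fun S => FlowRecurrence.exists_dist_flow_le (m := m) hΨ S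
  obtain ⟨L, hF⟩ := hg.exists_isFlowSection hφ_pos hφ_meas hφ_int hg_lip
  obtain ⟨B, hB, hball⟩ := FlowRecurrence.ae_measureReal_ball_bounds hM ν
  obtain ⟨q, -, hq1, hq⟩ := exists_seq_strictAnti_tendsto' (show (1 : ℝ) < 2 by norm_num)
  -- The regularity constant depends on `x`, while the almost sure statements fix it beforehand;
  -- countably many values suffice because regularity persists when the constant decreases.
  have hδ : ∀ j : ℕ, (0 : ℝ) < 1 / ((j : ℝ) + 1) := fun j => by positivity
  have hnoret := ae_all_iff.2 fun j : ℕ => FlowRecurrence.ae_eventually_no_return hM hT hφ_pos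
    hφ_meas hφ_int hdecay hF hlip (hδ j)
  have hret := ae_all_iff.2 fun j : ℕ => ae_all_iff.2 fun n : ℕ =>
    FlowRecurrence.ae_eventually_exists_return hM hν (div_pos two_pos (hδ j)) (hq1 n).1
  filter_upwards [hball, hnoret, hret] with x ⟨hm0, hmB, hdouble⟩ hx1 hx2 hper hdim
  obtain ⟨δ, hδ0, hreg⟩ := FlowRecurrence.exists_isRegularAt hΨ (hper 1 one_pos)
  obtain ⟨j, hj⟩ := exists_nat_one_div_lt hδ0
  have hregj := hreg.mono hj.le
  have hmono : Monotone fun r => ν.real (Metric.ball x r) := fun r s hrs =>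
    measureReal_mono (Metric.ball_subset_ball hrs)
  obtain ⟨c, hc0, hc1, hc⟩ := FlowRecurrence.exists_eventually_measure_ball_mul_le hm0 hdim
  refine FlowRecurrence.recurrenceRate_eq_localDim_sub_one hm0 (fun η hη => ?_) (fun η hη => ?_)
  · refine hregj.eventually_log_returnTime_le (hδ j) hmono hm0 hdouble (fun s hs => ?_) hη
    obtain ⟨n, hn⟩ := (hq.eventually_lt_const hs).exists
    filter_upwards [hx2 j n] with k hk
    obtain ⟨t, ht1, ht2, ht3⟩ := hk
    have hq0 : 0 ≤ q n := by linarith [(hq1 n).1]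
    exact ⟨t, ht1, ht2.trans_le (by gcongr), ht3⟩
  · exact hregj.eventually_le_log_returnTime hmono hm0 hdouble hB hmB hc0 hc1 hc
      (hx1 j hregj hper c hc0 hc1 hc) hη
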